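/- Let $0<i,j<1$ be real numbers with $i+j=1$. For $\theta=(\gamma,\delta)\in\mathbb R^2$ let $\mathrm{Bad}_\theta(i,j)$ be the set of points $(x,y)\in\mathbb R^2$ for which there is a constant $c=c(x,y)>0$ such that $$\max\{\|qx-\gamma\|^{1/i},\ \|qy-\delta\|^{1/j}\}>\frac{c}{q}\qquad\text{for all } q\in\mathbb N=\{1,2,3,\dots\},$$ where $\|\cdot\|$ is the distance of a real number to the nearest integer. Let $I\subset\mathbb R$ be a non-degenerate interval (open, closed or half-open, bounded or not), let $f\in C^2(I)$ satisfy $f''(x)\ne 0$ for all $x\in I$, and let $\mathcal C_f=\{(x,f(x)):x\in I\}$ be its graph, a planar curve, equipped with its Riemannian distance (the Euclidean length of the arc between two points). Then for every $\theta\in\mathbb R^2$ the set $\mathrm{Bad}_\theta(i,j)\cap\mathcal C_f$ is a winning subset of $\mathcal C_f$ for Schmidt's game. Here, for $\alpha,\beta\in(0,1)$, the game on a metric space $M$ is played as follows: player B chooses a closed ball $B_0\subset M$ of positive radius; then, alternately, A chooses a closed ball $A_n\subset B_n$ of diameter $\alpha\,\mathrm{diam}(B_n)$ and B chooses a closed ball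 $B_{n+1}\subset A_n$ of diameter $\beta\,\mathrm{diam}(A_n)$. A set $X\subset M$ is $(\alpha,\beta)$-winning if A can play so that, however B plays, $\bigcap_n B_n=\bigcap_n A_n$ is a single point and this point lies in $X$; it is $\alpha$-winning if it is $(\alpha,\beta)$-winning for all $\beta\in(0,1)$; and it is winning if it is $\alpha$-winning for some $\alpha\in(0,1)$. -/

import Mathlib

open Set
open scoped ENNReal

/-! ### Schmidt games in a metric space -/

section Game

variable {M : Type*} [PseudoEMetricSpace M]

/-- `S` is a closed ball of finite positive radius. -/
def IsGameBall (S : Set M) : Prop :=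
  ∃ (x : M) (r : ℝ), 0 < r ∧ S = Metric.closedEBall x (ENNReal.ofReal r)

/-- `T` is a legal answer to `S` with ratio `t`: a closed ball contained in `S` whose diameter is
`t` times the diameter of `S`. -/
def IsGameMove (t : ℝ) (S T : Set M) : Prop :=
  IsGameBall T ∧ T ⊆ S ∧ Metric.ediam T = ENNReal.ofReal t * Metric.ediam S

/-- `X` is `(α, β)`-winning for Schmidt's game. A strategy `σ` of the first player (A) prescribes
her `n`-th ball from the balls `B 0, …, B n` which her opponent has chosen so far. It is required
that her answers are legal as long as the opponent has played legally, and that in every infinite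
legal play the intersection of the balls is a single point, lying in `X`. -/
def IsAlphaBetaWinning (α β : ℝ) (X : Set M) : Prop :=
  ∃ σ : (n : ℕ) → (Fin (n + 1) → Set M) → Set M,
    ∀ B : ℕ → Set M, IsGameBall (B 0) →
      (∀ n : ℕ, (∀ k < n, IsGameMove β (σ k fun l => B l) (B (k + 1))) →
        IsGameMove α (B n) (σ n fun l => B l)) ∧
      ((∀ n : ℕ, IsGameMove β (σ n fun l => B l) (B (n + 1))) →
        ∃ x ∈ X, ⋂ n, B n = {x})

/-- `X` is `α`-winning: it is `(α, β)`-winning for all `β ∈ (0, 1)`. -/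
def IsAlphaWinning (α : ℝ) (X : Set M) : Prop :=
  ∀ β : ℝ, 0 < β → β < 1 → IsAlphaBetaWinning α β X

/-- `X` is winning: it is `α`-winning for some `α ∈ (0, 1)`. -/
def IsWinning (X : Set M) : Prop :=
  ∃ α : ℝ, 0 < α ∧ α < 1 ∧ IsAlphaWinning α X

end Game

/-! ### Badly approximable points -/

/-- The distance of a real number to the nearest integer. -/
noncomputable def distInt (t : ℝ) : ℝ := |t - round t|

/-- The set of points `(x, y)` of the plane for which there is `c > 0` such that
`max (‖q x - γ‖ ^ (1 / i)) (‖q y - δ‖ ^ (1 / j)) > c / q` for all integers `q ≥ 1`. -/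
noncomputable def Bad (i j γ δ : ℝ) : Set (EuclideanSpace ℝ (Fin 2)) :=
  {p | ∃ c : ℝ, 0 < c ∧ ∀ q : ℕ, 1 ≤ q →
    c / (q : ℝ) < max (distInt (q * p 0 - γ) ^ (1 / i)) (distInt (q * p 1 - δ) ^ (1 / j))}

/-! ### Planar curves with the Riemannian (arc length) distance -/

/-- The parametrization `t ↦ (t, f t)` of the graph of `f`. -/
noncomputable def graphPt (f : ℝ → ℝ) (t : ℝ) : EuclideanSpace ℝ (Fin 2) := !₂[t, f t]

/-- The curve `{(x, f x) : x ∈ I}` in the Euclidean plane. -/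
def planarCurve (f : ℝ → ℝ) (I : Set ℝ) : Set (EuclideanSpace ℝ (Fin 2)) := graphPt f '' I

/-- The points of the curve `{(x, f x) : x ∈ I}`, as a type of its own, so that the distance
on it is the one along the curve and not the one restricted from the plane. -/
def CurvePoint (f : ℝ → ℝ) (I : Set ℝ) : Type :=
  {p : EuclideanSpace ℝ (Fin 2) // p ∈ planarCurve f I}

/-- The length of the arc of the graph of `f` over the interval with end points `x` and `y`: the
supremum of the lengths of the inscribed polygons, for the Euclidean norm of the plane. -/
noncomputable def arcLength (f : ℝ → ℝ) (x y : ℝ) : ℝ≥0∞ :=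
  eVariationOn (graphPt f) (uIcc x y)

theorem arcLength_self (f : ℝ → ℝ) (x : ℝ) : arcLength f x x = 0 := by
  unfold arcLength
  rw [uIcc_self]
  exact eVariationOn.subsingleton _ subsingleton_singleton

theorem arcLength_comm (f : ℝ → ℝ) (x y : ℝ) : arcLength f x y = arcLength f y x := by
  unfold arcLength
  rw [uIcc_comm]

theorem arcLength_add (f : ℝ → ℝ) {x y z : ℝ} (hxy : x ≤ y) (hyz : y ≤ z) :
    arcLength f x y + arcLength f y z = arcLength f x z := by
  unfold arcLength
  rw [uIcc_of_le hxy, uIcc_of_le hyz, uIcc_of_le (hxy.trans hyz)]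
  simpa using eVariationOn.Icc_add_Icc (graphPt f) hxy hyz (mem_univ y)

theorem arcLength_triangle (f : ℝ → ℝ) (x y z : ℝ) :
    arcLength f x z ≤ arcLength f x y + arcLength f y z := by
  wlog hxz : x ≤ z generalizing x z
  · have h := this z x (le_of_not_ge hxz)
    rw [arcLength_comm f x z, arcLength_comm f x y, arcLength_comm f y z, add_comm]
    exact h
  rcases le_total x y with hxy | hyx
  · rcases le_total y z with hyz | hzy
    · exact (arcLength_add f hxy hyz).ge
    · rw [← arcLength_add f hxz hzy, add_assoc]
      exact le_self_add
  · rw [← arcLength_add f hyx hxz, ← add_assoc]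
    exact le_add_self

theorem edist_graphPt_le_arcLength (f : ℝ → ℝ) (x y : ℝ) :
    edist (graphPt f x) (graphPt f y) ≤ arcLength f x y :=
  eVariationOn.edist_le _ left_mem_uIcc right_mem_uIcc

/-- The curve carries the Riemannian distance: the distance of two points is the length of the arc
of the curve between them. -/
noncomputable instance (f : ℝ → ℝ) (I : Set ℝ) : EMetricSpace (CurvePoint f I) where
  edist p q := arcLength f (p.1 0) (q.1 0)
  edist_self p := arcLength_self f _
  edist_comm p q := arcLength_comm f _ _
  edist_triangle p q r := arcLength_triangle f _ _ _
  eq_of_edist_eq_zero {p q} h := by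
    have h0 : edist (graphPt f (p.1 0)) (graphPt f (q.1 0)) = 0 :=
      le_antisymm ((edist_graphPt_le_arcLength f _ _).trans h.le) bot_le
    have h1 : graphPt f (p.1 0) = graphPt f (q.1 0) := eq_of_edist_eq_zero h0
    obtain ⟨p, s, hs, rfl⟩ := p
    obtain ⟨q, t, ht, rfl⟩ := q
    apply Subtype.ext
    simpa [graphPt] using h1

/-! ### Schmidt's game on a space isometric to an interval -/

section GameLemmas

variable {M : Type*} [PseudoEMetricSpace M] {φ : M → ℝ}

/-! Signed arc length turns the game on the curve into a game on an interval, where every ball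
offers A two answers of ratio 1/4 that are a quarter of its diameter apart. Suppose that each
dangerous set is announced at least ten rounds before its deadline `N`, and meets the ball in play
at that stage in at most four clusters of the size of a ball of stage `N`. A cluster whose deadline
is still to come cannot meet both answers. Give it the weight `(2/3) ^ (rounds left)` and always
move to the lighter side: the total weight never exceeds 1, and no cluster survives its deadline
(`isAlphaWinning_of_clusters`).

The dangerous sets come from Diophantine approximation. After exchanging the coordinates if
necessary, `j ≤ i`. A point at which the constant `exp (-(1 + 3 ε) ℓ)` fails is near a shifted
rational point. Two shifted rational points of the same stage near one ball differ by an ordinary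
rational point, so they yield a single cluster as soon as the ball stays away from ordinary rational
points of moderate height (`abs_sub_le_of_mem_shiftedSet`).

To stay away from those, Minkowski's theorem puts a rational point of denominator `q` on an integral
line with `|A| ≤ q ^ i` and `|B| ≤ q ^ j`. The slope form `A + B m` is the derivative of the line
form along the curve. If it is not too small (steep), the curve crosses the line transversally and
the nearby points form one cluster. If it is small (flat), the curvature makes the line form grow
quadratically and the nearby points form two clusters, one on each side of the tangency.

Many lines may share a stage and a deadline, and they have to produce the same clusters. For large
slope forms, integrality forces the rational point of one line onto the other. Otherwise the lines
are proportional, since their intersection would be a rational point too close to the curve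
(`AvoidsRationals.cross_eq_zero`). The argument is inductive: a ball that misses all sets with
deadline at most `n` avoids rational points at its own scale (`avoidsRationals_of_notMem`), and this
makes the sets announced at stage `n` split into few clusters.

The slope threshold `exp (-μ ℓ - ν L)` must suit both kinds of lines. Up to small losses this asks
for `1 / (2 (1 + i)) < μ < 1 / (2 + i)`, which is possible because `i > 0`. -/

theorem closedEBall_eq_preimage (hφ : Isometry φ) (x : M) {r : ℝ} (hr : 0 ≤ r) :
    Metric.closedEBall x (ENNReal.ofReal r) = φ ⁻¹' Icc (φ x - r) (φ x + r) := by
  rw [← hφ.preimage_closedEBall, Metric.closedEBall_ofReal hr, Real.closedBall_eq_Icc]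

theorem IsGameBall.image_eq (hφ : Isometry φ) {B : Set M} (hB : IsGameBall B) :
    ∃ c r : ℝ, 0 < r ∧ c ∈ range φ ∧ φ '' B = Icc (c - r) (c + r) ∩ range φ := by
  obtain ⟨x, r, hr, rfl⟩ := hB
  refine ⟨φ x, r, hr, mem_range_self x, ?_⟩
  rw [closedEBall_eq_preimage hφ x hr.le, image_preimage_eq_inter_range]

/-- A ball may be cut off by an end of the range, so its diameter need not be twice its radius. It
is still positive, because an interval with more than one point has points arbitrarily close to the
centre. -/
theorem IsGameBall.exists_ediam_eq (hφ : Isometry φ) (hord : (range φ).OrdConnected)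
    (hnt : (range φ).Nontrivial) {B : Set M} (hB : IsGameBall B) :
    ∃ D : ℝ, 0 < D ∧ Metric.ediam B = ENNReal.ofReal D := by
  obtain ⟨c, r, hr, hc, him⟩ := hB.image_eq hφ
  have hb : Bornology.IsBounded (φ '' B) := him ▸ (Metric.isBounded_Icc _ _).subset inter_subset_left
  have hcB : c ∈ φ '' B := him ▸ ⟨⟨by linarith, by linarith⟩, hc⟩
  have hne : ∃ y ∈ φ '' B, y ≠ c := by
    obtain ⟨y, hy, hyc⟩ := hnt.exists_ne c
    rcases lt_or_gt_of_ne hyc with h | h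
    · refine ⟨max y (c - r), ?_, (max_lt h (by linarith)).ne⟩
      rw [him]
      exact ⟨⟨le_max_right _ _, (max_lt h (by linarith)).le.trans (by linarith)⟩,
        hord.out hy hc ⟨le_max_left _ _, (max_lt h (by linarith)).le⟩⟩
    · refine ⟨min y (c + r), ?_, (lt_min h (by linarith)).ne'⟩
      rw [him]
      exact ⟨⟨le_trans (by linarith) (lt_min h (by linarith)).le, min_le_right _ _⟩,
        hord.out hc hy ⟨(lt_min h (by linarith)).le, min_le_left _ _⟩⟩
  obtain ⟨y, hy, hyc⟩ := hne
  refine ⟨sSup (φ '' B) - sInf (φ '' B), ?_, ?_⟩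
  · have h1 := csInf_le hb.bddBelow hcB
    have h2 := le_csSup hb.bddAbove hcB
    have h3 := csInf_le hb.bddBelow hy
    have h4 := le_csSup hb.bddAbove hy
    rcases lt_or_gt_of_ne hyc with h | h <;> linarith
  · rw [← hφ.ediam_image, Real.ediam_eq hb]

/-- Two legal answers far apart, both in the interior of the given ball. -/
theorem IsGameBall.exists_two_moves (hφ : Isometry φ) (hord : (range φ).OrdConnected)
    {B : Set M} (hB : IsGameBall B) {D : ℝ} (hD : 0 < D)
    (hBD : Metric.ediam B = ENNReal.ofReal D) :
    ∃ (A A' : Set M) (u : ℝ), IsGameMove (1 / 4) B A ∧ IsGameMove (1 / 4) B A' ∧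
      Ioo u (u + D) ⊆ φ '' B ∧
      φ '' A = Icc (u + D / 8) (u + 3 * D / 8) ∧ φ '' A' = Icc (u + 5 * D / 8) (u + 7 * D / 8) := by
  obtain ⟨c, r, hr, hc, him⟩ := hB.image_eq hφ
  have hb : Bornology.IsBounded (φ '' B) := him ▸ (Metric.isBounded_Icc _ _).subset inter_subset_left
  have hne : (φ '' B).Nonempty := ⟨c, him ▸ ⟨⟨by linarith, by linarith⟩, hc⟩⟩
  have hoc : (φ '' B).OrdConnected := him ▸ ordConnected_Icc.inter hord
  have hDe : sSup (φ '' B) - sInf (φ '' B) = D := by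
    rw [← hφ.ediam_image, Real.ediam_eq hb] at hBD
    exact (ENNReal.ofReal_eq_ofReal_iff (sub_nonneg.2 (Real.sInf_le_sSup _ hb.bddBelow hb.bddAbove))
      hD.le).1 hBD
  set u := sInf (φ '' B) with hu
  have hIoo : Ioo u (u + D) ⊆ φ '' B := by
    rintro t ⟨h1, h2⟩
    obtain ⟨y, hy, hyt⟩ := exists_lt_of_csInf_lt hne h1
    obtain ⟨z, hz, hzt⟩ := exists_lt_of_lt_csSup hne (show t < sSup (φ '' B) by linarith)
    exact hoc.out hy hz ⟨hyt.le, hzt.le⟩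
  -- Radius `D / 8` gives diameter `D / 4`. The bounds on `s` keep the ball strictly inside, so no
  -- end of the range truncates it.
  have key : ∀ s : ℝ, D / 8 < s → s < 7 * D / 8 →
      ∃ A, IsGameMove (1 / 4) B A ∧ φ '' A = Icc (u + s - D / 8) (u + s + D / 8) := by
    intro s h1 h2
    obtain ⟨z, hz, hzs⟩ := hIoo (show u + s ∈ Ioo u (u + D) from ⟨by linarith, by linarith⟩)
    have hsub : Icc (u + s - D / 8) (u + s + D / 8) ⊆ φ '' B := fun t ht =>
      hIoo ⟨by linarith [ht.1], by linarith [ht.2]⟩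
    have hA : φ '' Metric.closedEBall z (ENNReal.ofReal (D / 8)) =
        Icc (u + s - D / 8) (u + s + D / 8) := by
      rw [closedEBall_eq_preimage hφ z (by linarith), image_preimage_eq_inter_range, hzs,
        inter_eq_left]
      exact hsub.trans (image_subset_range _ _)
    refine ⟨Metric.closedEBall z (ENNReal.ofReal (D / 8)), ⟨⟨z, D / 8, by linarith, rfl⟩, ?_, ?_⟩, hA⟩
    -- `φ` need not be injective on a pseudometric space; the inclusion of images lifts because `B`
    -- is a preimage under `φ`.
    · obtain ⟨x, r', hr', rfl⟩ := hB
      intro p hp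
      have : φ p ∈ φ '' Metric.closedEBall x (ENNReal.ofReal r') := hsub (hA ▸ mem_image_of_mem φ hp)
      obtain ⟨p', hp', hpp⟩ := this
      rw [closedEBall_eq_preimage hφ x hr'.le] at hp' ⊢
      simpa [hpp] using hp'
    · rw [← hφ.ediam_image, hA, Real.ediam_Icc, hBD, ← ENNReal.ofReal_mul (by norm_num)]
      congr 1; ring
  obtain ⟨A, hA, hA'⟩ := key (D / 4) (by linarith) (by linarith)
  obtain ⟨A₂, hA₂, hA₂'⟩ := key (3 * D / 4) (by linarith) (by linarith)
  refine ⟨A, A₂, u, hA, hA₂, hIoo, ?_, ?_⟩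
  · rw [hA']; congr 1 <;> ring
  · rw [hA₂']; congr 1 <;> ring

end GameLemmas

/-! ### The potential of the remaining clusters, and the winning criterion -/

section Potential

variable {M : Type*}

/-- The factor by which the weight of a cluster decreases with each round left. -/
noncomputable def decay : ℝ≥0∞ := ENNReal.ofReal (2 / 3)

/-- The potential of a set `S` at stage `n`: the clusters `C n' N a` born at stage `n' ≤ n` with
deadline `N > n` which meet `S` are counted with weight `decay ^ (N - n)`. -/
noncomputable def potential (C : ℕ → ℕ → Fin 4 → Set M) (n : ℕ) (S : Set M) : ℝ≥0∞ :=
  open Classical in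
  ∑' t : ℕ × ℕ × Fin 4,
    if (1 ≤ t.1 ∧ t.1 ≤ n ∧ t.1 + 10 ≤ t.2.1 ∧ n < t.2.1) ∧ (C t.1 t.2.1 t.2.2 ∩ S).Nonempty
    then decay ^ (t.2.1 - n) else 0

/-- Only clusters born by stage `n` are counted, so a strategy based on the potential uses nothing
but the past of the play. -/
theorem potential_congr {C C' : ℕ → ℕ → Fin 4 → Set M} {n : ℕ} (h : ∀ l ≤ n, C l = C' l)
    (S : Set M) : potential C n S = potential C' n S := by
  unfold potential
  refine tsum_congr fun t => ?_
  by_cases ht : t.1 ≤ n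
  · rw [h _ ht]
  · simp [ht]

theorem potential_mono (C : ℕ → ℕ → Fin 4 → Set M) (n : ℕ) {S S' : Set M} (h : S ⊆ S') :
    potential C n S ≤ potential C n S' := by
  unfold potential
  refine ENNReal.tsum_le_tsum fun t => ?_
  split_ifs with h1 h2
  · exact le_rfl
  · exact absurd ⟨h1.1, h1.2.mono (inter_subset_inter_right _ h)⟩ h2
  · exact zero_le
  · exact le_rfl

theorem potential_zero (C : ℕ → ℕ → Fin 4 → Set M) (S : Set M) : potential C 0 S = 0 := by
  unfold potential
  rw [ENNReal.tsum_eq_zero]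
  intro t
  rw [if_neg]
  rintro ⟨⟨h1, h2, -⟩, -⟩
  omega

/-- Each cluster still to be avoided is counted on at most one of the two sides. -/
theorem potential_add_le {C : ℕ → ℕ → Fin 4 → Set M} {n : ℕ} {S A A' : Set M} (hA : A ⊆ S)
    (hA' : A' ⊆ S)
    (h : ∀ n' N a, n < N → (C n' N a ∩ A).Nonempty → ¬ (C n' N a ∩ A').Nonempty) :
    potential C n A + potential C n A' ≤ potential C n S := by
  unfold potential
  rw [← ENNReal.tsum_add]
  refine ENNReal.tsum_le_tsum fun t => ?_
  by_cases h0 : (1 ≤ t.1 ∧ t.1 ≤ n ∧ t.1 + 10 ≤ t.2.1 ∧ n < t.2.1)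
  · by_cases h1 : (C t.1 t.2.1 t.2.2 ∩ A).Nonempty
    · have h2 := h _ _ _ h0.2.2.2 h1
      rw [if_pos ⟨h0, h1⟩, if_neg fun h => h2 h.2,
        if_pos ⟨h0, h1.mono (inter_subset_inter_right _ hA)⟩, add_zero]
    · by_cases h2 : (C t.1 t.2.1 t.2.2 ∩ A').Nonempty
      · rw [if_neg fun h => h1 h.2, if_pos ⟨h0, h2⟩,
          if_pos ⟨h0, h2.mono (inter_subset_inter_right _ hA')⟩, zero_add]
      · rw [if_neg fun h => h1 h.2, if_neg fun h => h2 h.2, zero_add]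
        exact zero_le
  · rw [if_neg fun h => h0 h.1, if_neg fun h => h0 h.1, zero_add]
    exact zero_le

/-- Four clusters for each deadline at least ten rounds ahead weigh `4 * 3 * (2 / 3) ^ 10 ≈ 0.21` in
total; this is the reason for the delay of ten rounds. -/
theorem tsum_decay_le : (4 : ℝ≥0∞) * ∑' k : ℕ, decay ^ (k + 10) ≤ ENNReal.ofReal (1 / 4) := by
  have h1 : (fun k : ℕ => decay ^ (k + 10)) = fun k => decay ^ 10 * decay ^ k :=
    funext fun k => by rw [pow_add, mul_comm]
  rw [h1]
  rw [ENNReal.tsum_mul_left, ENNReal.tsum_geometric]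
  have h2 : (1 : ℝ≥0∞) - decay = ENNReal.ofReal (1 / 3) := by
    rw [decay, ← ENNReal.ofReal_one, ← ENNReal.ofReal_sub _ (by norm_num)]
    norm_num
  rw [h2, ← ENNReal.ofReal_inv_of_pos (by norm_num), decay, ← ENNReal.ofReal_pow (by norm_num),
    ← ENNReal.ofReal_mul (by positivity), show (4 : ℝ≥0∞) = ENNReal.ofReal 4 by norm_num,
    ← ENNReal.ofReal_mul (by norm_num)]
  apply ENNReal.ofReal_le_ofReal
  norm_num

/-- With one round less to go each weight grows by the factor 3/2, clusters whose deadline has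
arrived drop out, and the clusters born at stage `n + 1` weigh at most 1/4. -/
theorem potential_succ_le (C : ℕ → ℕ → Fin 4 → Set M) (n : ℕ) (S : Set M) :
    potential C (n + 1) S ≤ ENNReal.ofReal (3 / 2) * potential C n S + ENNReal.ofReal (1 / 4) := by
  classical
  have hnew : ∑' t : ℕ × ℕ × Fin 4,
      (if t.1 = n + 1 ∧ n + 1 + 10 ≤ t.2.1 then decay ^ (t.2.1 - (n + 1)) else 0) ≤
      ENNReal.ofReal (1 / 4) := by
    refine le_trans (le_of_eq ?_) tsum_decay_le
    rw [ENNReal.tsum_prod', tsum_eq_single (n + 1) (fun m hm => by simp [hm]), ENNReal.tsum_prod']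
    simp only [true_and, tsum_fintype, Finset.sum_const, Finset.card_univ, Fintype.card_fin,
      nsmul_eq_mul]
    rw [ENNReal.tsum_mul_left, ← ENNReal.summable.sum_add_tsum_nat_add' (k := n + 1 + 10)]
    rw [Finset.sum_eq_zero (fun b hb => by
      rw [if_neg]; have := Finset.mem_range.1 hb; omega), zero_add]
    push_cast
    congr 1
    refine tsum_congr fun k => ?_
    rw [if_pos (by omega)]
    congr 1
    omega
  refine le_trans ?_ (add_le_add_right hnew _)
  unfold potential
  rw [← ENNReal.tsum_mul_left, ← ENNReal.tsum_add]
  refine ENNReal.tsum_le_tsum fun t => ?_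
  split_ifs with h1 h2 h3 h3
  · have : ENNReal.ofReal (3 / 2) * decay ^ (t.2.1 - n) = decay ^ (t.2.1 - (n + 1)) := by
      rw [show t.2.1 - n = t.2.1 - (n + 1) + 1 by omega, pow_succ', ← mul_assoc, decay,
        ← ENNReal.ofReal_mul (by norm_num)]
      norm_num
    rw [this]
    exact le_self_add
  · have : ENNReal.ofReal (3 / 2) * decay ^ (t.2.1 - n) = decay ^ (t.2.1 - (n + 1)) := by
      rw [show t.2.1 - n = t.2.1 - (n + 1) + 1 by omega, pow_succ', ← mul_assoc, decay,
        ← ENNReal.ofReal_mul (by norm_num)]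
      norm_num
    rw [this]
    exact le_self_add
  · simp
  · exfalso
    obtain ⟨⟨a1, a2, a3, a4⟩, a5⟩ := h1
    by_cases h4 : t.1 = n + 1
    · exact h3 ⟨h4, by omega⟩
    · exact h2 ⟨⟨a1, by omega, a3, by omega⟩, a5⟩
  all_goals exact zero_le

/-- One round before its deadline, a single cluster already weighs `decay`. -/
theorem disjoint_of_potential_lt {C : ℕ → ℕ → Fin 4 → Set M} {n : ℕ} {S : Set M}
    (h : potential C n S < decay) {n' : ℕ} (h1 : 1 ≤ n') (h2 : n' ≤ n) (h3 : n' + 10 ≤ n + 1)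
    (a : Fin 4) : Disjoint (C n' (n + 1) a) S := by
  classical
  rw [disjoint_iff_inter_eq_empty]
  by_contra hne
  refine absurd h (not_lt.2 ?_)
  unfold potential
  refine le_trans ?_ (ENNReal.le_tsum (n', n + 1, a))
  rw [if_pos ⟨⟨h1, h2, h3, Nat.lt_succ_self n⟩, nonempty_iff_ne_empty.2 hne⟩]
  simp

end Potential

/-- A winning criterion for Schmidt's game on an interval. The sets `T n N` have to be avoided from
stage `N` on, and are taken into account from stage `n` on: a ball of stage `n` which misses all
sets with deadline at most `n` meets `T n N` in at most four clusters whose size is that of a ball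
of stage `N`. -/
theorem isAlphaWinning_of_clusters {M : Type*} [EMetricSpace M] {φ : M → ℝ} (hφ : Isometry φ)
    (hord : (range φ).OrdConnected) (hnt : (range φ).Nontrivial) (X : Set M)
    (h : ∀ β D : ℝ, 0 < β → β < 1 → 0 < D → ∀ B₀ : Set M, IsGameBall B₀ →
      Metric.ediam B₀ = ENNReal.ofReal D → ∃ A₀, IsGameMove (1 / 4) B₀ A₀ ∧ IsCompact A₀ ∧
      ∃ T : ℕ → ℕ → Set M,
        (∀ n N, 1 ≤ n → n + 10 ≤ N → ∀ J ⊆ A₀,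
          Metric.ediam J ≤ ENNReal.ofReal (D * (β / 4) ^ n) →
          (∀ n' N', 1 ≤ n' → n' + 10 ≤ N' → N' ≤ n → Disjoint J (T n' N')) →
          ∃ C : Fin 4 → Set M, J ∩ T n N ⊆ ⋃ a, C a ∧
            ∀ a, Metric.ediam (C a) ≤ ENNReal.ofReal (D * (β / 4) ^ N)) ∧
        (∀ p ∈ A₀, (∀ n N, 1 ≤ n → n + 10 ≤ N → p ∉ T n N) → p ∈ X)) :
    IsAlphaWinning (1 / 4) X := by
  classical
  intro β hβ0 hβ1
  -- All data are chosen as total functions of `B₀`, with junk values off the game balls, so that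
  -- they can enter a strategy.
  have hstart : ∀ B₀ : Set M, ∃ (D : ℝ) (A₀ : Set M) (T : ℕ → ℕ → Set M)
      (Cl : ℕ → ℕ → Set M → Fin 4 → Set M), IsGameBall B₀ →
      0 < D ∧ Metric.ediam B₀ = ENNReal.ofReal D ∧ IsGameMove (1 / 4) B₀ A₀ ∧ IsCompact A₀ ∧
      (∀ n N J a, Metric.ediam (Cl n N J a) ≤ ENNReal.ofReal (D * (β / 4) ^ N)) ∧
      (∀ n N, 1 ≤ n → n + 10 ≤ N → ∀ J ⊆ A₀,
          Metric.ediam J ≤ ENNReal.ofReal (D * (β / 4) ^ n) →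
          (∀ n' N', 1 ≤ n' → n' + 10 ≤ N' → N' ≤ n → Disjoint J (T n' N')) →
          J ∩ T n N ⊆ ⋃ a, Cl n N J a) ∧
      (∀ p ∈ A₀, (∀ n N, 1 ≤ n → n + 10 ≤ N → p ∉ T n N) → p ∈ X) := by
    intro B₀
    by_cases hB : IsGameBall B₀
    swap
    · exact ⟨0, ∅, fun _ _ => ∅, fun _ _ _ _ => ∅, fun h => absurd h hB⟩
    obtain ⟨D, hD, hBD⟩ := hB.exists_ediam_eq hφ hord hnt
    obtain ⟨A₀, hA, hAc, T, hT, hX⟩ := h β D hβ0 hβ1 hD B₀ hB hBD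
    -- Empty clusters serve as default, so the diameter bound holds without any hypothesis on `J`.
    have hC : ∀ n N, ∀ J : Set M, ∃ C : Fin 4 → Set M,
        (∀ a, Metric.ediam (C a) ≤ ENNReal.ofReal (D * (β / 4) ^ N)) ∧
        (1 ≤ n → n + 10 ≤ N → J ⊆ A₀ →
          Metric.ediam J ≤ ENNReal.ofReal (D * (β / 4) ^ n) →
          (∀ n' N', 1 ≤ n' → n' + 10 ≤ N' → N' ≤ n → Disjoint J (T n' N')) →
          J ∩ T n N ⊆ ⋃ a, C a) := by
      intro n N J
      by_cases hc : 1 ≤ n ∧ n + 10 ≤ N ∧ J ⊆ A₀ ∧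
          Metric.ediam J ≤ ENNReal.ofReal (D * (β / 4) ^ n) ∧
          (∀ n' N', 1 ≤ n' → n' + 10 ≤ N' → N' ≤ n → Disjoint J (T n' N'))
      · obtain ⟨C, hC1, hC2⟩ := hT n N hc.1 hc.2.1 J hc.2.2.1 hc.2.2.2.1 hc.2.2.2.2
        exact ⟨C, hC2, fun _ _ _ _ _ => hC1⟩
      · exact ⟨fun _ => ∅, by simp, fun h1 h2 h3 h4 h5 => absurd ⟨h1, h2, h3, h4, h5⟩ hc⟩
    choose Cl hCl1 hCl2 using hC
    exact ⟨D, A₀, T, Cl, fun _ => ⟨hD, hBD, hA, hAc, hCl1,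
      fun n N h1 h2 J => hCl2 n N J h1 h2, hX⟩⟩
  choose D A₀ T Cl hstart using hstart
  have hmoves : ∀ B : Set M, ∃ A A' : Set M, IsGameBall B →
      IsGameMove (1 / 4) B A ∧ IsGameMove (1 / 4) B A' ∧
      ∀ p ∈ A, ∀ p' ∈ A', Metric.ediam B ≤ 4 * edist p p' := by
    intro B
    by_cases hB : IsGameBall B
    swap
    · exact ⟨∅, ∅, fun h => absurd h hB⟩
    obtain ⟨d, hd, hBd⟩ := hB.exists_ediam_eq hφ hord hnt
    obtain ⟨A, A', u, h1, h2, -, h3, h4⟩ := hB.exists_two_moves hφ hord hd hBd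
    refine ⟨A, A', fun _ => ⟨h1, h2, fun p hp p' hp' => ?_⟩⟩
    have e1 : φ p ∈ Icc _ _ := h3 ▸ mem_image_of_mem φ hp
    have e2 : φ p' ∈ Icc _ _ := h4 ▸ mem_image_of_mem φ hp'
    rw [← hφ.edist_eq, edist_dist, hBd, show (4 : ℝ≥0∞) = ENNReal.ofReal 4 by norm_num,
      ← ENNReal.ofReal_mul (by norm_num)]
    apply ENNReal.ofReal_le_ofReal
    rw [Real.dist_eq, abs_sub_comm]
    have := le_abs_self (φ p' - φ p)
    linarith [e1.2, e2.1]
  choose L R hLR using hmoves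
  -- the clusters met so far, in terms of the balls played
  let F : (ℕ → Set M) → ℕ → ℕ → Fin 4 → Set M := fun B n N a => Cl (B 0) n N (B n) a
  let G : (ℕ → Set M) → ℕ → Set M := fun B n =>
    if n = 0 then A₀ (B 0) else
      if potential (F B) n (L (B n)) ≤ potential (F B) n (R (B n)) then L (B n) else R (B n)
  -- The finite history is extended periodically to a sequence; `G` at stage `n` reads only the
  -- indices up to `n`, where nothing changes.
  refine ⟨fun n b => G (fun l => b ⟨l % (n + 1), Nat.mod_lt _ n.succ_pos⟩) n, ?_⟩
  intro B hB0
  obtain ⟨hD, hBD, hA0, hAc, hCl1, hCl2, hwin⟩ := hstart (B 0) hB0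
  have hG : ∀ n, G (fun l => B (l % (n + 1))) n = G B n := by
    intro n
    have h0 : (0 % (n + 1)) = 0 := Nat.zero_mod _
    have hn : n % (n + 1) = n := Nat.mod_eq_of_lt n.lt_succ_self
    have hp : ∀ S, potential (F fun l => B (l % (n + 1))) n S = potential (F B) n S := by
      intro S
      refine potential_congr (fun l hl => ?_) S
      funext N a
      simp only [F]
      rw [h0, Nat.mod_eq_of_lt (Nat.lt_succ_of_le hl)]
    simp only [G, hp, h0, hn]
  simp only [hG]
  have hlegal : ∀ n, IsGameBall (B n) → IsGameMove (1 / 4) (B n) (G B n) := by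
    intro n hn
    simp only [G]
    split_ifs with h1 h2
    · subst h1; exact hA0
    · exact (hLR _ hn).1
    · exact (hLR _ hn).2.1
  have hball : ∀ n, (∀ k < n, IsGameMove β (G B k) (B (k + 1))) → IsGameBall (B n) := by
    intro n hn
    rcases Nat.eq_zero_or_pos n with rfl | hpos
    · exact hB0
    · have := (hn (n - 1) (by omega)).1
      rwa [Nat.sub_add_cancel hpos] at this
  refine ⟨fun n hn => hlegal n (hball n hn), fun hplay => ?_⟩
  have hb : ∀ n, IsGameBall (B n) := fun n => hball n fun k _ => hplay k
  have hdiam : ∀ n, Metric.ediam (B n) = ENNReal.ofReal (D (B 0) * (β / 4) ^ n) := by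
    intro n
    induction n with
    | zero => simpa using hBD
    | succ n ih =>
      rw [(hplay n).2.2, (hlegal n (hb n)).2.2, ih, ← ENNReal.ofReal_mul (by norm_num),
        ← ENNReal.ofReal_mul hβ0.le]
      congr 1
      ring
  have hanti : ∀ n, B (n + 1) ⊆ B n := fun n => (hplay n).2.1.trans (hlegal n (hb n)).2.1
  have hanti' : Antitone B := antitone_nat_of_succ_le hanti
  have hsubA : ∀ n, 1 ≤ n → B n ⊆ A₀ (B 0) := fun n hn =>
    (hanti' hn).trans (by simpa [G] using (hplay 0).2.1)
  have hhalf : ∀ n, 1 ≤ n → 2 * potential (F B) n (G B n) ≤ potential (F B) n (B n) := by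
    intro n hn
    obtain ⟨hl, hr, hsep⟩ := hLR _ (hb n)
    have hadd : potential (F B) n (L (B n)) + potential (F B) n (R (B n)) ≤
        potential (F B) n (B n) := by
      -- Points of the two answers are at least `D * (β / 4) ^ n / 4` apart, which exceeds the
      -- diameter `D * (β / 4) ^ N` of a cluster because `N ≥ n + 1` and `β < 1`.
      refine potential_add_le hl.2.1 hr.2.1 fun n' N a hN => ?_
      rintro ⟨p, hp1, hp2⟩ ⟨p', hp1', hp2'⟩
      have h1 := hsep p hp2 p' hp2'
      have h2 := (Metric.edist_le_ediam_of_mem hp1 hp1').trans (hCl1 n' N (B n') a)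
      rw [hdiam n] at h1
      have h3 := h1.trans (mul_le_mul_right h2 4)
      rw [show (4 : ℝ≥0∞) = ENNReal.ofReal 4 by norm_num, ← ENNReal.ofReal_mul (by norm_num),
        ENNReal.ofReal_le_ofReal_iff (by positivity)] at h3
      have h4 : (β / 4) ^ N ≤ (β / 4) ^ (n + 1) :=
        pow_le_pow_of_le_one (by positivity) (by linarith) hN
      have h5 : 0 < D (B 0) * (β / 4) ^ n := by positivity
      have h6 : D (B 0) * (β / 4) ^ (n + 1) = D (B 0) * (β / 4) ^ n * (β / 4) := by ring
      have h7 := mul_le_mul_of_nonneg_left h4 hD.le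
      nlinarith
    refine le_trans ?_ hadd
    rw [two_mul]
    simp only [G, if_neg (show n ≠ 0 by omega)]
    split_ifs with h1
    · exact add_le_add_right h1 _
    · exact add_le_add_left (not_le.1 h1).le _
  -- The invariant reproduces itself: `3 / 2 * (1 / 2) + 1 / 4 = 1`.
  have hpot : ∀ n, potential (F B) n (B n) ≤ 1 := by
    intro n
    induction n with
    | zero => rw [potential_zero]; exact zero_le
    | succ n ih =>
      have h1 : ENNReal.ofReal (3 / 2) * potential (F B) n (B (n + 1)) ≤ ENNReal.ofReal (3 / 4) := by
        rcases Nat.eq_zero_or_pos n with rfl | hn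
        · simp [potential_zero]
        · have h2 := (mul_le_mul_right (potential_mono (F B) n (hplay n).2.1) 2).trans
            ((hhalf n hn).trans ih)
          calc _ = ENNReal.ofReal (3 / 4) * (2 * potential (F B) n (B (n + 1))) := by
                rw [← mul_assoc, show (2 : ℝ≥0∞) = ENNReal.ofReal 2 by norm_num,
                  ← ENNReal.ofReal_mul (by norm_num)]
                norm_num
            _ ≤ ENNReal.ofReal (3 / 4) * 1 := mul_le_mul_right h2 _
            _ = _ := mul_one _
      refine (potential_succ_le _ n _).trans ((add_le_add_left h1 _).trans ?_)
      rw [← ENNReal.ofReal_add (by norm_num) (by norm_num)]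
      norm_num
  -- After A's move at stage `N - 1` the potential is at most 1/2, less than the weight 2/3 of a
  -- cluster with deadline `N`.
  have hdis : ∀ N n, 1 ≤ n → n + 10 ≤ N → ∀ a, Disjoint (F B n N a) (B N) := by
    intro N n hn hN a
    obtain ⟨m, rfl⟩ : ∃ m, N = m + 1 := ⟨N - 1, by omega⟩
    refine (disjoint_of_potential_lt ?_ hn (by omega : n ≤ m) hN a).mono_right (hplay m).2.1
    have h2 := (hhalf m (by omega)).trans (hpot m)
    have h3 : potential (F B) m (G B m) ≤ ENNReal.ofReal (1 / 2) := by
      calc _ = ENNReal.ofReal (1 / 2) * (2 * potential (F B) m (G B m)) := by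
            rw [← mul_assoc, show (2 : ℝ≥0∞) = ENNReal.ofReal 2 by norm_num,
              ← ENNReal.ofReal_mul (by norm_num)]
            norm_num
        _ ≤ ENNReal.ofReal (1 / 2) * 1 := mul_le_mul_right h2 _
        _ = _ := mul_one _
    refine h3.trans_lt ?_
    rw [decay, ENNReal.ofReal_lt_ofReal_iff (by norm_num)]
    norm_num
  -- Strong induction on the deadline: the covering by clusters at stage `n < N` presupposes that `B
  -- n` misses all sets with deadline at most `n`.
  have hsafe : ∀ N n, 1 ≤ n → n + 10 ≤ N → Disjoint (B N) (T (B 0) n N) := by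
    intro N
    induction N using Nat.strong_induction_on with
    | _ N ih =>
      intro n hn hN
      have hcov := hCl2 n N hn hN (B n) (hsubA n hn) (hdiam n).le fun n' N' h1 h2 h3 =>
        (ih N' (by omega) n' h1 h2).mono_left (hanti' h3)
      rw [Set.disjoint_left]
      intro p hp hpT
      obtain ⟨a, ha⟩ := mem_iUnion.1 (hcov ⟨hanti' (by omega : n ≤ N) hp, hpT⟩)
      exact Set.disjoint_left.1 (hdis N n hn hN a) ha hp
  have hclosed : ∀ n, IsClosed (B n) := by
    intro n
    obtain ⟨x, r, hr, hx⟩ := hb n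
    rw [hx]
    exact Metric.isClosed_closedEBall
  -- The space need not be complete; the common point comes from the compactness of `A₀`.
  obtain ⟨x, hx⟩ := IsCompact.nonempty_iInter_of_sequence_nonempty_isCompact_isClosed
    (fun n => B (n + 1)) (fun n => hanti (n + 1))
    (fun n => by
      obtain ⟨x, r, hr, hx⟩ := hb (n + 1)
      exact ⟨x, hx ▸ Metric.mem_closedEBall_self⟩)
    (hAc.of_isClosed_subset (hclosed 1) (hsubA 1 le_rfl)) (fun n => hclosed (n + 1))
  have hxB : ∀ n, x ∈ B n := fun n => hanti n (mem_iInter.1 hx n)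
  refine ⟨x, hwin x (hsubA 1 le_rfl (hxB 1)) fun n N h1 h2 hxT =>
    Set.disjoint_left.1 (hsafe N n h1 h2) (hxB N) hxT, ?_⟩
  refine Subset.antisymm (fun y hy => ?_) (singleton_subset_iff.2 (mem_iInter.2 hxB))
  have hle : ∀ n, edist y x ≤ ENNReal.ofReal (D (B 0) * (β / 4) ^ n) := fun n =>
    (Metric.edist_le_ediam_of_mem (mem_iInter.1 hy n) (hxB n)).trans (hdiam n).le
  have hlim : Filter.Tendsto (fun n : ℕ => ENNReal.ofReal (D (B 0) * (β / 4) ^ n)) Filter.atTop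
      (nhds 0) := by
    rw [← ENNReal.ofReal_zero]
    refine ENNReal.tendsto_ofReal ?_
    simpa using (tendsto_pow_atTop_nhds_zero_of_lt_one (by positivity : 0 ≤ β / 4)
      (by linarith)).const_mul (D (B 0))
  exact edist_le_zero.1 (ge_of_tendsto' hlim hle)

/-! ### Integral lines through rational points -/

open Real in
/-- Minkowski's theorem in the plane, by the pigeonhole principle: a rational point with denominator
`q` lies on an integral line whose coefficients are at most `q ^ i` and `q ^ j`. -/
theorem exists_line_through {i j : ℝ} (hij : i + j = 1) {q : ℕ} (hq : 1 ≤ q) (u v : ℤ) :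
    ∃ A B C : ℤ, (A ≠ 0 ∨ B ≠ 0) ∧ A * u + B * v + C * q = 0 ∧
      |(A : ℝ)| ≤ exp (i * log q) ∧ |(B : ℝ)| ≤ exp (j * log q) := by
  have hq0 : (0 : ℝ) < q := by exact_mod_cast hq
  have : NeZero q := ⟨by omega⟩
  set a := ⌊exp (i * log q)⌋₊ with ha
  set b := ⌊exp (j * log q)⌋₊ with hb
  have hcard : q < (a + 1) * (b + 1) := by
    have h1 := Nat.lt_floor_add_one (exp (i * log q))
    have h2 := Nat.lt_floor_add_one (exp (j * log q))
    have h3 : exp (i * log q) * exp (j * log q) = q := by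
      rw [← exp_add, ← add_mul, hij, one_mul, exp_log hq0]
    have h4 : (q : ℝ) < ((a + 1) * (b + 1) : ℕ) := by
      push_cast
      rw [← h3]
      exact mul_lt_mul'' h1 h2 (exp_pos _).le (exp_pos _).le
    exact_mod_cast h4
  -- Among more than `q` pairs, two give the same value of `x.1 * u + x.2 * v` modulo `q`; their
  -- difference is `(A, B)`.
  obtain ⟨x, hx, y, hy, hxy, he⟩ := Finset.exists_ne_map_eq_of_card_lt_of_maps_to
    (s := Finset.range (a + 1) ×ˢ Finset.range (b + 1)) (t := (Finset.univ : Finset (ZMod q)))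
    (f := fun z => ((z.1 * u + z.2 * v : ℤ) : ZMod q))
    (by simpa [ZMod.card] using hcard) (fun _ _ => Finset.mem_coe.2 (Finset.mem_univ _))
  simp only [Finset.mem_product, Finset.mem_range] at hx hy
  rw [ZMod.intCast_eq_intCast_iff_dvd_sub] at he
  obtain ⟨C, hC⟩ := he
  have habs : ∀ {s t n : ℕ} {z : ℝ}, 0 ≤ z → n = ⌊z⌋₊ → s < n + 1 → t < n + 1 →
      |(((s : ℤ) - t : ℤ) : ℝ)| ≤ z := by
    intro s t n z hz hn hs ht
    have h1 : |((s : ℤ) - t)| ≤ n := by rw [abs_le]; omega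
    have h2 : (|(((s : ℤ) - t : ℤ) : ℝ)|) ≤ (n : ℝ) := by
      rw [← Int.cast_abs]; exact_mod_cast h1
    exact h2.trans (hn ▸ Nat.floor_le hz)
  refine ⟨(x.1 : ℤ) - y.1, (x.2 : ℤ) - y.2, C, ?_, ?_, ?_, ?_⟩
  · by_contra hcon
    push Not at hcon
    exact hxy (Prod.ext (by omega) (by omega))
  · linear_combination -hC
  · exact habs (exp_pos _).le ha hx.1 hy.1
  · exact habs (exp_pos _).le hb hx.2 hy.2

/-! ### Line forms along a curve with bounded curvature -/

/-- The curve `p ↦ (X p, Y p)`, `p ∈ S`, has slope `m`, bounded by `K`, with respect to the first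
coordinate, and its curvature is bounded from above and below, with sign `σ`. -/
structure IsCurve {ι : Type*} (S : Set ι) (X Y m : ι → ℝ) (K k σ : ℝ) : Prop where
  one_le : 1 ≤ K
  pos : 0 < k
  sign : |σ| = 1
  slope_le : ∀ p ∈ S, |m p| ≤ K
  slope_sub_le : ∀ p ∈ S, ∀ p' ∈ S, |m p' - m p| ≤ K * |X p' - X p|
  taylor_le : ∀ p ∈ S, ∀ p' ∈ S, |Y p' - Y p - m p * (X p' - X p)| ≤ K * |X p' - X p| ^ 2
  le_taylor : ∀ p ∈ S, ∀ p' ∈ S,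
    k * |X p' - X p| ^ 2 ≤ σ * (Y p' - Y p - m p * (X p' - X p))

namespace IsCurve

variable {ι : Type*} {S : Set ι} {X Y m : ι → ℝ} {K k σ : ℝ}

/-- `A + B * m` plays the part of the derivative of `A * X + B * Y + C` along the curve, and only
the coefficient `B` contributes to its variation. -/
theorem abs_slopeForm_sub_le (h : IsCurve S X Y m K k σ) {p p' : ι} (hp : p ∈ S) (hp' : p' ∈ S)
    (A B : ℝ) : |(A + B * m p') - (A + B * m p)| ≤ K * |B| * |X p' - X p| := by
  rw [show (A + B * m p') - (A + B * m p) = B * (m p' - m p) by ring, abs_mul]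
  have := mul_le_mul_of_nonneg_left (h.slope_sub_le p hp p' hp') (abs_nonneg B)
  linarith

theorem abs_form_sub_le (h : IsCurve S X Y m K k σ) {p p' : ι} (hp : p ∈ S) (hp' : p' ∈ S)
    (A B C : ℝ) :
    |(A * X p' + B * Y p' + C) - (A * X p + B * Y p + C) - (A + B * m p) * (X p' - X p)| ≤
      K * |B| * |X p' - X p| ^ 2 := by
  rw [show (A * X p' + B * Y p' + C) - (A * X p + B * Y p + C) - (A + B * m p) * (X p' - X p) =
    B * (Y p' - Y p - m p * (X p' - X p)) by ring, abs_mul]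
  have := mul_le_mul_of_nonneg_left (h.taylor_le p hp p' hp') (abs_nonneg B)
  linarith

/-- If the slope form of a line varies little then the line form is controlled linearly. -/
theorem abs_form_le (h : IsCurve S X Y m K k σ) {p p' : ι} (hp : p ∈ S) (hp' : p' ∈ S)
    {A B C V Δ : ℝ} (hΔ : |X p' - X p| ≤ Δ) (hV : |A + B * m p| ≤ V) (hB : K * |B| * Δ ≤ V) :
    |A * X p' + B * Y p' + C| ≤ |A * X p + B * Y p + C| + 2 * V * Δ := by
  have h1 := h.abs_form_sub_le hp hp' A B C
  have hΔ0 := abs_nonneg (X p' - X p)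
  have hV0 : 0 ≤ V := (abs_nonneg _).trans hV
  have hK : 0 ≤ K * |B| := mul_nonneg (by linarith [h.one_le]) (abs_nonneg _)
  have h2 : K * |B| * |X p' - X p| ^ 2 ≤ V * Δ := by
    rw [pow_two, ← mul_assoc]
    exact mul_le_mul ((mul_le_mul_of_nonneg_left hΔ hK).trans hB) hΔ hΔ0 hV0
  have h3 : |(A + B * m p) * (X p' - X p)| ≤ V * Δ := by
    rw [abs_mul]; exact mul_le_mul hV hΔ hΔ0 hV0
  have h4 := abs_add_le ((A * X p' + B * Y p' + C) - (A * X p + B * Y p + C) -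
    (A + B * m p) * (X p' - X p)) ((A * X p + B * Y p + C) + (A + B * m p) * (X p' - X p))
  have h5 := abs_add_le (A * X p + B * Y p + C) ((A + B * m p) * (X p' - X p))
  rw [show (A * X p' + B * Y p' + C) - (A * X p + B * Y p + C) - (A + B * m p) * (X p' - X p) +
    ((A * X p + B * Y p + C) + (A + B * m p) * (X p' - X p)) = A * X p' + B * Y p' + C by ring] at h4
  linarith

theorem abs_slopeForm_le (h : IsCurve S X Y m K k σ) {p p' : ι} (hp : p ∈ S) (hp' : p' ∈ S)
    {A B V Δ : ℝ} (hΔ : |X p' - X p| ≤ Δ) (hV : |A + B * m p| ≤ V) (hB : K * |B| * Δ ≤ V) :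
    |A + B * m p'| ≤ 2 * V := by
  have h1 := h.abs_slopeForm_sub_le hp hp' A B
  have h2 : K * |B| * |X p' - X p| ≤ V := (mul_le_mul_of_nonneg_left hΔ
    (mul_nonneg (by linarith [h.one_le]) (abs_nonneg _))).trans hB
  have h3 := abs_sub_abs_le_abs_sub (A + B * m p') (A + B * m p)
  linarith

/-- Where the slope form dominates its variation, the line form separates points. -/
theorem abs_sub_le_of_steep (h : IsCurve S X Y m K k σ) {p p' : ι} (hp : p ∈ S) (hp' : p' ∈ S)
    {A B C V Δ t : ℝ} (hΔ : |X p' - X p| ≤ Δ) (hV : V ≤ |A + B * m p|) (hB : 2 * (K * |B| * Δ) ≤ V)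
    (h1 : |A * X p + B * Y p + C| ≤ t) (h2 : |A * X p' + B * Y p' + C| ≤ t) :
    V * |X p' - X p| ≤ 4 * t := by
  have h3 := h.abs_form_sub_le hp hp' A B C
  have h4 : K * |B| * |X p' - X p| ≤ V / 2 := (mul_le_mul_of_nonneg_left hΔ
    (mul_nonneg (by linarith [h.one_le]) (abs_nonneg _))).trans (by linarith)
  have h5 : K * |B| * |X p' - X p| ^ 2 ≤ V / 2 * |X p' - X p| := by
    rw [pow_two, ← mul_assoc]
    exact mul_le_mul_of_nonneg_right h4 (abs_nonneg _)
  have h6 : V * |X p' - X p| ≤ |(A + B * m p) * (X p' - X p)| := by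
    rw [abs_mul]; exact mul_le_mul_of_nonneg_right hV (abs_nonneg _)
  have h7 : |(A + B * m p) * (X p' - X p)| ≤ 2 * t + V / 2 * |X p' - X p| := by
    rw [abs_le] at h1 h2 h3 ⊢
    constructor <;> linarith [h1.1, h1.2, h2.1, h2.2, h3.1, h3.2]
  linarith

/-- On the part of the curve where the slope form of a line has constant sign, the line form
separates points quadratically. -/
theorem sq_le_of_flat (h : IsCurve S X Y m K k σ) {p p' : ι} (hp : p ∈ S) (hp' : p' ∈ S)
    {A B C t : ℝ} (hs : 0 ≤ (A + B * m p) * (A + B * m p'))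
    (h1 : |A * X p + B * Y p + C| ≤ t) (h2 : |A * X p' + B * Y p' + C| ≤ t) :
    |B| * k * |X p' - X p| ^ 2 ≤ 2 * t := by
  -- Up to exchanging the points, the linear and the quadratic term of the expansion at `p` have the
  -- same sign, so they cannot cancel. If both orders failed, the slope forms would have opposite
  -- signs.
  wlog hsg : 0 ≤ (B * σ) * ((A + B * m p) * (X p' - X p)) generalizing p p' with H
  · by_cases hsg' : 0 ≤ (B * σ) * ((A + B * m p') * (X p - X p'))
    · rw [abs_sub_comm]
      exact H hp' hp (by linarith) h2 h1 hsg'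
    · exfalso
      push Not at hsg hsg'
      have h3 := mul_pos_of_neg_of_neg hsg hsg'
      have h4 : 0 ≤ ((B * σ) * (X p' - X p)) ^ 2 * ((A + B * m p) * (A + B * m p')) :=
        mul_nonneg (sq_nonneg _) hs
      nlinarith
  have h3 := h.le_taylor p hp p' hp'
  have h4 := mul_le_mul_of_nonneg_left h3 (abs_nonneg B)
  have hσ : σ = 1 ∨ σ = -1 := eq_or_eq_neg_of_abs_eq h.sign
  rw [abs_le] at h1 h2
  have h5 : (A * X p' + B * Y p' + C) - (A * X p + B * Y p + C) = (A + B * m p) * (X p' - X p) +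
    B * (Y p' - Y p - m p * (X p' - X p)) := by ring
  have hk : 0 ≤ |B| * k * |X p' - X p| ^ 2 := by have := h.pos; positivity
  rcases hσ with rfl | rfl <;> rcases le_or_gt 0 B with hB | hB
  · rw [abs_of_nonneg hB] at *
    rcases hB.eq_or_lt with rfl | hB'
    · simp; linarith [h1.1, h1.2]
    have : 0 ≤ (A + B * m p) * (X p' - X p) := by
      by_contra hc; push Not at hc; nlinarith
    linarith [h1.1, h1.2, h2.1, h2.2]
  · rw [abs_of_neg hB] at *
    have : (A + B * m p) * (X p' - X p) ≤ 0 := by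
      by_contra hc; push Not at hc; nlinarith
    linarith [h1.1, h1.2, h2.1, h2.2]
  · rw [abs_of_nonneg hB] at *
    rcases hB.eq_or_lt with rfl | hB'
    · simp; linarith [h1.1, h1.2]
    have : (A + B * m p) * (X p' - X p) ≤ 0 := by
      by_contra hc; push Not at hc; nlinarith
    linarith [h1.1, h1.2, h2.1, h2.2]
  · rw [abs_of_neg hB] at *
    have : 0 ≤ (A + B * m p) * (X p' - X p) := by
      by_contra hc; push Not at hc; nlinarith
    linarith [h1.1, h1.2, h2.1, h2.2]

end IsCurve

/-! ### Avoiding rational points makes nearby lines proportional -/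

/-- No rational point of small height is close to `(x, y)`; here `R` is the scale up to which the
heights are considered, and `exp (-ℓ)` the constant of approximation. -/
def AvoidsRationals (i j ℓ ε R x y : ℝ) : Prop :=
  ∀ q : ℕ, 1 ≤ q → ∀ u v : ℤ, |q * x - u| ≤ Real.exp (-ℓ - i * Real.log q) →
    |q * y - v| ≤ Real.exp (-ℓ - j * Real.log q) →
    Real.exp (-(1 + ε) * ℓ - (1 + i) * Real.log q) < R

open Real in
/-- Two integral lines near a point which avoids rationals are parallel, since otherwise they
intersect in a rational point which is too close. -/
theorem AvoidsRationals.cross_eq_zero {i j ℓ ε R x y m K b V h LY : ℝ} (hi : 0 < i) (hi1 : i < 1)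
    (hj : 0 < j) (hji : j ≤ i) (hℓ : 0 ≤ ℓ) (hav : AvoidsRationals i j ℓ ε R x y)
    {A₁ B₁ C₁ A₂ B₂ C₂ : ℤ} (hK : 1 ≤ K) (hm : |m| ≤ K)
    (hB₁ : |(B₁ : ℝ)| ≤ b) (hB₂ : |(B₂ : ℝ)| ≤ b)
    (hV₁ : |A₁ + B₁ * m| ≤ V) (hV₂ : |A₂ + B₂ * m| ≤ V)
    (hF₁ : |A₁ * x + B₁ * y + C₁| ≤ h) (hF₂ : |A₂ * x + B₂ * y + C₂| ≤ h)
    (hY : 2 * V * b ≤ exp LY) (hbh : 8 * K * (b * h) ≤ exp (-ℓ - i * LY))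
    (hVh : 8 * (V * h) ≤ exp (-ℓ - j * LY)) (hLY : -ℓ ≤ LY)
    (hR : R ≤ exp (-(1 + ε) * ℓ - (1 + i) * LY)) :
    A₁ * B₂ = A₂ * B₁ ∧ B₁ * C₂ = B₂ * C₁ ∧ C₁ * A₂ = C₂ * A₁ := by
  have hb0 : 0 ≤ b := (abs_nonneg _).trans hB₁
  have hh0 : 0 ≤ h := (abs_nonneg _).trans hF₁
  -- By Cramer's rule the lines meet at `(u / q, v / q)`.
  set q : ℤ := A₁ * B₂ - A₂ * B₁ with hq
  set u : ℤ := B₁ * C₂ - B₂ * C₁ with hu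
  set v : ℤ := C₁ * A₂ - C₂ * A₁ with hv
  have hprod : ∀ {a c s t : ℝ}, |a| ≤ s → |c| ≤ t → |a * c| ≤ s * t := fun {a c s t} h1 h2 => by
    rw [abs_mul]; exact mul_le_mul h1 h2 (abs_nonneg _) ((abs_nonneg _).trans h1)
  have hsub : ∀ {a c s : ℝ}, |a| ≤ s → |c| ≤ s → |a - c| ≤ 2 * s := fun {a c s} h1 h2 =>
    (abs_sub _ _).trans (by linarith)
  have hq1 : |(q : ℝ)| ≤ exp LY := by
    have e : (q : ℝ) = (A₁ + B₁ * m) * B₂ - (A₂ + B₂ * m) * B₁ := by push_cast [hq]; ring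
    rw [e]
    exact (hsub (hprod hV₁ hB₂) (hprod hV₂ hB₁)).trans (by linarith)
  have hu1 : |q * x - u| ≤ 2 * (b * h) := by
    have e : (q * x - u : ℝ) = B₂ * (A₁ * x + B₁ * y + C₁) - B₁ * (A₂ * x + B₂ * y + C₂) := by
      push_cast [hq, hu]; ring
    rw [e]
    exact hsub (hprod hB₂ hF₁) (hprod hB₁ hF₂)
  have hv1 : |q * y - v| ≤ 2 * (V * h) + K * (2 * (b * h)) := by
    -- Moving along the tangent direction replaces the coefficients `A₁`, `A₂` by the slope forms,
    -- which may be much smaller.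
    have e : (q * y - v : ℝ) = ((A₁ + B₁ * m) * (A₂ * x + B₂ * y + C₂) -
        (A₂ + B₂ * m) * (A₁ * x + B₁ * y + C₁)) + m * (q * x - u) := by
      push_cast [hq, hu, hv]; ring
    rw [e]
    exact (abs_add_le _ _).trans (add_le_add (hsub (hprod hV₁ hF₂) (hprod hV₂ hF₁)) (hprod hm hu1))
  have hbh0 : 0 ≤ b * h := mul_nonneg hb0 hh0
  have hbhK : b * h ≤ K * (b * h) := le_mul_of_one_le_left hbh0 hK
  by_cases hq0 : q = 0
  · have e1 : exp (-ℓ - i * LY) ≤ 1 := exp_le_one_iff.2 (by nlinarith)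
    have e2 : exp (-ℓ - j * LY) ≤ 1 := exp_le_one_iff.2 (by nlinarith)
    have hu0 : u = 0 := by
      rw [hq0] at hu1
      have : |(u : ℝ)| < 1 := by
        simp only [Int.cast_zero, zero_mul, zero_sub, abs_neg] at hu1
        linarith
      exact Int.abs_lt_one_iff.1 (by exact_mod_cast this)
    have hv0 : v = 0 := by
      rw [hq0] at hv1
      have : |(v : ℝ)| < 1 := by
        simp only [Int.cast_zero, zero_mul, zero_sub, abs_neg] at hv1
        linarith
      exact Int.abs_lt_one_iff.1 (by exact_mod_cast this)
    exact ⟨by linarith, by linarith, by linarith⟩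
  · exfalso
    have hn1 : 1 ≤ q.natAbs := Int.natAbs_pos.2 hq0
    have hnc : ((q.natAbs : ℕ) : ℝ) = |(q : ℝ)| := by rw [← Int.cast_abs, Nat.cast_natAbs]
    have hlog0 : 0 ≤ log q.natAbs := log_nonneg (by exact_mod_cast hn1)
    have hlog : log q.natAbs ≤ LY := by
      rw [log_le_iff_le_exp (by exact_mod_cast hn1), hnc]; exact hq1
    have e1 : exp (-ℓ - i * LY) ≤ exp (-ℓ - i * log q.natAbs) := by
      apply exp_le_exp.2; nlinarith
    have e2 : exp (-ℓ - j * LY) ≤ exp (-ℓ - j * log q.natAbs) := by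
      apply exp_le_exp.2; nlinarith
    have e3 : exp (-ℓ - i * log q.natAbs) ≤ exp (-ℓ - j * log q.natAbs) := by
      apply exp_le_exp.2; nlinarith
    have e4 : exp (-(1 + ε) * ℓ - (1 + i) * LY) ≤
        exp (-(1 + ε) * ℓ - (1 + i) * log q.natAbs) := by
      apply exp_le_exp.2; nlinarith
    have e0 := exp_pos (-ℓ - i * log q.natAbs)
    -- Avoidance is stated for positive denominators; the sign of `q` goes into the numerators.
    have hsgn : ∀ (z : ℝ) (w : ℤ), |(q.natAbs : ℝ) * z - ((q.sign * w : ℤ) : ℝ)| = |q * z - w| := by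
      intro z w
      have h1 : ((q.natAbs : ℕ) : ℝ) = q.sign * q := by
        rw [Nat.cast_natAbs]; exact_mod_cast (Int.sign_mul_self_eq_abs q).symm
      have h2 : |((q.sign : ℤ) : ℝ)| = 1 := by
        rw [← Int.cast_abs, Int.abs_sign_of_ne_zero hq0, Int.cast_one]
      rw [h1, Int.cast_mul, mul_assoc, ← mul_sub, abs_mul, h2, one_mul]
    refine absurd (hR.trans e4) (not_le.2 (hav q.natAbs hn1 (q.sign * u) (q.sign * v) ?_ ?_))
    · rw [hsgn]; linarith
    · rw [hsgn]; linarith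

/-! ### Exponents, scales, stages and deadlines -/

/-- The exponents and constants of the construction. The constant of approximation is `exp (-ℓ)`;
balls of stage `n` have size `exp (a - n * lam)`, and clusters with deadline `N` have size
`exp (a₁ - N * lam)`. All other constants are bounded in terms of `exp g`, and `ℓ` is large in
terms of `g`. -/
structure Exponents where
  (i j s τ μ ν x ε g ℓ a a₁ lam : ℝ)
  i_pos : 0 < i
  i_lt : i < 1
  j_pos : 0 < j
  j_le : j ≤ i
  i_add_j : i + j = 1
  s_pos : 0 < s
  τ_pos : 0 < τ
  s_add : s + 2 * τ = 1
  μ_pos : 0 < μ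
  μ_mul : μ * (2 + i * s) = s
  ν_pos : 0 < ν
  ν_mul : ν * (2 + i) = i * j
  ε_pos : 0 < ε
  ε_le_τ : 2 * ε ≤ τ
  ε_le_μ : ε ≤ i * μ
  le_x : μ + ε ≤ x
  le_x' : 1 - μ * (1 + i) + 2 * ε ≤ x
  x_le : x + ε ≤ 1 / 2
  one_le_g : 1 ≤ g
  lam_pos : 0 < lam
  lam_le : 6 * lam ≤ i * s * g
  lam_le' : lam ≤ j * g
  a_le : |a| ≤ g
  a₁_le : |a₁| ≤ g
  g_le : 100 * g ≤ ε * ℓ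

namespace Exponents

variable (e : Exponents)

theorem ε_le : e.ε ≤ 1 / 4 := by linarith [e.ε_le_τ, e.s_add, e.s_pos]

theorem j_le_one : e.j ≤ 1 := by linarith [e.i_lt, e.j_le]

theorem τ_le : e.τ ≤ 1 := by linarith [e.s_add, e.s_pos]

theorem s_lt : e.s < 1 := by linarith [e.s_add, e.τ_pos]

theorem ℓ_pos : 0 < e.ℓ := by
  by_contra h
  push Not at h
  nlinarith [e.g_le, e.one_le_g, e.ε_pos]

theorem g_le_τ : 200 * e.g ≤ e.τ * e.ℓ := by
  nlinarith [e.g_le, e.ε_le_τ, e.ℓ_pos]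

theorem g_le_iμ : 100 * e.g ≤ e.i * e.μ * e.ℓ := by
  nlinarith [e.g_le, e.ε_le_μ, e.ℓ_pos]

theorem g_le_ℓ : 400 * e.g ≤ e.ℓ := by
  nlinarith [e.g_le, e.ε_le, e.ℓ_pos]

theorem μ_le : e.μ ≤ 1 / 2 := by linarith [e.le_x, e.x_le, e.ε_pos]

theorem ν_le_j : e.ν ≤ e.j := by
  nlinarith [e.ν_mul, e.ν_pos, e.i_pos, e.j_pos, e.i_lt]

theorem ν_le_i : 2 * e.ν ≤ e.i := by
  nlinarith [e.ν_mul, e.ν_pos, e.i_pos, e.j_pos, e.j_le_one]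

theorem lam_le_g : 6 * e.lam ≤ e.g := by
  have h : e.i * e.s ≤ 1 := by nlinarith [e.i_pos, e.i_lt, e.s_pos, e.s_lt]
  nlinarith [e.lam_le, e.one_le_g]

/-- For `s = 1` this would be an equality, by the relation defining `ν`. It is what controls the `L`
terms in `IsSteepAt.steep_bound`. -/
theorem mul_i_add_ν : (2 + e.i * e.s) * (e.i + e.ν) ≤ 3 * e.i := by
  have h1 : (2 + e.i) * (e.i + e.ν) = 3 * e.i := by
    have h := e.ν_mul
    have h' := e.i_add_j
    have : e.j = 1 - e.i := by linarith
    rw [this] at h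
    linear_combination h
  have h2 : e.i * e.s ≤ e.i := by nlinarith [e.i_pos, e.s_lt]
  nlinarith [e.i_pos, e.ν_pos]

theorem two_le_exp : 2 ≤ Real.exp e.g := by
  have := Real.add_one_le_exp e.g
  linarith [e.one_le_g]

/-- Logarithm of the size of balls which see lines with slope form `exp w` through rational points
of height `exp L`. -/
noncomputable def steepScale (L w : ℝ) : ℝ :=
  -(e.s + e.τ) * e.ℓ + (1 + e.i * e.s) * (e.i * L - w) - (1 + e.i) * L

/-- Logarithm of the size of the corresponding clusters. -/
noncomputable def steepSize (L w : ℝ) : ℝ := 6 * e.g - e.ℓ - L - w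

/-- Logarithm of the size of balls which see almost tangential lines of height `exp L`. -/
noncomputable def flatScale (L : ℝ) : ℝ := -e.x * e.ℓ - (e.j + e.ν) * L

/-- Logarithm of the size of the corresponding clusters. -/
noncomputable def flatSize (L : ℝ) : ℝ := 5 * e.g - e.ℓ / 2 - (1 + e.j) / 2 * L

/-- Logarithm of the size of balls which see shifted rational points of height `exp L`. -/
noncomputable def shiftedScale (L : ℝ) : ℝ := -(1 + 2 * e.ε) * e.ℓ - (1 + e.i) * L

/-- Logarithm of the size of the corresponding clusters. -/
noncomputable def shiftedSize (L : ℝ) : ℝ := e.g - (1 + 3 * e.ε) * e.ℓ - (1 + e.i) * L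

/-- Balls of stage `n` have the size given by `R`, up to one round. -/
def IsStage (n : ℕ) (R : ℝ) : Prop := e.a - n * e.lam ≤ R ∧ R ≤ e.a - n * e.lam + e.lam

/-- Clusters of the size given by `D` have deadline `N`, up to one round. -/
def IsDeadline (N : ℕ) (D : ℝ) : Prop := D ≤ e.a₁ - N * e.lam ∧ e.a₁ - N * e.lam ≤ D + e.lam

variable {e}

theorem IsStage.abs_sub_le {n : ℕ} {R R' : ℝ} (h : e.IsStage n R) (h' : e.IsStage n R') :
    |R - R'| ≤ e.lam := by
  obtain ⟨h1, h2⟩ := h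
  obtain ⟨h3, h4⟩ := h'
  rw [abs_le]
  constructor <;> linarith

theorem IsDeadline.abs_sub_le {n : ℕ} {R R' : ℝ} (h : e.IsDeadline n R) (h' : e.IsDeadline n R') :
    |R - R'| ≤ e.lam := by
  obtain ⟨h1, h2⟩ := h
  obtain ⟨h3, h4⟩ := h'
  rw [abs_le]
  constructor <;> linarith

theorem exists_nat_level {a t lam : ℝ} (hl : 0 < lam) (h : t < a) :
    ∃ n : ℕ, 1 ≤ n ∧ a - n * lam ≤ t ∧ t ≤ a - n * lam + lam := by
  have h0 : 0 < (a - t) / lam := div_pos (by linarith) hl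
  refine ⟨⌈(a - t) / lam⌉₊, Nat.ceil_pos.2 h0, ?_, ?_⟩
  · have := (div_le_iff₀ hl).1 (Nat.le_ceil ((a - t) / lam))
    linarith
  · have := (lt_div_iff₀ hl).1 (by linarith [Nat.ceil_lt_add_one h0.le] :
      (⌈(a - t) / lam⌉₊ : ℝ) - 1 < (a - t) / lam)
    linarith

variable (e) in
/-- If clusters are much smaller than the balls which see them, there are many rounds between
stage and deadline. -/
theorem exists_levels {R D : ℝ} (hR : R ≤ -2 * e.g) (hRD : D + 4 * e.g ≤ R) :
    ∃ n N : ℕ, 1 ≤ n ∧ n + 10 ≤ N ∧ e.IsStage n R ∧ e.IsDeadline N D := by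
  have ha := abs_le.1 e.a_le
  have ha' := abs_le.1 e.a₁_le
  have hg := e.one_le_g
  obtain ⟨n, hn, h1, h2⟩ := exists_nat_level e.lam_pos (show R < e.a by linarith)
  obtain ⟨N, hN, h3, h4⟩ := exists_nat_level e.lam_pos (show D < e.a₁ by linarith)
  -- A deadline rounds in the other direction than a stage: the clusters must still fit into a ball
  -- of stage `N`, so the predecessor is taken.
  obtain ⟨N, rfl⟩ : ∃ N', N = N' + 1 := ⟨N - 1, by omega⟩
  refine ⟨n, N, hn, ?_, ⟨h1, h2⟩, ?_, ?_⟩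
  · have hl := e.lam_le_g
    push_cast at h3
    have : ((n : ℝ) + 9) * e.lam < (N : ℝ) * e.lam := by linarith
    have h5 := lt_of_mul_lt_mul_right this e.lam_pos.le
    have : n + 9 < N := by exact_mod_cast h5
    omega
  · push_cast at h4; linarith
  · push_cast at h3; linarith

theorem IsDeadline.le_of_le {n N : ℕ} {D : ℝ} (hD : e.IsDeadline N D)
    (h : e.a - n * e.lam + 2 * e.g ≤ D) : N ≤ n := by
  have ha := abs_le.1 e.a_le
  have ha' := abs_le.1 e.a₁_le
  have : (N : ℝ) * e.lam ≤ n * e.lam := by linarith [hD.1]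
  exact_mod_cast le_of_mul_le_mul_right this e.lam_pos

end Exponents

section

open Real

/-! ### The dangerous sets -/

section Sets

variable {ι : Type*} (e : Exponents) (S : Set ι) (X Y m : ι → ℝ)

/-- The point `p` is close to the rational point `(u, v) / q`, of height `exp L`, on the line
`A x + B y + C = 0`, which is not almost tangential to the curve at `p`: its slope form is
`exp w`. -/
structure IsSteepAt (p : ι) (q : ℕ) (u v A B C : ℤ) (L w : ℝ) : Prop where
  mem : p ∈ S
  one_le : 1 ≤ q
  log_eq : L = log q
  abs_x_le : |q * X p - u| ≤ exp (-e.ℓ - e.i * L)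
  abs_y_le : |q * Y p - v| ≤ exp (-e.ℓ - e.j * L)
  line : A * u + B * v + C * q = 0
  abs_A_le : |(A : ℝ)| ≤ exp (e.i * L)
  abs_B_le : |(B : ℝ)| ≤ exp (e.j * L)
  slope : |A + B * m p| = exp w
  le_w : -e.μ * e.ℓ - e.ν * L ≤ w

/-- The point `p` is close to the line `A x + B y + C = 0`, of height `exp L`, which is almost
tangential to the curve at `p`. -/
structure IsFlatAt (p : ι) (A B C : ℤ) (L : ℝ) : Prop where
  mem : p ∈ S
  nonneg : 0 ≤ L
  abs_B_le : |(B : ℝ)| ≤ exp (e.j * L)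
  le_abs_B : exp (e.j * L - 2 * e.g) ≤ |(B : ℝ)|
  abs_form_le : |A * X p + B * Y p + C| ≤ exp (e.g - e.ℓ - L)
  slope_le : |A + B * m p| ≤ exp (-e.μ * e.ℓ - e.ν * L)

/-- The point `p` is close to the shifted rational point `(u + γ, v + δ) / q`. -/
structure IsShiftedAt (γ δ : ℝ) (p : ι) (q : ℕ) (u v : ℤ) (L : ℝ) : Prop where
  mem : p ∈ S
  one_le : 1 ≤ q
  log_eq : L = log q
  abs_x_le : |q * X p - γ - u| ≤ exp (-(1 + 3 * e.ε) * e.ℓ - e.i * L)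
  abs_y_le : |q * Y p - δ - v| ≤ exp (-(1 + 3 * e.ε) * e.ℓ - e.j * L)

/-- The points which are close to a line as in `IsSteepAt`, with stage `n` and deadline `N`. -/
def steepSet (n N : ℕ) : Set ι :=
  {p | ∃ q u v A B C L w, IsSteepAt e S X Y m p q u v A B C L w ∧
    e.IsStage n (e.steepScale L w) ∧ e.IsDeadline N (e.steepSize L w)}

/-- The points which are close to a line as in `IsFlatAt`, with stage `n` and deadline `N`. -/
def flatSet (n N : ℕ) : Set ι :=
  {p | ∃ A B C L, IsFlatAt e S X Y m p A B C L ∧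
    e.IsStage n (e.flatScale L) ∧ e.IsDeadline N (e.flatSize L)}

/-- The points which are close to a shifted rational point, with stage `n` and deadline `N`. -/
def shiftedSet (γ δ : ℝ) (n N : ℕ) : Set ι :=
  {p | ∃ q u v L, IsShiftedAt e S X Y γ δ p q u v L ∧
    e.IsStage n (e.shiftedScale L) ∧ e.IsDeadline N (e.shiftedSize L)}

end Sets

/-! ### Missing the dangerous sets means avoiding rational points -/

section Avoid

variable {ι : Type*} {e : Exponents} {S : Set ι} {X Y m : ι → ℝ} {K k σ : ℝ}

/-- Since the line passes through the rational point, `q` times the line form is `A (q x - u) + B (q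
y - v)`, and the bounds on the coefficients balance those on the distances. -/
theorem abs_form_le_of_near {q : ℕ} (hq : 1 ≤ q) {x y A B C u v α β ζ : ℝ}
    (hline : A * u + B * v + C * q = 0) (hA : |A| ≤ exp α) (hB : |B| ≤ exp β)
    (hx : |q * x - u| ≤ exp (ζ - α)) (hy : |q * y - v| ≤ exp (ζ - β)) :
    |A * x + B * y + C| ≤ 2 * exp (ζ - log q) := by
  have hq0 : (0 : ℝ) < q := by exact_mod_cast hq
  have h1 : (q : ℝ) * |A * x + B * y + C| ≤ 2 * exp ζ := by
    have h0 := abs_mul (q : ℝ) (A * x + B * y + C)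
    rw [abs_of_pos hq0] at h0
    rw [← h0, show q * (A * x + B * y + C) = A * (q * x - u) + B * (q * y - v) by
        linear_combination hline]
    refine (abs_add_le _ _).trans ?_
    rw [abs_mul, abs_mul, two_mul]
    have h2 := mul_le_mul hA hx (abs_nonneg _) (exp_pos _).le
    have h3 := mul_le_mul hB hy (abs_nonneg _) (exp_pos _).le
    rw [← exp_add] at h2 h3
    rw [add_sub_cancel] at h2 h3
    exact add_le_add h2 h3
  rw [exp_sub, exp_log hq0, ← mul_div_assoc, le_div_iff₀ hq0]
  linarith

theorem IsSteepAt.abs_form_le {p : ι} {q : ℕ} {u v A B C : ℤ} {L w : ℝ}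
    (h : IsSteepAt e S X Y m p q u v A B C L w) :
    |A * X p + B * Y p + C| ≤ 2 * exp (-e.ℓ - L) := by
  rw [h.log_eq]
  exact abs_form_le_of_near (u := (u : ℝ)) (v := (v : ℝ)) h.one_le (by exact_mod_cast h.line) h.abs_A_le h.abs_B_le
    (by simpa [h.log_eq] using h.abs_x_le) (by simpa [h.log_eq] using h.abs_y_le)

theorem IsSteepAt.nonneg {p : ι} {q : ℕ} {u v A B C : ℤ} {L w : ℝ}
    (h : IsSteepAt e S X Y m p q u v A B C L w) : 0 ≤ L := by
  rw [h.log_eq]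
  exact log_nonneg (by exact_mod_cast h.one_le)

theorem IsSteepAt.w_le {p : ι} {q : ℕ} {u v A B C : ℤ} {L w : ℝ} (hc : IsCurve S X Y m K k σ)
    (hK : K ≤ exp e.g) (h : IsSteepAt e S X Y m p q u v A B C L w) : w ≤ e.i * L + 2 * e.g := by
  rw [← exp_le_exp, ← h.slope]
  have h1 := h.abs_A_le
  have h2 : exp (e.j * L) ≤ exp (e.i * L) :=
    exp_le_exp.2 (mul_le_mul_of_nonneg_right e.j_le h.nonneg)
  have h3 : |B * m p| ≤ exp (e.i * L) * exp e.g := by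
    rw [abs_mul]
    exact mul_le_mul (h.abs_B_le.trans h2) ((hc.slope_le p h.mem).trans hK) (abs_nonneg _)
      (exp_pos _).le
  have h4 : exp (e.i * L + 2 * e.g) = exp (e.i * L) * exp e.g * exp e.g := by
    rw [two_mul, ← add_assoc, exp_add, exp_add]
  rw [h4]
  have h5 := e.two_le_exp
  have h6 := exp_pos (e.i * L)
  have h7 := abs_add_le (A : ℝ) (B * m p)
  nlinarith [mul_pos h6 (exp_pos e.g)]

theorem IsSteepAt.sub_le {p : ι} {q : ℕ} {u v A B C : ℤ} {L w : ℝ}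
    (h : IsSteepAt e S X Y m p q u v A B C L w) : e.i * L - w ≤ e.μ * e.ℓ + (e.i + e.ν) * L := by
  linarith [h.le_w]

/-- A point which meets none of the sets with deadline at most `n` is not close to rational points
whose height corresponds to stage `n`. -/
theorem avoidsRationals_of_notMem (hc : IsCurve S X Y m K k σ) (hK : K ≤ exp e.g) {n : ℕ} {p : ι}
    (hp : p ∈ S)
    (hs : ∀ n' N', 1 ≤ n' → n' + 10 ≤ N' → N' ≤ n → p ∉ steepSet e S X Y m n' N')
    (hf : ∀ n' N', 1 ≤ n' → n' + 10 ≤ N' → N' ≤ n → p ∉ flatSet e S X Y m n' N') :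
    AvoidsRationals e.i e.j e.ℓ e.ε (exp (e.a - n * e.lam)) (X p) (Y p) := by
  intro q hq u v hx hy
  by_contra hcon
  rw [not_lt, exp_le_exp] at hcon
  have hi := e.i_pos
  have hi1 := e.i_lt
  have hj := e.j_pos
  have hℓ := e.ℓ_pos
  have hg := e.one_le_g
  have hν := e.ν_pos
  obtain ⟨A, B, C, hAB, hline, hA, hB⟩ := exists_line_through e.i_add_j hq u v
  set L := log q with hL
  have hL0 : 0 ≤ L := log_nonneg (by exact_mod_cast hq)
  rcases le_or_gt (exp (-e.μ * e.ℓ - e.ν * L)) |A + B * m p| with hV | hV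
  · have hV0 : 0 < |A + B * m p| := (exp_pos _).trans_le hV
    set w := log |A + B * m p|
    have hst : IsSteepAt e S X Y m p q u v A B C L w :=
      ⟨hp, hq, hL, hx, hy, hline, hA, hB, (exp_log hV0).symm, (le_log_iff_exp_le hV0).2 hV⟩
    have hu1 := hst.sub_le
    have hu2 := hst.w_le hc hK
    have his : 0 ≤ e.i * e.s := mul_nonneg hi.le e.s_pos.le
    have his1 : e.i * e.s ≤ e.i := by nlinarith [e.s_lt]
    have hiν : e.i + e.ν ≤ 1 := by linarith [e.ν_le_j, e.i_add_j]
    have h1 : e.steepScale L w ≤ -2 * e.g := by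
      have h2 := mul_le_mul_of_nonneg_left hu1 (show 0 ≤ 1 + e.i * e.s by linarith)
      have h3 : (1 + e.i * e.s) * (e.μ * e.ℓ) = e.s * e.ℓ - e.μ * e.ℓ := by
        linear_combination e.ℓ * e.μ_mul
      have h4 : (1 + e.i * e.s) * ((e.i + e.ν) * L) ≤ (1 + e.i) * (1 * L) :=
        mul_le_mul (by linarith) (mul_le_mul_of_nonneg_right hiν hL0) (by positivity) (by linarith)
      have h5 := e.g_le_τ
      have h6 := mul_pos e.μ_pos hℓ
      unfold Exponents.steepScale
      linarith
    have h2 : e.steepSize L w + 4 * e.g ≤ e.steepScale L w := by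
      have h3 : -2 * e.g ≤ e.i * e.s * (e.i * L - w) := by
        have := mul_le_mul_of_nonneg_left (show -2 * e.g ≤ e.i * L - w by linarith) his
        nlinarith
      have h5 := e.g_le_τ
      have h6 : e.τ * e.ℓ = e.ℓ - (e.s + e.τ) * e.ℓ := by linear_combination e.ℓ * e.s_add
      unfold Exponents.steepScale Exponents.steepSize
      linarith
    obtain ⟨n', N', h3, h4, h5, h6⟩ := e.exists_levels h1 h2
    -- As `w ≤ i L + 2 g`, the cluster size is at least `4 g - ℓ - (1 + i) L` on the logarithmic
    -- scale. This exceeds the size of the ball, so the deadline has passed.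
    refine hs n' N' h3 h4 (h6.le_of_le ?_) ⟨q, u, v, A, B, C, L, w, hst, h5, h6⟩
    have := e.g_le
    unfold Exponents.steepSize
    linarith
  · have hμℓ := mul_pos e.μ_pos hℓ
    have hνL := mul_nonneg hν.le hL0
    have hV1 : |A + B * m p| < 1 := hV.trans_le (exp_le_one_iff.2 (by linarith))
    have hB0 : B ≠ 0 := by
      rintro rfl
      have hA0 : A ≠ 0 := by simpa using hAB
      have : (1 : ℝ) ≤ |(A : ℝ)| := by exact_mod_cast Int.one_le_abs hA0
      simp at hV1
      linarith
    have hB1 : (1 : ℝ) ≤ |(B : ℝ)| := by exact_mod_cast Int.one_le_abs hB0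
    have hBpos : (0 : ℝ) < |(B : ℝ)| := by linarith
    have hAB' : |(A : ℝ)| ≤ |(B : ℝ)| * exp (2 * e.g) := by
      have h1 : |(A : ℝ)| ≤ 1 + |(B : ℝ)| * exp e.g := by
        have h2 : |B * m p| ≤ |(B : ℝ)| * exp e.g := by
          rw [abs_mul]
          exact mul_le_mul_of_nonneg_left ((hc.slope_le p hp).trans hK) hBpos.le
        have h3 := abs_sub (A + B * m p) (B * m p)
        rw [add_sub_cancel_right] at h3
        linarith
      have h2 := e.two_le_exp
      rw [two_mul, exp_add]
      have h3 := mul_le_mul_of_nonneg_left h2 hBpos.le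
      have h4 := mul_le_mul_of_nonneg_left h2 (mul_pos hBpos (exp_pos e.g)).le
      linarith
    -- The height is reset to the true size of the coefficients. The slope form being small, `|A|`
    -- is at most a constant times `|B|`; with `j ≤ i` this makes `|B|` comparable to `exp (j L')`,
    -- as the quadratic separation requires.
    set L' := max (log |(A : ℝ)| / e.i) (log |(B : ℝ)| / e.j) with hL'
    have hlogB : 0 ≤ log |(B : ℝ)| := log_nonneg hB1
    have hL'0 : 0 ≤ L' := (div_nonneg hlogB hj.le).trans (le_max_right _ _)
    have hAL : A ≠ 0 → (0 : ℝ) < |(A : ℝ)| := fun h => abs_pos.2 (by exact_mod_cast h)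
    have hL'L : L' ≤ L := by
      refine max_le ?_ ?_
      · rw [div_le_iff₀ hi]
        by_cases hA0 : A = 0
        · simp [hA0]; positivity
        · rw [log_le_iff_le_exp (hAL hA0), mul_comm]; exact hA
      · rw [div_le_iff₀ hj, log_le_iff_le_exp hBpos, mul_comm]; exact hB
    have hB' : |(B : ℝ)| ≤ exp (e.j * L') := by
      rw [← log_le_iff_le_exp hBpos, mul_comm, ← div_le_iff₀ hj]
      exact le_max_right _ _
    have hB'' : exp (e.j * L' - 2 * e.g) ≤ |(B : ℝ)| := by
      rw [← le_log_iff_exp_le hBpos]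
      rcases max_choice (log |(A : ℝ)| / e.i) (log |(B : ℝ)| / e.j) with h | h
      · have h1 : e.j * L' ≤ e.i * L' := mul_le_mul_of_nonneg_right e.j_le hL'0
        have h2 : e.i * L' = log |(A : ℝ)| := by rw [hL', h]; field_simp
        -- With the convention `log 0 = 0`, the case `A = 0` gives `L' = 0`, and `|B| ≥ 1` suffices.
        by_cases hA0 : A = 0
        · rw [hA0, Int.cast_zero, abs_zero, log_zero] at h2; linarith
        · have h3 := log_le_log (hAL hA0) hAB'
          rw [log_mul hBpos.ne' (exp_pos _).ne', log_exp] at h3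
          linarith
      · have h2 : e.j * L' = log |(B : ℝ)| := by rw [hL', h]; field_simp
        linarith
    have hF : |A * X p + B * Y p + C| ≤ exp (e.g - e.ℓ - L') := by
      have h1 : |A * X p + B * Y p + C| ≤ 2 * exp (-e.ℓ - L) :=
        abs_form_le_of_near hq (by exact_mod_cast hline) hA hB hx hy
      have h2 : exp e.g * exp (-e.ℓ - L) ≤ exp (e.g - e.ℓ - L') := by
        rw [← exp_add]; exact exp_le_exp.2 (by linarith)
      exact h1.trans ((mul_le_mul_of_nonneg_right e.two_le_exp (exp_pos _).le).trans h2)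
    have hfl : IsFlatAt e S X Y m p A B C L' :=
      ⟨hp, hL'0, hB', hB'', hF, hV.le.trans (exp_le_exp.2 (by nlinarith))⟩
    have hx0 := e.le_x
    have hε := e.g_le
    have h1 : e.flatScale L' ≤ -2 * e.g := by
      have h2 := mul_le_mul_of_nonneg_right hx0 hℓ.le
      have h3 : 0 ≤ (e.j + e.ν) * L' := by positivity
      unfold Exponents.flatScale
      linarith
    have h2 : e.flatSize L' + 4 * e.g ≤ e.flatScale L' := by
      have h2 := mul_le_mul_of_nonneg_right e.x_le hℓ.le
      have h3 : (e.j + e.ν) * L' ≤ (1 + e.j) / 2 * L' :=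
        mul_le_mul_of_nonneg_right (by linarith [e.ν_le_i, e.i_add_j]) hL'0
      unfold Exponents.flatScale Exponents.flatSize
      linarith
    obtain ⟨n', N', h3, h4, h5, h6⟩ := e.exists_levels h1 h2
    refine hf n' N' h3 h4 (h6.le_of_le ?_) ⟨A, B, C, L', hfl, h5, h6⟩
    have h7 : (1 + e.j) / 2 * L' ≤ (1 + e.i) * L :=
      mul_le_mul (by linarith [e.j_le]) hL'L hL'0 (by linarith)
    unfold Exponents.flatSize
    linarith

end Avoid

/-! ### Steep lines: one cluster per ball -/

section Clusters

variable {ι : Type*} {e : Exponents} {S : Set ι} {X Y m : ι → ℝ} {K k σ : ℝ}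

/-- Up to constants, stage and deadline determine the height and the slope form. -/
theorem Exponents.steep_comparable {n N : ℕ} {L w L' w' : ℝ} (hR : e.IsStage n (e.steepScale L w))
    (hR' : e.IsStage n (e.steepScale L' w')) (hD : e.IsDeadline N (e.steepSize L w))
    (hD' : e.IsDeadline N (e.steepSize L' w')) : |L - L'| ≤ e.g ∧ |w - w'| ≤ e.g := by
  have h1 := abs_le.1 (hR.abs_sub_le hR')
  have h2 := abs_le.1 (hD.abs_sub_le hD')
  unfold Exponents.steepScale at h1
  unfold Exponents.steepSize at h2
  have hi := e.i_pos
  have his : 0 < e.i * e.s := mul_pos hi e.s_pos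
  -- Scale minus size is `i s (i L - w)` up to a constant, so stage and deadline determine `i L - w`
  -- because `s > 0`; the size then determines `L`.
  set U := (e.i * L - w) - (e.i * L' - w') with hU
  have h3 : e.i * e.s * U ≤ e.i * e.s * (e.g / 3) := by
    have := e.lam_le
    rw [hU]; linarith [h1.1, h1.2, h2.1, h2.2]
  have h4 : e.i * e.s * (-(e.g / 3)) ≤ e.i * e.s * U := by
    have := e.lam_le
    rw [hU]; linarith [h1.1, h1.2, h2.1, h2.2]
  have h5 := le_of_mul_le_mul_left h3 his
  have h6 := le_of_mul_le_mul_left h4 his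
  have hl := e.lam_le_g
  have hg := e.one_le_g
  have h9 : L - L' ≤ e.g / 2 := by
    by_contra hc; push Not at hc; nlinarith
  have h10 : -(e.g / 2) ≤ L - L' := by
    by_contra hc; push Not at hc; nlinarith
  refine ⟨abs_le.2 ⟨by linarith, by linarith⟩, abs_le.2 ⟨?_, ?_⟩⟩
  · linarith [h2.2]
  · linarith [h2.1]

theorem mul_abs_le_exp_sub (hK : K ≤ exp e.g) {B α β t Δ : ℝ} (hB : |B| ≤ exp α)
    (hΔ : Δ ≤ exp β) (hΔ0 : 0 ≤ Δ) (h : e.g + α + β ≤ t) : K * |B| * Δ ≤ exp t := by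
  have h1 := mul_le_mul (mul_le_mul hK hB (abs_nonneg _) (exp_pos _).le) hΔ hΔ0
    (mul_pos (exp_pos _) (exp_pos _)).le
  rw [← exp_add, ← exp_add] at h1
  exact h1.trans (exp_le_exp.2 h)

theorem Exponents.two_mul_exp_le (t : ℝ) : 2 * exp t ≤ exp (e.g + t) := by
  rw [exp_add]
  exact mul_le_mul_of_nonneg_right e.two_le_exp (exp_pos _).le

/-- On a ball of its stage the slope form varies by at most half its value. The relations for `μ`
and `ν` match the threshold `le_w` to the scale, and the surplus `τ ℓ` absorbs the constants. -/
theorem IsSteepAt.steep_bound {p : ι} {q : ℕ} {u v A B C : ℤ} {L w Δ : ℝ} {n : ℕ}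
    (hK : K ≤ exp e.g)
    (h : IsSteepAt e S X Y m p q u v A B C L w) (hR : e.IsStage n (e.steepScale L w))
    (hΔ : Δ ≤ exp (e.a - n * e.lam)) (hΔ0 : 0 ≤ Δ) :
    2 * (K * |(B : ℝ)| * Δ) ≤ exp w := by
  have hg := e.one_le_g
  have hu := h.sub_le
  have hL := h.nonneg
  have h1 : e.g + e.j * L + e.steepScale L w ≤ w - e.g := by
    have his : 0 ≤ 2 + e.i * e.s := by linarith [mul_pos e.i_pos e.s_pos]
    have h2 := mul_le_mul_of_nonneg_left hu his
    have h3 : (2 + e.i * e.s) * (e.μ * e.ℓ) = e.s * e.ℓ := by linear_combination e.ℓ * e.μ_mul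
    have h4 := mul_le_mul_of_nonneg_right e.mul_i_add_ν hL
    have h5 := e.g_le_τ
    have h6 : e.j * L = L - e.i * L := by linear_combination L * e.i_add_j
    unfold Exponents.steepScale
    linarith
  have h7 := mul_abs_le_exp_sub hK h.abs_B_le
    (hΔ.trans (exp_le_exp.2 hR.1)) hΔ0 h1
  have h8 := e.two_mul_exp_le (w - e.g)
  rw [add_sub_cancel] at h8
  linarith

/-- Two points of a ball in the same steep set, the case of large slope forms: the rational point
close to the second one lies on the line of the first. -/
theorem IsSteepAt.abs_form_le_of_le {p₁ p₂ : ι} {q₁ q₂ : ℕ} {u₁ v₁ A₁ B₁ C₁ u₂ v₂ A₂ B₂ C₂ : ℤ}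
    {L₁ w₁ L₂ w₂ : ℝ} {n : ℕ} (hc : IsCurve S X Y m K k σ) (hK : K ≤ exp e.g)
    (h₁ : IsSteepAt e S X Y m p₁ q₁ u₁ v₁ A₁ B₁ C₁ L₁ w₁)
    (h₂ : IsSteepAt e S X Y m p₂ q₂ u₂ v₂ A₂ B₂ C₂ L₂ w₂)
    (hR₁ : e.IsStage n (e.steepScale L₁ w₁))
    (hL : |L₁ - L₂| ≤ e.g)
    (hΔ : |X p₂ - X p₁| ≤ exp (e.a - n * e.lam))
    (hcase : e.i * (e.i * L₁ - w₁) ≤ e.ℓ) :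
    |A₁ * X p₂ + B₁ * Y p₂ + C₁| ≤ exp (4 * e.g - e.ℓ - L₁) := by
  have hg := e.one_le_g
  have hℓ := e.ℓ_pos
  have hi := e.i_pos
  have hi1 := e.i_lt
  have hj := e.j_pos
  have hj1 := e.j_le_one
  have hgτ := e.g_le_τ
  have hτ1 : e.τ * e.ℓ ≤ e.ℓ := by nlinarith [e.τ_le]
  rw [abs_le] at hL
  have hst₁ := h₁.steep_bound hK hR₁ le_rfl (exp_pos _).le
  have hKB₁ : 0 ≤ K * |(B₁ : ℝ)| * exp (e.a - n * e.lam) := by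
    have := hc.one_le; positivity
  have hF₁ := h₁.abs_form_le
  set U := e.i * L₁ - w₁ with hU
  have hscale : w₁ + e.steepScale L₁ w₁ = -L₁ - (e.s + e.τ) * e.ℓ + e.s * (e.i * U) := by
    unfold Exponents.steepScale; rw [hU]; ring
  have hwΔ : exp w₁ * exp (e.a - n * e.lam) ≤
      exp (-L₁ - (e.s + e.τ) * e.ℓ + e.s * (e.i * U)) := by
    rw [← exp_add, exp_le_exp]; linarith [hR₁.1]
  have h1 : exp w₁ * exp (e.a - n * e.lam) ≤ exp (-L₁ - e.τ * e.ℓ) := by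
    refine hwΔ.trans (exp_le_exp.2 ?_)
    have := mul_le_mul_of_nonneg_left hcase e.s_pos.le
    linarith
  have h2 : |A₁ * X p₂ + B₁ * Y p₂ + C₁| ≤
      2 * exp (-e.ℓ - L₁) + 2 * exp (-L₁ - e.τ * e.ℓ) := by
    have := hc.abs_form_le h₁.mem h₂.mem (C := (C₁ : ℝ)) hΔ h₁.slope.le (by linarith)
    linarith
  have hq : (q₂ : ℝ) = exp L₂ := by
    rw [h₂.log_eq, exp_log]; exact_mod_cast h₂.one_le
  have hA : |(A₁ : ℝ)| * |q₂ * X p₂ - u₂| ≤ exp (e.g - e.ℓ) := by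
    refine (mul_le_mul h₁.abs_A_le h₂.abs_x_le (abs_nonneg _) (exp_pos _).le).trans ?_
    rw [← exp_add, exp_le_exp]
    nlinarith
  have hB : |(B₁ : ℝ)| * |q₂ * Y p₂ - v₂| ≤ exp (e.g - e.ℓ) := by
    refine (mul_le_mul h₁.abs_B_le h₂.abs_y_le (abs_nonneg _) (exp_pos _).le).trans ?_
    rw [← exp_add, exp_le_exp]
    nlinarith
  have hAB : |A₁ * (q₂ * X p₂ - u₂) + B₁ * (q₂ * Y p₂ - v₂)| ≤ 2 * exp (e.g - e.ℓ) := by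
    refine (abs_add_le _ _).trans ?_
    rw [abs_mul, abs_mul]
    linarith
  -- By `hcase` the first line form is of order at most `exp (-L₁ - τ ℓ)` on the ball, much less
  -- than `1 / q₂`, so this integer is smaller than 1.
  have hint : (A₁ * u₂ + B₁ * v₂ + C₁ * q₂ : ℤ) = 0 := by
    have h3 : |((A₁ * u₂ + B₁ * v₂ + C₁ * q₂ : ℤ) : ℝ)| < 1 := by
      have h4 : ((A₁ * u₂ + B₁ * v₂ + C₁ * q₂ : ℤ) : ℝ) = q₂ * (A₁ * X p₂ + B₁ * Y p₂ + C₁) -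
          (A₁ * (q₂ * X p₂ - u₂) + B₁ * (q₂ * Y p₂ - v₂)) := by
        push_cast; ring
      have h5 : |q₂ * (A₁ * X p₂ + B₁ * Y p₂ + C₁)| ≤
          2 * exp (e.g - e.ℓ) + 2 * exp (e.g - e.τ * e.ℓ) := by
        rw [abs_mul, Nat.abs_cast, hq]
        refine (mul_le_mul_of_nonneg_left h2 (exp_pos _).le).trans ?_
        rw [mul_add, mul_left_comm, mul_left_comm (exp L₂), ← exp_add, ← exp_add]
        gcongr <;> linarith
      rw [h4]
      have h6 : exp (e.g - e.ℓ) ≤ exp (e.g - e.τ * e.ℓ) := exp_le_exp.2 (by linarith)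
      have h7 := e.two_mul_exp_le (e.g - e.τ * e.ℓ)
      have h8 := e.two_mul_exp_le (e.g + (e.g - e.τ * e.ℓ))
      have h9 := e.two_mul_exp_le (e.g + (e.g + (e.g - e.τ * e.ℓ)))
      have h10 : exp (e.g + (e.g + (e.g + (e.g - e.τ * e.ℓ)))) < 1 :=
        exp_lt_one_iff.2 (by linarith)
      have h11 := exp_pos (e.g - e.τ * e.ℓ)
      have h12 := abs_sub (q₂ * (A₁ * X p₂ + B₁ * Y p₂ + C₁))
        (A₁ * (q₂ * X p₂ - u₂) + B₁ * (q₂ * Y p₂ - v₂))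
      linarith
    exact Int.abs_lt_one_iff.1 (by exact_mod_cast h3)
  -- With the integer gone, the crude bound improves to the distance of `p₂` from its own rational
  -- point.
  have h13 : exp L₂ * |A₁ * X p₂ + B₁ * Y p₂ + C₁| ≤ exp (2 * e.g - e.ℓ) := by
    have h14 : (q₂ : ℝ) * (A₁ * X p₂ + B₁ * Y p₂ + C₁) =
        A₁ * (q₂ * X p₂ - u₂) + B₁ * (q₂ * Y p₂ - v₂) := by
      have : (A₁ * u₂ + B₁ * v₂ + C₁ * q₂ : ℝ) = 0 := by exact_mod_cast hint
      linear_combination this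
    rw [← hq, ← Nat.abs_cast q₂, ← abs_mul, h14]
    refine (hAB.trans (e.two_mul_exp_le _)).trans (exp_le_exp.2 (by linarith))
  have h15 : exp (4 * e.g - e.ℓ - L₁) = exp (-L₂) * exp (4 * e.g - e.ℓ - L₁ + L₂) := by
    rw [← exp_add]; congr 1; ring
  calc |A₁ * X p₂ + B₁ * Y p₂ + C₁|
      = exp (-L₂) * (exp L₂ * |A₁ * X p₂ + B₁ * Y p₂ + C₁|) := by
        rw [← mul_assoc, ← exp_add]; simp
    _ ≤ exp (-L₂) * exp (2 * e.g - e.ℓ) := mul_le_mul_of_nonneg_left h13 (exp_pos _).le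
    _ ≤ _ := by
        rw [h15]
        exact mul_le_mul_of_nonneg_left (exp_le_exp.2 (by linarith)) (exp_pos _).le
theorem Exponents.eight_mul_le (hK : K ≤ exp e.g) : 8 * K ≤ exp (4 * e.g) := by
  have e1 := e.two_mul_exp_le e.g
  have e2 := e.two_mul_exp_le (e.g + e.g)
  have e3 := e.two_mul_exp_le (e.g + (e.g + e.g))
  rw [show 4 * e.g = e.g + (e.g + (e.g + e.g)) by ring]
  linarith

/-- The numerical conditions under which two lines of a steep set are parallel. -/
theorem Exponents.steep_parallel {L w U : ℝ} (hL : 0 ≤ L) (hU : U = e.i * L - w)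
    (hcase : e.ℓ < e.i * U) (hw : -e.μ * e.ℓ - e.ν * L ≤ w) :
    (0 ≤ U ∧ e.s * (e.i * U) - e.s * e.ℓ ≤ e.i * U - e.ℓ) ∧
    4 * e.g + (e.g + e.j * L + (-L - e.τ * e.ℓ - e.ℓ + e.i * U + 3 * e.g)) ≤
      -e.ℓ - e.i * (w + e.j * L + 4 * e.g) ∧
    4 * e.g + (w + 2 * e.g + (-L - e.τ * e.ℓ - e.ℓ + e.i * U + 3 * e.g)) ≤
      -e.ℓ - e.j * (w + e.j * L + 4 * e.g) ∧
    -e.ℓ ≤ w + e.j * L + 4 * e.g ∧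
    e.steepScale L w ≤ -(1 + e.ε) * e.ℓ - (1 + e.i) * (w + e.j * L + 4 * e.g) := by
  have hg := e.one_le_g
  have hℓ := e.ℓ_pos
  have hi := e.i_pos
  have hi1 := e.i_lt
  have hgτ := e.g_le_τ
  have hU0 : 0 ≤ U := by
    by_contra h; push Not at h; nlinarith
  have hsU : e.s * (e.i * U) - e.s * e.ℓ ≤ e.i * U - e.ℓ := by
    nlinarith [e.s_lt]
  have hig : e.i * e.g ≤ e.g := by nlinarith
  have hig0 : 0 ≤ e.i * e.g := by positivity
  have hiU : e.i * U ≤ U := by nlinarith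
  have hij : e.j = 1 - e.i := by linarith [e.i_add_j]
  have hμℓ : e.μ * e.ℓ ≤ e.ℓ / 2 := by nlinarith [e.μ_le]
  have hνL : e.ν * L ≤ e.j * L := mul_le_mul_of_nonneg_right e.ν_le_j hL
  have hwU : w = e.i * L - U := by rw [hU]; ring
  refine ⟨⟨hU0, hsU⟩, ?_, ?_, by linarith, ?_⟩
  · rw [hwU, hij]; linarith
  · rw [hwU, hij]; linarith
  · have hε : 2 * e.ε * e.ℓ ≤ e.τ * e.ℓ := mul_le_mul_of_nonneg_right e.ε_le_τ hℓ.le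
    unfold Exponents.steepScale
    rw [← hU, hwU, hij]
    linarith

/-- Carries the bounds for the second line over to `p₁`, so that both lines can be intersected near
one point that avoids rationals. -/
theorem IsSteepAt.abs_form_le_at_other {p₁ p₂ : ι} {q₂ : ℕ} {u₂ v₂ A₂ B₂ C₂ : ℤ}
    {L₂ w₂ H R : ℝ} {n : ℕ} (hc : IsCurve S X Y m K k σ) (hK : K ≤ exp e.g) (hp₁ : p₁ ∈ S)
    (h₂ : IsSteepAt e S X Y m p₂ q₂ u₂ v₂ A₂ B₂ C₂ L₂ w₂)
    (hR₂ : e.IsStage n (e.steepScale L₂ w₂))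
    (hΔ : |X p₁ - X p₂| ≤ exp (e.a - n * e.lam)) (hR : e.a - n * e.lam ≤ R)
    (hH : -e.ℓ - L₂ ≤ H) (hH' : w₂ + R ≤ H) :
    |A₂ * X p₁ + B₂ * Y p₁ + C₂| ≤ exp (2 * e.g + H) ∧
      |A₂ + B₂ * m p₁| ≤ exp (e.g + w₂) := by
  have hst₂ := h₂.steep_bound hK hR₂ le_rfl (exp_pos _).le
  have hKB₂ : 0 ≤ K * |(B₂ : ℝ)| * exp (e.a - n * e.lam) := by
    have := hc.one_le; positivity
  have hF := hc.abs_form_le h₂.mem hp₁ (C := (C₂ : ℝ)) hΔ h₂.slope.le (by linarith)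
  have hV := hc.abs_slopeForm_le h₂.mem hp₁ hΔ h₂.slope.le (by linarith)
  refine ⟨?_, hV.trans (e.two_mul_exp_le _)⟩
  have hF₂ := h₂.abs_form_le
  have e1 : exp w₂ * exp (e.a - n * e.lam) ≤ exp H := by
    rw [← exp_add, exp_le_exp]; linarith
  have e2 : exp (-e.ℓ - L₂) ≤ exp H := exp_le_exp.2 hH
  have e3 := e.two_mul_exp_le H
  have e4 := e.two_mul_exp_le (e.g + H)
  rw [show 2 * e.g + H = e.g + (e.g + H) by ring]
  linarith

/-- Two points of a ball in the same steep set, the case of small slope forms: the two lines are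
parallel. -/
theorem IsSteepAt.abs_form_le_of_lt {p₁ p₂ : ι} {q₁ q₂ : ℕ} {u₁ v₁ A₁ B₁ C₁ u₂ v₂ A₂ B₂ C₂ : ℤ}
    {L₁ w₁ L₂ w₂ : ℝ} {n : ℕ} (hc : IsCurve S X Y m K k σ) (hK : K ≤ exp e.g)
    (h₁ : IsSteepAt e S X Y m p₁ q₁ u₁ v₁ A₁ B₁ C₁ L₁ w₁)
    (h₂ : IsSteepAt e S X Y m p₂ q₂ u₂ v₂ A₂ B₂ C₂ L₂ w₂)
    (hR₁ : e.IsStage n (e.steepScale L₁ w₁)) (hR₂ : e.IsStage n (e.steepScale L₂ w₂))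
    (hL : |L₁ - L₂| ≤ e.g) (hw : |w₁ - w₂| ≤ e.g)
    (hΔ : |X p₂ - X p₁| ≤ exp (e.a - n * e.lam))
    (hcase : e.ℓ < e.i * (e.i * L₁ - w₁))
    (hav : AvoidsRationals e.i e.j e.ℓ e.ε (exp (e.a - n * e.lam)) (X p₁) (Y p₁)) :
    |A₁ * X p₂ + B₁ * Y p₂ + C₁| ≤ exp (4 * e.g - e.ℓ - L₁) := by
  have hg := e.one_le_g
  have hℓ := e.ℓ_pos
  have hL0 := h₁.nonneg
  rw [abs_le] at hL hw
  have hΔ' : |X p₁ - X p₂| ≤ exp (e.a - n * e.lam) := by rwa [abs_sub_comm]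
  have hst₁ := h₁.steep_bound hK hR₁ le_rfl (exp_pos _).le
  have hKB₁ : 0 ≤ K * |(B₁ : ℝ)| * exp (e.a - n * e.lam) := by
    have := hc.one_le; positivity
  have hF₂ := h₂.abs_form_le
  set U := e.i * L₁ - w₁ with hU
  obtain ⟨⟨hU0, hsU⟩, n1, n2, n3, n4⟩ := e.steep_parallel hL0 hU hcase h₁.le_w
  have hscale : w₁ + e.steepScale L₁ w₁ = -L₁ - (e.s + e.τ) * e.ℓ + e.s * (e.i * U) := by
    unfold Exponents.steepScale; rw [hU]; ring
  have hτ1 : e.τ * e.ℓ ≤ e.ℓ := by nlinarith [e.τ_le]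
  obtain ⟨hF₂₁, hV₂₁⟩ := h₂.abs_form_le_at_other (H := e.g + (-L₁ - e.τ * e.ℓ - e.ℓ + e.i * U)) hc hK
    h₁.mem hR₂ hΔ' hR₁.1 (by linarith) (by linarith)
  have hF₂₁' : |A₂ * X p₁ + B₂ * Y p₁ + C₂| ≤
      exp (-L₁ - e.τ * e.ℓ - e.ℓ + e.i * U + 3 * e.g) :=
    hF₂₁.trans (exp_le_exp.2 (by linarith))
  have hF₁₁' : |A₁ * X p₁ + B₁ * Y p₁ + C₁| ≤
      exp (-L₁ - e.τ * e.ℓ - e.ℓ + e.i * U + 3 * e.g) :=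
    h₁.abs_form_le.trans ((e.two_mul_exp_le _).trans (exp_le_exp.2 (by linarith)))
  have hV₁ : |A₁ + B₁ * m p₁| ≤ exp (w₁ + 2 * e.g) := by
    rw [h₁.slope, exp_le_exp]; linarith
  have hV₂ : |A₂ + B₂ * m p₁| ≤ exp (w₁ + 2 * e.g) :=
    hV₂₁.trans (exp_le_exp.2 (by linarith))
  have hB₁ : |(B₁ : ℝ)| ≤ exp (e.g + e.j * L₁) :=
    h₁.abs_B_le.trans (exp_le_exp.2 (by linarith))
  have hB₂ : |(B₂ : ℝ)| ≤ exp (e.g + e.j * L₁) := by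
    refine h₂.abs_B_le.trans (exp_le_exp.2 ?_)
    have := mul_le_mul_of_nonneg_left (show L₂ - L₁ ≤ e.g by linarith) e.j_pos.le
    linarith [mul_le_mul_of_nonneg_right e.j_le_one (show 0 ≤ e.g by linarith)]
  have hK8 := e.eight_mul_le hK
  have h8 : 8 ≤ exp (4 * e.g) := by linarith [hc.one_le]
  have m1 : 2 * exp (w₁ + 2 * e.g) * exp (e.g + e.j * L₁) ≤ exp (w₁ + e.j * L₁ + 4 * e.g) := by
    rw [mul_assoc, ← exp_add]
    exact (e.two_mul_exp_le _).trans (exp_le_exp.2 (by linarith))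
  have m2 : 8 * K * (exp (e.g + e.j * L₁) * exp (-L₁ - e.τ * e.ℓ - e.ℓ + e.i * U + 3 * e.g)) ≤
      exp (-e.ℓ - e.i * (w₁ + e.j * L₁ + 4 * e.g)) := by
    rw [← exp_add]
    refine (mul_le_mul_of_nonneg_right hK8 (exp_pos _).le).trans ?_
    rw [← exp_add, exp_le_exp]
    exact n1
  have m3 : 8 * (exp (w₁ + 2 * e.g) * exp (-L₁ - e.τ * e.ℓ - e.ℓ + e.i * U + 3 * e.g)) ≤
      exp (-e.ℓ - e.j * (w₁ + e.j * L₁ + 4 * e.g)) := by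
    rw [← exp_add]
    refine (mul_le_mul_of_nonneg_right h8 (exp_pos _).le).trans ?_
    rw [← exp_add, exp_le_exp]
    exact n2
  obtain ⟨c1, c2, c3⟩ := hav.cross_eq_zero e.i_pos e.i_lt e.j_pos
    e.j_le hℓ.le hc.one_le (hc.slope_le _ h₁.mem) hB₁ hB₂ hV₁ hV₂ hF₁₁' hF₂₁' m1 m2 m3 n3
    (exp_le_exp.2 (hR₁.1.trans n4))
  -- For proportional lines the line forms are in the ratio of the slope forms, which are comparable
  -- at `p₂`.
  have hcross : (A₁ + B₁ * m p₂) * (A₂ * X p₂ + B₂ * Y p₂ + C₂) =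
      (A₂ + B₂ * m p₂) * (A₁ * X p₂ + B₁ * Y p₂ + C₁) := by
    have c1' : (A₁ * B₂ : ℝ) = A₂ * B₁ := by exact_mod_cast c1
    have c2' : (B₁ * C₂ : ℝ) = B₂ * C₁ := by exact_mod_cast c2
    have c3' : (C₁ * A₂ : ℝ) = C₂ * A₁ := by exact_mod_cast c3
    linear_combination (Y p₂ - m p₂ * X p₂) * c1' + m p₂ * c2' - c3'
  have h1 : |A₁ + B₁ * m p₂| ≤ 2 * exp w₁ :=
    hc.abs_slopeForm_le h₁.mem h₂.mem hΔ h₁.slope.le (by linarith)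
  have h2 : exp w₂ * |A₁ * X p₂ + B₁ * Y p₂ + C₁| ≤ 2 * exp w₁ * (2 * exp (-e.ℓ - L₂)) := by
    rw [← h₂.slope, ← abs_mul, ← hcross, abs_mul]
    exact mul_le_mul h1 hF₂ (abs_nonneg _) (by positivity)
  have h3 : 2 * exp w₁ * (2 * exp (-e.ℓ - L₂)) ≤ exp w₂ * exp (4 * e.g - e.ℓ - L₁) := by
    have e1 := e.two_mul_exp_le (w₁ + (-e.ℓ - L₂))
    have e2 := e.two_mul_exp_le (e.g + (w₁ + (-e.ℓ - L₂)))
    have e3 : 2 * exp w₁ * (2 * exp (-e.ℓ - L₂)) = 2 * (2 * exp (w₁ + (-e.ℓ - L₂))) := by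
      rw [exp_add w₁]; ring
    have e4 : exp (e.g + (e.g + (w₁ + (-e.ℓ - L₂)))) ≤
        exp w₂ * exp (4 * e.g - e.ℓ - L₁) := by
      rw [← exp_add, exp_le_exp]; linarith
    linarith
  exact le_of_mul_le_mul_left (h2.trans h3) (exp_pos _)

/-- Two points of a ball in the same steep set: both are close to the line of the first. -/
theorem IsSteepAt.abs_form_le_of_isSteepAt {p₁ p₂ : ι} {q₁ q₂ : ℕ} {u₁ v₁ A₁ B₁ C₁ u₂ v₂ A₂ B₂ C₂ : ℤ}
    {L₁ w₁ L₂ w₂ : ℝ} {n : ℕ} (hc : IsCurve S X Y m K k σ) (hK : K ≤ exp e.g)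
    (h₁ : IsSteepAt e S X Y m p₁ q₁ u₁ v₁ A₁ B₁ C₁ L₁ w₁)
    (h₂ : IsSteepAt e S X Y m p₂ q₂ u₂ v₂ A₂ B₂ C₂ L₂ w₂)
    (hR₁ : e.IsStage n (e.steepScale L₁ w₁)) (hR₂ : e.IsStage n (e.steepScale L₂ w₂))
    (hL : |L₁ - L₂| ≤ e.g) (hw : |w₁ - w₂| ≤ e.g)
    (hΔ : |X p₂ - X p₁| ≤ exp (e.a - n * e.lam))
    (hav : AvoidsRationals e.i e.j e.ℓ e.ε (exp (e.a - n * e.lam)) (X p₁) (Y p₁)) :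
    |A₁ * X p₂ + B₁ * Y p₂ + C₁| ≤ exp (4 * e.g - e.ℓ - L₁) := by
  rcases le_or_gt (e.i * (e.i * L₁ - w₁)) e.ℓ with hcase | hcase
  · exact h₁.abs_form_le_of_le hc hK h₂ hR₁ hL hΔ hcase
  · exact h₁.abs_form_le_of_lt hc hK h₂ hR₁ hR₂ hL hw hΔ hcase hav

/-- A steep set meets a ball in one cluster. -/
theorem abs_sub_le_of_mem_steepSet {n N : ℕ} {p p' : ι} (hc : IsCurve S X Y m K k σ)
    (hK : K ≤ exp e.g) (hp : p ∈ steepSet e S X Y m n N) (hp' : p' ∈ steepSet e S X Y m n N)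
    (hΔ : |X p' - X p| ≤ exp (e.a - n * e.lam))
    (hav : AvoidsRationals e.i e.j e.ℓ e.ε (exp (e.a - n * e.lam)) (X p) (Y p)) :
    |X p' - X p| ≤ exp (e.a₁ - N * e.lam) := by
  obtain ⟨q₁, u₁, v₁, A₁, B₁, C₁, L₁, w₁, h₁, hR₁, hD₁⟩ := hp
  obtain ⟨q₂, u₂, v₂, A₂, B₂, C₂, L₂, w₂, h₂, hR₂, hD₂⟩ := hp'
  have hg := e.one_le_g
  obtain ⟨hL, hw⟩ := Exponents.steep_comparable hR₁ hR₂ hD₁ hD₂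
  have hF := h₁.abs_form_le_of_isSteepAt hc hK h₂ hR₁ hR₂ hL hw hΔ hav
  have hF₁ : |A₁ * X p + B₁ * Y p + C₁| ≤ exp (4 * e.g - e.ℓ - L₁) :=
    h₁.abs_form_le.trans ((e.two_mul_exp_le _).trans (exp_le_exp.2 (by linarith)))
  have h1 := hc.abs_sub_le_of_steep h₁.mem h₂.mem hΔ h₁.slope.ge
    (h₁.steep_bound hK hR₁ le_rfl (exp_pos _).le) hF₁ hF
  have h2 : 4 * exp (4 * e.g - e.ℓ - L₁) ≤ exp w₁ * exp (e.steepSize L₁ w₁) := by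
    have e1 := e.two_mul_exp_le (4 * e.g - e.ℓ - L₁)
    have e2 := e.two_mul_exp_le (e.g + (4 * e.g - e.ℓ - L₁))
    rw [← exp_add, show w₁ + e.steepSize L₁ w₁ = e.g + (e.g + (4 * e.g - e.ℓ - L₁)) by
      unfold Exponents.steepSize; ring]
    linarith
  exact (le_of_mul_le_mul_left (h1.trans h2) (exp_pos _)).trans (exp_le_exp.2 hD₁.1)

end Clusters

/-! ### Almost tangential lines: two clusters per ball -/

section FlatClusters

variable {ι : Type*} {e : Exponents} {S : Set ι} {X Y m : ι → ℝ} {K k σ : ℝ}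

theorem Exponents.flat_comparable {n : ℕ} {L L' : ℝ} (hR : e.IsStage n (e.flatScale L))
    (hR' : e.IsStage n (e.flatScale L')) : |L - L'| ≤ e.g := by
  have h1 := abs_le.1 (hR.abs_sub_le hR')
  unfold Exponents.flatScale at h1
  have hj := e.j_pos
  have hν := e.ν_pos
  have hg := e.one_le_g
  have hl := e.lam_le'
  have h3 : (e.j + e.ν) * (L - L') ≤ (e.j + e.ν) * e.g := by
    have := mul_nonneg hν.le (show 0 ≤ e.g by linarith)
    linarith [h1.1]
  have h4 : (e.j + e.ν) * (-e.g) ≤ (e.j + e.ν) * (L - L') := by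
    have := mul_nonneg hν.le (show 0 ≤ e.g by linarith)
    linarith [h1.2]
  exact abs_le.2 ⟨le_of_mul_le_mul_left h4 (by linarith), le_of_mul_le_mul_left h3 (by linarith)⟩

/-- The numerical conditions under which two lines of a flat set are parallel. -/
theorem Exponents.flat_parallel {L : ℝ} (hL : 0 ≤ L) :
    (6 * e.g + e.j * L + (2 * e.g - e.ℓ - L) ≤
      -e.ℓ - e.i * ((e.j - e.ν) * L - e.μ * e.ℓ + 4 * e.g)) ∧
    (6 * e.g + e.j * L + (2 * e.g - (e.μ + e.x) * e.ℓ - (e.j + 2 * e.ν) * L) ≤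
      -e.ℓ - e.i * ((e.j - e.ν) * L - e.μ * e.ℓ + 4 * e.g)) ∧
    (7 * e.g - e.μ * e.ℓ - e.ν * L + (2 * e.g - e.ℓ - L) ≤
      -e.ℓ - e.j * ((e.j - e.ν) * L - e.μ * e.ℓ + 4 * e.g)) ∧
    (7 * e.g - e.μ * e.ℓ - e.ν * L + (2 * e.g - (e.μ + e.x) * e.ℓ - (e.j + 2 * e.ν) * L) ≤
      -e.ℓ - e.j * ((e.j - e.ν) * L - e.μ * e.ℓ + 4 * e.g)) ∧
    -e.ℓ ≤ (e.j - e.ν) * L - e.μ * e.ℓ + 4 * e.g ∧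
    e.flatScale L ≤ -(1 + e.ε) * e.ℓ - (1 + e.i) * ((e.j - e.ν) * L - e.μ * e.ℓ + 4 * e.g) := by
  have hg := e.one_le_g
  have hℓ := e.ℓ_pos
  have hi := e.i_pos
  have hi1 := e.i_lt
  have hj := e.j_pos
  have hj1 := e.j_le_one
  have hν := e.ν_pos
  have hνj := e.ν_le_j
  have hig : e.i * e.g ≤ e.g := by nlinarith
  have hjg : e.j * e.g ≤ e.g := by nlinarith
  have hgε := e.g_le
  have hgμ := e.g_le_iμ
  have hμℓ : e.μ * e.ℓ ≤ e.ℓ / 2 := by nlinarith [e.μ_le]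
  have hμℓ0 : 0 < e.μ * e.ℓ := mul_pos e.μ_pos hℓ
  have hiμℓ : e.i * e.μ * e.ℓ ≤ e.μ * e.ℓ := by nlinarith
  have hjμℓ : 0 < e.j * (e.μ * e.ℓ) := mul_pos hj hμℓ0
  have hx := mul_le_mul_of_nonneg_right e.le_x' hℓ.le
  have hνL : 0 ≤ e.ν * L := mul_nonneg hν.le hL
  have hjνL : e.ν * L ≤ e.j * L := mul_le_mul_of_nonneg_right hνj hL
  -- The relation for `ν` makes the `L` terms cancel exactly in the second and in the last
  -- inequality.
  have hνi : e.ν * (2 + e.i) * L = e.i * e.j * L := by rw [e.ν_mul]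
  have hjj : e.j * (e.j * L - e.ν * L) ≤ e.j * L - e.ν * L := by nlinarith
  have hiL : e.i * L + e.j * L = L := by linear_combination L * e.i_add_j
  have hinu : e.i * (e.j * L - e.ν * L) ≤ e.i * L := by nlinarith
  unfold Exponents.flatScale
  refine ⟨?_, ?_, ?_, ?_, by linarith, ?_⟩
  · linarith
  · linarith
  · linarith
  · linarith
  · linarith

theorem IsFlatAt.flat_bound {p : ι} {A B C : ℤ} {L : ℝ} {n : ℕ}
    (hK : K ≤ exp e.g) (h : IsFlatAt e S X Y m p A B C L) (hR : e.IsStage n (e.flatScale L)) :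
    K * |(B : ℝ)| * exp (e.a - n * e.lam) ≤ exp (-e.μ * e.ℓ - e.ν * L) := by
  refine mul_abs_le_exp_sub hK h.abs_B_le (exp_le_exp.2 hR.1) (exp_pos _).le ?_
  have h1 := mul_le_mul_of_nonneg_right e.le_x e.ℓ_pos.le
  have h2 := e.g_le
  have h3 := e.one_le_g
  unfold Exponents.flatScale
  linarith

/-- Two points of a ball in the same flat set: both are close to the line of the first. -/
theorem IsFlatAt.abs_form_le_of_isFlatAt {p₁ p₂ : ι} {A₁ B₁ C₁ A₂ B₂ C₂ : ℤ} {L₁ L₂ : ℝ} {n : ℕ}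
    (hc : IsCurve S X Y m K k σ) (hK : K ≤ exp e.g)
    (h₁ : IsFlatAt e S X Y m p₁ A₁ B₁ C₁ L₁) (h₂ : IsFlatAt e S X Y m p₂ A₂ B₂ C₂ L₂)
    (hR₁ : e.IsStage n (e.flatScale L₁)) (hR₂ : e.IsStage n (e.flatScale L₂))
    (hΔ : |X p₂ - X p₁| ≤ exp (e.a - n * e.lam))
    (hav : AvoidsRationals e.i e.j e.ℓ e.ε (exp (e.a - n * e.lam)) (X p₁) (Y p₁)) :
    |A₁ * X p₂ + B₁ * Y p₂ + C₁| ≤ exp (5 * e.g - e.ℓ - L₁) := by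
  have hg := e.one_le_g
  have hL := abs_le.1 (Exponents.flat_comparable hR₁ hR₂)
  have hL0 := h₁.nonneg
  have hΔ' : |X p₁ - X p₂| ≤ exp (e.a - n * e.lam) := by rwa [abs_sub_comm]
  obtain ⟨n1, n2, n3, n4, n5, n6⟩ := e.flat_parallel hL0
  have hst₂ := h₂.flat_bound hK hR₂
  have hν1 : e.ν ≤ 1 := e.ν_le_j.trans e.j_le_one
  have hνL : -e.ν * L₂ ≤ e.g - e.ν * L₁ := by
    have := mul_le_mul_of_nonneg_left (show L₁ - L₂ ≤ e.g by linarith) e.ν_pos.le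
    linarith [mul_le_mul_of_nonneg_right hν1 (show 0 ≤ e.g by linarith)]
  have hjL : e.j * |L₁ - L₂| ≤ e.g := by
    have := mul_le_mul e.j_le_one (abs_le.2 hL) (abs_nonneg _) zero_le_one
    linarith
  have hjL₁ : e.j * L₂ ≤ e.g + e.j * L₁ := by
    have := mul_le_mul_of_nonneg_left (neg_abs_le (L₁ - L₂)) e.j_pos.le
    linarith
  have hjL₂ : e.j * L₁ ≤ e.g + e.j * L₂ := by
    have := mul_le_mul_of_nonneg_left (le_abs_self (L₁ - L₂)) e.j_pos.le
    linarith
  have hB₁ : |(B₁ : ℝ)| ≤ exp (e.g + e.j * L₁) :=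
    h₁.abs_B_le.trans (exp_le_exp.2 (by linarith))
  have hB₂ : |(B₂ : ℝ)| ≤ exp (e.g + e.j * L₁) := h₂.abs_B_le.trans (exp_le_exp.2 hjL₁)
  have hV₁ : |A₁ + B₁ * m p₁| ≤ exp (2 * e.g - e.μ * e.ℓ - e.ν * L₁) :=
    h₁.slope_le.trans (exp_le_exp.2 (by linarith))
  have hV₂ : |A₂ + B₂ * m p₁| ≤ exp (2 * e.g - e.μ * e.ℓ - e.ν * L₁) :=
    (hc.abs_slopeForm_le h₂.mem h₁.mem hΔ' h₂.slope_le hst₂).trans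
      ((e.two_mul_exp_le _).trans (exp_le_exp.2 (by linarith)))
  -- The two terms are the closeness of a point to its own line, and the variation of the second
  -- line form over the ball.
  set h := exp (2 * e.g - e.ℓ - L₁) +
    exp (2 * e.g - (e.μ + e.x) * e.ℓ - (e.j + 2 * e.ν) * L₁) with hh
  have hF₁ : |A₁ * X p₁ + B₁ * Y p₁ + C₁| ≤ h := by
    refine h₁.abs_form_le.trans ?_
    have := exp_pos (2 * e.g - (e.μ + e.x) * e.ℓ - (e.j + 2 * e.ν) * L₁)
    have : exp (e.g - e.ℓ - L₁) ≤ exp (2 * e.g - e.ℓ - L₁) := exp_le_exp.2 (by linarith)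
    linarith
  have hF₂ : |A₂ * X p₁ + B₂ * Y p₁ + C₂| ≤ h := by
    have h1 := hc.abs_form_le h₂.mem h₁.mem (C := (C₂ : ℝ)) hΔ' h₂.slope_le hst₂
    have h2 : exp (e.g - e.ℓ - L₂) ≤ exp (2 * e.g - e.ℓ - L₁) := exp_le_exp.2 (by linarith)
    have h3 : 2 * exp (-e.μ * e.ℓ - e.ν * L₂) * exp (e.a - n * e.lam) ≤
        exp (2 * e.g - (e.μ + e.x) * e.ℓ - (e.j + 2 * e.ν) * L₁) := by
      rw [mul_assoc, ← exp_add]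
      refine (e.two_mul_exp_le _).trans (exp_le_exp.2 ?_)
      have := hR₁.1
      unfold Exponents.flatScale at this
      linarith
    linarith [h₂.abs_form_le]
  have hK8 := e.eight_mul_le hK
  have h8 : 8 ≤ exp (4 * e.g) := by linarith [hc.one_le]
  have hhalf : ∀ {z t : ℝ}, e.g + z ≤ t → 2 * exp z ≤ exp t := fun hz =>
    (e.two_mul_exp_le _).trans (exp_le_exp.2 hz)
  have m1 : 2 * exp (2 * e.g - e.μ * e.ℓ - e.ν * L₁) * exp (e.g + e.j * L₁) ≤
      exp ((e.j - e.ν) * L₁ - e.μ * e.ℓ + 4 * e.g) := by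
    rw [mul_assoc, ← exp_add]
    exact hhalf (by linarith)
  have m2 : 8 * K * (exp (e.g + e.j * L₁) * h) ≤
      exp (-e.ℓ - e.i * ((e.j - e.ν) * L₁ - e.μ * e.ℓ + 4 * e.g)) := by
    refine (mul_le_mul_of_nonneg_right hK8 (by positivity)).trans ?_
    rw [hh, ← mul_assoc, mul_add, ← exp_add, ← exp_add, ← exp_add]
    have e1 := hhalf (t := -e.ℓ - e.i * ((e.j - e.ν) * L₁ - e.μ * e.ℓ + 4 * e.g)) (z := 4 * e.g + (e.g + e.j * L₁) + (2 * e.g - e.ℓ - L₁)) (by linarith [n1])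
    have e2 := hhalf (t := -e.ℓ - e.i * ((e.j - e.ν) * L₁ - e.μ * e.ℓ + 4 * e.g)) (z := 4 * e.g + (e.g + e.j * L₁) +
      (2 * e.g - (e.μ + e.x) * e.ℓ - (e.j + 2 * e.ν) * L₁)) (by linarith [n2])
    linarith
  have m3 : 8 * (exp (2 * e.g - e.μ * e.ℓ - e.ν * L₁) * h) ≤
      exp (-e.ℓ - e.j * ((e.j - e.ν) * L₁ - e.μ * e.ℓ + 4 * e.g)) := by
    refine (mul_le_mul_of_nonneg_right h8 (by positivity)).trans ?_
    rw [hh, ← mul_assoc, mul_add, ← exp_add, ← exp_add, ← exp_add]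
    have e1 := hhalf (t := -e.ℓ - e.j * ((e.j - e.ν) * L₁ - e.μ * e.ℓ + 4 * e.g)) (z := 4 * e.g + (2 * e.g - e.μ * e.ℓ - e.ν * L₁) + (2 * e.g - e.ℓ - L₁))
      (by linarith [n3])
    have e2 := hhalf (t := -e.ℓ - e.j * ((e.j - e.ν) * L₁ - e.μ * e.ℓ + 4 * e.g)) (z := 4 * e.g + (2 * e.g - e.μ * e.ℓ - e.ν * L₁) +
      (2 * e.g - (e.μ + e.x) * e.ℓ - (e.j + 2 * e.ν) * L₁)) (by linarith [n4])
    linarith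
  obtain ⟨c1, c2, -⟩ := hav.cross_eq_zero e.i_pos e.i_lt e.j_pos
    e.j_le e.ℓ_pos.le hc.one_le (hc.slope_le _ h₁.mem) hB₁ hB₂ hV₁ hV₂ hF₁ hF₂ m1 m2 m3 n5
    (exp_le_exp.2 (hR₁.1.trans n6))
  -- The proportional lines are compared through `B`, since here the slope forms may vanish.
  have hcross : (B₂ : ℝ) * (A₁ * X p₂ + B₁ * Y p₂ + C₁) = B₁ * (A₂ * X p₂ + B₂ * Y p₂ + C₂) := by
    have c1' : (A₁ * B₂ : ℝ) = A₂ * B₁ := by exact_mod_cast c1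
    have c2' : (B₁ * C₂ : ℝ) = B₂ * C₁ := by exact_mod_cast c2
    linear_combination X p₂ * c1' - c2'
  have h1 : |(B₂ : ℝ)| * |A₁ * X p₂ + B₁ * Y p₂ + C₁| ≤
      exp (e.j * L₁) * exp (e.g - e.ℓ - L₂) := by
    rw [← abs_mul, hcross, abs_mul]
    exact mul_le_mul h₁.abs_B_le h₂.abs_form_le (abs_nonneg _) (exp_pos _).le
  have h2 : exp (e.j * L₁) * exp (e.g - e.ℓ - L₂) ≤
      exp (e.j * L₂ - 2 * e.g) * exp (5 * e.g - e.ℓ - L₁) := by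
    rw [← exp_add, ← exp_add, exp_le_exp]
    linarith
  have h3 := (mul_le_mul_of_nonneg_right h₂.le_abs_B (abs_nonneg
    (A₁ * X p₂ + B₁ * Y p₂ + C₁))).trans (h1.trans h2)
  exact le_of_mul_le_mul_left h3 (exp_pos _)

/-- A flat set meets a ball in two clusters. -/
theorem exists_cover_flatSet {n N : ℕ} {J : Set ι} (hc : IsCurve S X Y m K k σ)
    (hK : K ≤ exp e.g) (hk : exp (-e.g) ≤ k)
    (hΔ : ∀ p ∈ J, ∀ p' ∈ J, |X p' - X p| ≤ exp (e.a - n * e.lam))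
    (hav : ∀ p ∈ J, AvoidsRationals e.i e.j e.ℓ e.ε (exp (e.a - n * e.lam)) (X p) (Y p)) :
    ∃ C₁ C₂ : Set ι, J ∩ flatSet e S X Y m n N ⊆ C₁ ∪ C₂ ∧ C₁ ⊆ J ∧ C₂ ⊆ J ∧
      (∀ p ∈ C₁, ∀ p' ∈ C₁, |X p' - X p| ≤ exp (e.a₁ - N * e.lam)) ∧
      (∀ p ∈ C₂, ∀ p' ∈ C₂, |X p' - X p| ≤ exp (e.a₁ - N * e.lam)) := by
  rcases (J ∩ flatSet e S X Y m n N).eq_empty_or_nonempty with h0 | ⟨p₀, hp₀, h₀⟩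
  · exact ⟨∅, ∅, by rw [h0]; exact empty_subset _, empty_subset _, empty_subset _,
      by simp, by simp⟩
  have hg := e.one_le_g
  obtain ⟨A, B, C, L, h₁, hR₁, hD₁⟩ := h₀
  have hF : ∀ p ∈ J ∩ flatSet e S X Y m n N, p ∈ S ∧
      |A * X p + B * Y p + C| ≤ exp (5 * e.g - e.ℓ - L) := by
    rintro p ⟨hp, A₂, B₂, C₂, L₂, h₂, hR₂, -⟩
    exact ⟨h₂.mem, h₁.abs_form_le_of_isFlatAt hc hK h₂ hR₁ hR₂ (hΔ _ hp₀ _ hp) (hav _ hp₀)⟩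
  have key : ∀ p ∈ J ∩ flatSet e S X Y m n N, ∀ p' ∈ J ∩ flatSet e S X Y m n N,
      0 ≤ (A + B * m p) * (A + B * m p') → |X p' - X p| ≤ exp (e.a₁ - N * e.lam) := by
    intro p hp p' hp' hs
    have h2 := hc.sq_le_of_flat (hF p hp).1 (hF p' hp').1 hs (hF p hp).2 (hF p' hp').2
    have h3 : exp (e.j * L - 2 * e.g) * exp (-e.g) ≤ |(B : ℝ)| * k :=
      mul_le_mul h₁.le_abs_B hk (exp_pos _).le (abs_nonneg _)
    have h4 := (mul_le_mul_of_nonneg_right h3 (sq_nonneg |X p' - X p|)).trans h2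
    have h5 : 2 * exp (5 * e.g - e.ℓ - L) ≤
        exp (e.j * L - 2 * e.g) * exp (-e.g) * exp (e.flatSize L) ^ 2 := by
      refine (e.two_mul_exp_le _).trans ?_
      rw [pow_two, ← exp_add, ← exp_add, ← exp_add, exp_le_exp]
      unfold Exponents.flatSize
      linarith
    have h6 := le_of_mul_le_mul_left (h4.trans h5) (by positivity)
    exact (abs_le_of_sq_le_sq' h6 (exp_pos _).le).2.trans (exp_le_exp.2 hD₁.1)
  refine ⟨{p ∈ J ∩ flatSet e S X Y m n N | 0 ≤ (A + B * m p : ℝ)},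
    {p ∈ J ∩ flatSet e S X Y m n N | (A + B * m p : ℝ) ≤ 0}, ?_, fun p hp => hp.1.1,
    fun p hp => hp.1.1, fun p hp p' hp' => key p hp.1 p' hp'.1 (mul_nonneg hp.2 hp'.2),
    fun p hp p' hp' => key p hp.1 p' hp'.1 (mul_nonneg_of_nonpos_of_nonpos hp.2 hp'.2)⟩
  intro p hp
  rcases le_total 0 (A + B * m p : ℝ) with h | h
  · exact Or.inl ⟨hp, h⟩
  · exact Or.inr ⟨hp, h⟩

end FlatClusters

/-! ### Shifted rational points: one cluster per ball -/

section ShiftedClusters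

variable {ι : Type*} {e : Exponents} {S : Set ι} {X Y m : ι → ℝ} {K k σ γ δ : ℝ}

theorem Exponents.shifted_comparable {n : ℕ} {L L' : ℝ} (hR : e.IsStage n (e.shiftedScale L))
    (hR' : e.IsStage n (e.shiftedScale L')) : |L - L'| ≤ e.g := by
  have h1 := abs_le.1 (hR.abs_sub_le hR')
  unfold Exponents.shiftedScale at h1
  have hi := e.i_pos
  have hg := e.one_le_g
  have hl := e.lam_le_g
  have hig : 0 ≤ e.i * e.g := by positivity
  have h3 : (1 + e.i) * (L - L') ≤ (1 + e.i) * e.g := by linarith [h1.1]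
  have h4 : (1 + e.i) * (-e.g) ≤ (1 + e.i) * (L - L') := by linarith [h1.2]
  exact abs_le.2 ⟨le_of_mul_le_mul_left h4 (by linarith), le_of_mul_le_mul_left h3 (by linarith)⟩

theorem IsShiftedAt.nonneg {p : ι} {q : ℕ} {u v : ℤ} {L : ℝ}
    (h : IsShiftedAt e S X Y γ δ p q u v L) : 0 ≤ L := by
  rw [h.log_eq]
  exact log_nonneg (by exact_mod_cast h.one_le)

/-- The difference of two shifted rational points near a ball is close to the ball. -/
theorem Exponents.abs_sub_le_of_shifted {κ L₁ L₂ a x₁ x₂ q₁ q₂ u₁ u₂ : ℝ} (hκ0 : 0 ≤ κ)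
    (hκ : κ ≤ 1) (hL : L₂ - L₁ ≤ e.g) (hq₂ : q₂ = exp L₂)
    (h₁ : |q₁ * x₁ - a - u₁| ≤ exp (-(1 + 3 * e.ε) * e.ℓ - κ * L₁))
    (h₂ : |q₂ * x₂ - a - u₂| ≤ exp (-(1 + 3 * e.ε) * e.ℓ - κ * L₂))
    (hx : |x₂ - x₁| ≤ exp (2 * e.g - (1 + 2 * e.ε) * e.ℓ - (1 + κ) * L₂)) :
    |(q₂ - q₁) * x₁ - (u₂ - u₁)| ≤ exp (-e.g - e.ℓ - κ * L₂) := by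
  have hg := e.one_le_g
  have hgε := e.g_le
  have hκL : κ * L₂ ≤ e.g + κ * L₁ := by
    have h3 := mul_le_mul_of_nonneg_left hL hκ0
    linarith [mul_le_mul_of_nonneg_right hκ (show 0 ≤ e.g by linarith)]
  set t := 2 * e.g - (1 + 2 * e.ε) * e.ℓ - κ * L₂
  have e1 : exp (-(1 + 3 * e.ε) * e.ℓ - κ * L₁) ≤ exp t := exp_le_exp.2 (by linarith)
  have e2 : exp (-(1 + 3 * e.ε) * e.ℓ - κ * L₂) ≤ exp t := exp_le_exp.2 (by linarith)
  have e3 : |q₂ * (x₂ - x₁)| ≤ exp t := by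
    rw [abs_mul, hq₂, abs_of_pos (exp_pos _)]
    refine (mul_le_mul_of_nonneg_left hx (exp_pos _).le).trans ?_
    rw [← exp_add, exp_le_exp]; linarith
  have e4 := e.two_mul_exp_le t
  have e5 := e.two_mul_exp_le (e.g + t)
  have e6 : exp (e.g + (e.g + t)) ≤ exp (-e.g - e.ℓ - κ * L₂) := exp_le_exp.2 (by linarith)
  have e7 : 0 < exp t := exp_pos _
  rw [show (q₂ - q₁) * x₁ - (u₂ - u₁) = (q₂ * x₂ - a - u₂) - (q₁ * x₁ - a - u₁) - q₂ * (x₂ - x₁) by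
    ring]
  have e8 := abs_sub ((q₂ * x₂ - a - u₂) - (q₁ * x₁ - a - u₁)) (q₂ * (x₂ - x₁))
  have e9 := abs_sub (q₂ * x₂ - a - u₂) (q₁ * x₁ - a - u₁)
  linarith

/-- A shifted set meets a ball in one cluster. -/
theorem abs_sub_le_of_mem_shiftedSet {n N : ℕ} {p p' : ι} (hc : IsCurve S X Y m K k σ)
    (hK : K ≤ exp e.g) (hp : p ∈ shiftedSet e S X Y γ δ n N) (hp' : p' ∈ shiftedSet e S X Y γ δ n N)
    (hΔ : |X p' - X p| ≤ exp (e.a - n * e.lam))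
    (hav : AvoidsRationals e.i e.j e.ℓ e.ε (exp (e.a - n * e.lam)) (X p) (Y p))
    (hav' : AvoidsRationals e.i e.j e.ℓ e.ε (exp (e.a - n * e.lam)) (X p') (Y p')) :
    |X p' - X p| ≤ exp (e.a₁ - N * e.lam) := by
  obtain ⟨q₁, u₁, v₁, L₁, h₁, hR₁, hD₁⟩ := hp
  obtain ⟨q₂, u₂, v₂, L₂, h₂, hR₂, hD₂⟩ := hp'
  wlog hq : q₁ ≤ q₂ generalizing p p' q₁ u₁ v₁ L₁ q₂ u₂ v₂ L₂
  · rw [abs_sub_comm]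
    exact this (by rwa [abs_sub_comm]) hav' hav q₂ u₂ v₂ L₂ h₂ hR₂ hD₂ q₁ u₁ v₁ L₁ h₁ hR₁ hD₁
      (le_of_not_ge hq)
  have hg := e.one_le_g
  have hℓ := e.ℓ_pos
  have hi := e.i_pos
  have hi1 := e.i_lt
  have hj := e.j_pos
  have hεℓ : 0 < e.ε * e.ℓ := mul_pos e.ε_pos hℓ
  have hL := abs_le.1 (Exponents.shifted_comparable hR₁ hR₂)
  have hL2 := h₂.nonneg
  have hexp₂ : (q₂ : ℝ) = exp L₂ := by
    rw [h₂.log_eq, exp_log]; exact_mod_cast h₂.one_le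
  have hjiL : e.j * L₂ ≤ e.i * L₂ := mul_le_mul_of_nonneg_right e.j_le hL2
  have hR := hR₂.1
  unfold Exponents.shiftedScale at hR
  have hX : |X p' - X p| ≤ exp (-(1 + 2 * e.ε) * e.ℓ - (1 + e.i) * L₂) :=
    hΔ.trans (exp_le_exp.2 hR)
  have hX1 : |X p' - X p| ≤ 1 := hX.trans (exp_le_one_iff.2 (by nlinarith))
  have hY : |Y p' - Y p| ≤ 2 * (exp e.g * |X p' - X p|) := by
    have e1 := hc.taylor_le p h₁.mem p' h₂.mem
    have e2 : |m p * (X p' - X p)| ≤ K * |X p' - X p| := by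
      rw [abs_mul]
      exact mul_le_mul_of_nonneg_right (hc.slope_le p h₁.mem) (abs_nonneg _)
    have e3 := abs_add_le (Y p' - Y p - m p * (X p' - X p)) (m p * (X p' - X p))
    rw [sub_add_cancel] at e3
    have e4 : K * |X p' - X p| ^ 2 ≤ K * |X p' - X p| := by
      refine mul_le_mul_of_nonneg_left ?_ (by linarith [hc.one_le])
      nlinarith [abs_nonneg (X p' - X p)]
    have e5 := mul_le_mul_of_nonneg_right hK (abs_nonneg (X p' - X p))
    linarith
  have hY' : |Y p' - Y p| ≤ exp (2 * e.g - (1 + 2 * e.ε) * e.ℓ - (1 + e.j) * L₂) := by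
    refine hY.trans ?_
    have e1 := mul_le_mul_of_nonneg_left hX (exp_pos e.g).le
    rw [← exp_add] at e1
    refine (mul_le_mul_of_nonneg_left e1 zero_le_two).trans ?_
    exact (e.two_mul_exp_le _).trans (exp_le_exp.2 (by linarith))
  have hdx := e.abs_sub_le_of_shifted hi.le hi1.le (by linarith) hexp₂ h₁.abs_x_le h₂.abs_x_le
    (hX.trans (exp_le_exp.2 (by linarith)))
  have hdy := e.abs_sub_le_of_shifted hj.le e.j_le_one (by linarith) hexp₂ h₁.abs_y_le h₂.abs_y_le
    hY'
  rcases hq.eq_or_lt with heq | hlt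
  -- With equal denominators the numerators `u₁`, `u₂` differ by an integer smaller than 1, so both
  -- points are close to the same vertical line.
  · have hsmall : ∀ κ : ℝ, 0 ≤ κ → exp (-e.g - e.ℓ - κ * L₂) < 1 := fun κ hκ =>
      exp_lt_one_iff.2 (by nlinarith)
    have hu : u₂ - u₁ = 0 := by
      rw [heq, sub_self, zero_mul, zero_sub, abs_neg] at hdx
      exact Int.abs_lt_one_iff.1 (by exact_mod_cast hdx.trans_lt (hsmall _ hi.le))
    have hLL : L₁ = L₂ := by rw [h₁.log_eq, h₂.log_eq, heq]
    have hu' : (u₂ : ℝ) = u₁ := by exact_mod_cast sub_eq_zero.1 hu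
    have e1 := h₁.abs_x_le
    have e2 := h₂.abs_x_le
    rw [hLL] at e1
    rw [← heq, hu'] at e2
    have e3 := abs_sub (q₁ * X p' - γ - u₁) (q₁ * X p - γ - u₁)
    rw [show (q₁ * X p' - γ - u₁) - (q₁ * X p - γ - u₁) = q₁ * (X p' - X p) by ring, abs_mul,
      Nat.abs_cast] at e3
    have hq₁ : (q₁ : ℝ) = exp L₂ := by rw [heq]; exact hexp₂
    have e4 := e.two_mul_exp_le (-(1 + 3 * e.ε) * e.ℓ - e.i * L₂)
    have e5 : exp L₂ * |X p' - X p| ≤ exp L₂ * exp (e.shiftedSize L₂) := by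
      rw [← exp_add, show L₂ + e.shiftedSize L₂ =
        e.g + (-(1 + 3 * e.ε) * e.ℓ - e.i * L₂) by unfold Exponents.shiftedSize; ring]
      rw [hq₁] at e1 e2 e3
      linarith
    exact (le_of_mul_le_mul_left e5 (exp_pos _)).trans (exp_le_exp.2 hD₂.1)
  -- With distinct denominators, subtraction removes the shift and leaves a rational point of
  -- denominator `q₂ - q₁` closer to `p` than avoidance permits.
  · exfalso
    have hq1 : 1 ≤ q₂ - q₁ := by omega
    have hcast : ((q₂ - q₁ : ℕ) : ℝ) = q₂ - q₁ := Nat.cast_sub hq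
    have hlog : log ((q₂ - q₁ : ℕ) : ℝ) ≤ L₂ := by
      rw [h₂.log_eq]
      exact log_le_log (by exact_mod_cast hq1) (by exact_mod_cast Nat.sub_le q₂ q₁)
    have hlog' : log (q₂ - q₁ : ℝ) ≤ L₂ := hcast ▸ hlog
    refine absurd (hav (q₂ - q₁) hq1 (u₂ - u₁) (v₂ - v₁) ?_ ?_) (not_lt.2 ?_)
    · rw [hcast]
      push_cast
      exact hdx.trans (exp_le_exp.2 (by linarith [mul_le_mul_of_nonneg_left hlog' hi.le]))
    · rw [hcast]
      push_cast
      exact hdy.trans (exp_le_exp.2 (by linarith [mul_le_mul_of_nonneg_left hlog' hj.le]))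
    · rw [exp_le_exp]
      linarith [mul_le_mul_of_nonneg_left hlog (show 0 ≤ 1 + e.i by linarith)]

end ShiftedClusters

/-! ### Choice of the exponents and assembly of the dangerous sets -/

section Construction

/-- Suitable exponents exist for all constants. -/
theorem Exponents.exists_of {i j : ℝ} (hj : 0 < j) (hji : j ≤ i) (hij : i + j = 1)
    {g₀ lam : ℝ} (hlam : 0 < lam) (a a₁ : ℝ) :
    ∃ e : Exponents, e.i = i ∧ e.j = j ∧ e.a = a ∧ e.a₁ = a₁ ∧ e.lam = lam ∧ g₀ ≤ e.g := by
  have hi : 0 < i := by linarith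
  have hi1 : i < 1 := by linarith
  have his : 0 < i * (4 / (4 + i)) := by positivity
  set g := max (max (max 1 |a|) (max |a₁| g₀)) (max (6 * lam / (i * (4 / (4 + i)))) (lam / j))
  have hg1 : 1 ≤ g := ((le_max_left _ _).trans (le_max_left _ _)).trans (le_max_left _ _)
  have hga : |a| ≤ g := ((le_max_right _ _).trans (le_max_left _ _)).trans (le_max_left _ _)
  have hga₁ : |a₁| ≤ g := ((le_max_left _ _).trans (le_max_right _ _)).trans (le_max_left _ _)
  have hg₀ : g₀ ≤ g := ((le_max_right _ _).trans (le_max_right _ _)).trans (le_max_left _ _)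
  have hgl : 6 * lam ≤ i * (4 / (4 + i)) * g := by
    have : 6 * lam / (i * (4 / (4 + i))) ≤ g := (le_max_left _ _).trans (le_max_right _ _)
    rw [div_le_iff₀ his] at this
    linarith
  have hgl' : lam ≤ j * g := by
    have : lam / j ≤ g := (le_max_right _ _).trans (le_max_right _ _)
    rw [div_le_iff₀ hj] at this
    linarith
  -- The limiting case is `s = 1`, `μ = 1 / (2 + i)`; taking `s` slightly smaller leaves room for
  -- `τ` and `ε`. Then `x` and `ℓ` are chosen to give equality in `le_x'` and `g_le`.
  refine ⟨{
    i := i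
    j := j
    s := 4 / (4 + i)
    τ := i / (2 * (4 + i))
    μ := 2 / (4 + 3 * i)
    ν := i * j / (2 + i)
    x := (8 + 5 * i) / (4 * (4 + 3 * i))
    ε := i / (8 * (4 + 3 * i))
    g := g
    ℓ := 100 * g / (i / (8 * (4 + 3 * i)))
    a := a
    a₁ := a₁
    lam := lam
    i_pos := hi
    i_lt := hi1
    j_pos := hj
    j_le := hji
    i_add_j := hij
    s_pos := by positivity
    τ_pos := by positivity
    s_add := by field_simp
    μ_pos := by positivity
    μ_mul := by field_simp; ring
    ν_pos := by positivity
    ν_mul := by field_simp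
    ε_pos := by positivity
    ε_le_τ := ?_
    ε_le_μ := ?_
    le_x := ?_
    le_x' := ?_
    x_le := ?_
    one_le_g := hg1
    lam_pos := hlam
    lam_le := hgl
    lam_le' := hgl'
    a_le := hga
    a₁_le := hga₁
    g_le := ?_ }, rfl, rfl, rfl, rfl, rfl, hg₀⟩
  · rw [← mul_div_assoc, div_le_div_iff₀ (by positivity) (by positivity)]
    nlinarith
  · rw [← mul_div_assoc, div_le_div_iff₀ (by positivity) (by positivity)]
    nlinarith
  · rw [← sub_nonneg]
    have : (8 + 5 * i) / (4 * (4 + 3 * i)) - (2 / (4 + 3 * i) + i / (8 * (4 + 3 * i))) =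
      9 * i / (8 * (4 + 3 * i)) := by field_simp; ring
    rw [this]; positivity
  · rw [← sub_nonneg]
    have : (8 + 5 * i) / (4 * (4 + 3 * i)) -
      (1 - 2 / (4 + 3 * i) * (1 + i) + 2 * (i / (8 * (4 + 3 * i)))) = 0 := by field_simp; ring
    rw [this]
  · rw [← sub_nonneg]
    have : 1 / 2 - ((8 + 5 * i) / (4 * (4 + 3 * i)) + i / (8 * (4 + 3 * i))) =
      i / (8 * (4 + 3 * i)) := by field_simp; ring
    rw [this]; positivity
  · rw [mul_div_cancel₀ _ (by positivity)]

/-- For a curve with non-vanishing curvature, the points which are not badly approximable are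
contained in sets which meet balls in few small clusters. -/
theorem IsCurve.exists_clusters {ι : Type*} {S : Set ι} {X Y m : ι → ℝ} {K k σ i j : ℝ}
    (hc : IsCurve S X Y m K k σ) (hj : 0 < j) (hji : j ≤ i) (hij : i + j = 1) (γ δ : ℝ)
    {r r₁ ϱ : ℝ} (hr : 0 < r) (hr₁ : 0 < r₁) (hϱ : 0 < ϱ) (hϱ1 : ϱ < 1) :
    ∃ T : ℕ → ℕ → Set ι,
      (∀ n N, 1 ≤ n → n + 10 ≤ N → ∀ J ⊆ S, (∀ p ∈ J, ∀ p' ∈ J, |X p' - X p| ≤ r * ϱ ^ n) →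
        (∀ n' N', 1 ≤ n' → n' + 10 ≤ N' → N' ≤ n → Disjoint J (T n' N')) →
        ∃ C : Fin 4 → Set ι, J ∩ T n N ⊆ ⋃ a, C a ∧ ∀ a, C a ⊆ J ∧
          ∀ p ∈ C a, ∀ p' ∈ C a, |X p' - X p| ≤ r₁ * ϱ ^ N) ∧
      ∀ p ∈ S, (∀ n N, 1 ≤ n → n + 10 ≤ N → p ∉ T n N) →
        ∃ c : ℝ, 0 < c ∧ ∀ q : ℕ, 1 ≤ q → c / (q : ℝ) <
          max (distInt (q * X p - γ) ^ (1 / i)) (distInt (q * Y p - δ) ^ (1 / j)) := by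
  have hi : 0 < i := by linarith
  have hlam : 0 < -log ϱ := by linarith [log_neg hϱ hϱ1]
  obtain ⟨e, rfl, rfl, ha, ha₁, hl, hg⟩ := Exponents.exists_of hj hji hij
    (g₀ := max (log K) (-log k)) hlam (log r) (log r₁)
  have hK : K ≤ exp e.g := by
    rw [← log_le_iff_le_exp (by linarith [hc.one_le])]
    exact (le_max_left _ _).trans hg
  have hk : exp (-e.g) ≤ k := by
    rw [← le_log_iff_exp_le hc.pos]
    linarith [(le_max_right (log K) (-log k)).trans hg]
  have hscale : ∀ n : ℕ, exp (e.a - n * e.lam) = r * ϱ ^ n := fun n => by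
    rw [ha, hl, mul_neg, sub_neg_eq_add, exp_add, exp_log hr, ← log_pow, exp_log (by positivity)]
  have hscale₁ : ∀ n : ℕ, exp (e.a₁ - n * e.lam) = r₁ * ϱ ^ n := fun n => by
    rw [ha₁, hl, mul_neg, sub_neg_eq_add, exp_add, exp_log hr₁, ← log_pow, exp_log (by positivity)]
  simp_rw [← hscale, ← hscale₁]
  refine ⟨fun n N => (steepSet e S X Y m n N ∪ flatSet e S X Y m n N) ∪ shiftedSet e S X Y γ δ n N,
    ?_, ?_⟩
  · intro n N hn hN J hJ hJd hdis
    have hav : ∀ p ∈ J, AvoidsRationals e.i e.j e.ℓ e.ε (exp (e.a - n * e.lam)) (X p) (Y p) :=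
      fun p hp => avoidsRationals_of_notMem hc hK (hJ hp)
        (fun n' N' h1 h2 h3 h4 => Set.disjoint_left.1 (hdis n' N' h1 h2 h3) hp (Or.inl (Or.inl h4)))
        (fun n' N' h1 h2 h3 h4 => Set.disjoint_left.1 (hdis n' N' h1 h2 h3) hp (Or.inl (Or.inr h4)))
    obtain ⟨C₁, C₂, hcov, hC₁, hC₂, hd₁, hd₂⟩ := exists_cover_flatSet (N := N) hc hK hk hJd hav
    refine ⟨![J ∩ steepSet e S X Y m n N, C₁, C₂, J ∩ shiftedSet e S X Y γ δ n N], ?_, ?_⟩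
    · rintro p ⟨hp, (h | h) | h⟩
      · exact mem_iUnion.2 ⟨0, hp, h⟩
      · rcases hcov ⟨hp, h⟩ with h | h
        · exact mem_iUnion.2 ⟨1, h⟩
        · exact mem_iUnion.2 ⟨2, h⟩
      · exact mem_iUnion.2 ⟨3, hp, h⟩
    · intro a
      fin_cases a
      · exact ⟨inter_subset_left, fun p hp p' hp' => abs_sub_le_of_mem_steepSet hc hK hp.2 hp'.2
          (hJd p hp.1 p' hp'.1) (hav p hp.1)⟩
      · exact ⟨hC₁, hd₁⟩
      · exact ⟨hC₂, hd₂⟩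
      · exact ⟨inter_subset_left, fun p hp p' hp' => abs_sub_le_of_mem_shiftedSet hc hK hp.2 hp'.2
          (hJd p hp.1 p' hp'.1) (hav p hp.1) (hav p' hp'.1)⟩
  · intro p hp hT
    set ζ := (1 + 3 * e.ε) * e.ℓ
    have hζ0 : 0 ≤ ζ := by have := e.ε_pos; have := e.ℓ_pos; positivity
    -- One constant has to serve both exponents `1 / i` and `1 / j`; the smaller of `i`, `j`
    -- decides.
    refine ⟨exp (-ζ / e.j), exp_pos _, fun q hq => ?_⟩
    have hq0 : (0 : ℝ) < q := by exact_mod_cast hq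
    have hL0 : 0 ≤ log q := log_nonneg (by exact_mod_cast hq)
    have hpow : ∀ κ t : ℝ, 0 < κ → e.j ≤ κ → exp (-ζ - κ * log q) < t →
        exp (-ζ / e.j) / q < t ^ (1 / κ) := by
      intro κ t hκ hjκ ht
      have h1 : exp (-ζ / e.j) / q ≤ exp (-ζ - κ * log q) ^ (1 / κ) := by
        rw [← exp_mul]
        nth_rewrite 1 [← exp_log hq0]
        rw [← exp_sub, exp_le_exp]
        have h2 : (-ζ - κ * log q) * (1 / κ) = -ζ / κ - log q := by field_simp
        have h3 : ζ / κ ≤ ζ / e.j := div_le_div_of_nonneg_left hζ0 hj hjκ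
        rw [h2, neg_div, neg_div]
        linarith
      exact h1.trans_lt (rpow_lt_rpow (exp_pos _).le ht (by positivity))
    rw [lt_max_iff]
    by_contra hcon
    push Not at hcon
    have hx : distInt (q * X p - γ) ≤ exp (-ζ - e.i * log q) := by
      by_contra h; exact absurd (hpow _ _ hi hji (not_le.1 h)) (not_lt.2 hcon.1)
    have hy : distInt (q * Y p - δ) ≤ exp (-ζ - e.j * log q) := by
      by_contra h; exact absurd (hpow _ _ hj le_rfl (not_le.1 h)) (not_lt.2 hcon.2)
    have hsh : IsShiftedAt e S X Y γ δ p q (round (q * X p - γ)) (round (q * Y p - δ)) (log q) :=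
      ⟨hp, hq, rfl, by rw [neg_mul]; exact hx, by rw [neg_mul]; exact hy⟩
    have hgε := e.g_le
    have hg1 := e.one_le_g
    obtain ⟨n, N, h1, h2, h3, h4⟩ := e.exists_levels (R := e.shiftedScale (log q))
      (D := e.shiftedSize (log q))
      (by
        have := mul_nonneg (show 0 ≤ 1 + e.i by linarith) hL0
        have := e.ℓ_pos
        unfold Exponents.shiftedScale
        linarith)
      (by unfold Exponents.shiftedSize Exponents.shiftedScale; linarith)
    exact hT n N h1 h2 (Or.inr ⟨q, _, _, log q, hsh, h3, h4⟩)

end Construction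

/-! ### Curvature bounds on compact arcs, and exchange of coordinates -/

section Calculus

theorem exists_sub_eq_mul_of_hasDerivAt {g g' : ℝ → ℝ} {s : Set ℝ} (hs : s.OrdConnected)
    (hg : ∀ t ∈ s, HasDerivAt g (g' t) t) {x y : ℝ} (hx : x ∈ s) (hy : y ∈ s) :
    ∃ ξ ∈ uIcc x y, g y - g x = g' ξ * (y - x) := by
  wlog hxy : x ≤ y generalizing x y
  · obtain ⟨ξ, hξ, h⟩ := this hy hx (le_of_not_ge hxy)
    exact ⟨ξ, by rwa [uIcc_comm], by linarith⟩
  rcases hxy.eq_or_lt with rfl | hxy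
  · exact ⟨x, left_mem_uIcc, by ring⟩
  · have hsub : Icc x y ⊆ s := hs.out hx hy
    obtain ⟨ξ, hξ, h⟩ := exists_hasDerivAt_eq_slope g g' hxy
      (fun t ht => (hg t (hsub ht)).continuousAt.continuousWithinAt)
      fun t ht => hg t (hsub (Ioo_subset_Icc_self ht))
    refine ⟨ξ, by rw [uIcc_of_le hxy.le]; exact Ioo_subset_Icc_self hξ, ?_⟩
    rw [h, div_mul_cancel₀ _ (sub_ne_zero.2 hxy.ne')]

/-- A function with increasing derivative lies above its tangent lines. -/
theorem tangent_le_of_monotoneOn {g g' : ℝ → ℝ} {s : Set ℝ} (hs : s.OrdConnected)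
    (hg : ∀ t ∈ s, HasDerivAt g (g' t) t) (hm : MonotoneOn g' s) {x y : ℝ} (hx : x ∈ s)
    (hy : y ∈ s) : g' x * (y - x) ≤ g y - g x := by
  obtain ⟨ξ, hξ, h⟩ := exists_sub_eq_mul_of_hasDerivAt hs hg hx hy
  have hξs : ξ ∈ s := hs.uIcc_subset hx hy hξ
  rw [h]
  rcases le_total x y with hxy | hxy
  · rw [uIcc_of_le hxy] at hξ
    exact mul_le_mul_of_nonneg_right (hm hx hξs hξ.1) (sub_nonneg.2 hxy)
  · rw [uIcc_of_ge hxy] at hξ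
    exact mul_le_mul_of_nonpos_right (hm hξs hx hξ.2) (sub_nonpos.2 hxy)

theorem monotoneOn_of_hasDerivAt_nonneg {g g' : ℝ → ℝ} {s : Set ℝ} (hs : s.OrdConnected)
    (hg : ∀ t ∈ s, HasDerivAt g (g' t) t) (h0 : ∀ t ∈ s, 0 ≤ g' t) : MonotoneOn g s := by
  intro x hx y hy hxy
  obtain ⟨ξ, hξ, h⟩ := exists_sub_eq_mul_of_hasDerivAt hs hg hx hy
  have := mul_nonneg (h0 ξ (hs.uIcc_subset hx hy hξ)) (sub_nonneg.2 hxy)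
  linarith

/-- A continuous non-vanishing function on a compact interval has constant sign, and is bounded
away from zero and infinity. -/
theorem exists_sign_and_bounds {g : ℝ → ℝ} {a b : ℝ} (hab : a ≤ b) (hg : ContinuousOn g (Icc a b))
    (h0 : ∀ t ∈ Icc a b, g t ≠ 0) :
    ∃ σ κ K : ℝ, |σ| = 1 ∧ 0 < κ ∧ ∀ t ∈ Icc a b, κ ≤ σ * g t ∧ σ * g t ≤ K := by
  have hsign : ∃ σ : ℝ, |σ| = 1 ∧ ∀ t ∈ Icc a b, 0 < σ * g t := by
    have ha : a ∈ Icc a b := left_mem_Icc.2 hab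
    refine ⟨SignType.sign (g a), ?_, fun t ht => ?_⟩
    · rcases lt_or_gt_of_ne (h0 a ha) with h | h
      · simp [sign_neg h]
      · simp [sign_pos h]
    · have hiv := isPreconnected_Icc.image g hg |>.ordConnected
      rcases lt_or_gt_of_ne (h0 a ha) with h | h <;> by_contra hneg
      · rw [sign_neg h] at hneg
        simp only [SignType.coe_neg, SignType.coe_one, neg_mul, one_mul, not_lt] at hneg
        obtain ⟨z, hz, hz0⟩ := hiv.out (mem_image_of_mem g ha) (mem_image_of_mem g ht)
          (show (0 : ℝ) ∈ Icc (g a) (g t) from ⟨h.le, by linarith⟩)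
        exact h0 z hz hz0
      · rw [sign_pos h] at hneg
        simp only [SignType.coe_one, one_mul, not_lt] at hneg
        obtain ⟨z, hz, hz0⟩ := hiv.out (mem_image_of_mem g ht) (mem_image_of_mem g ha)
          (show (0 : ℝ) ∈ Icc (g t) (g a) from ⟨hneg, h.le⟩)
        exact h0 z hz hz0
  obtain ⟨σ, hσ, hpos⟩ := hsign
  have hc : ContinuousOn (fun t => σ * g t) (Icc a b) := continuousOn_const.mul hg
  have hne : (Icc a b).Nonempty := nonempty_Icc.2 hab
  obtain ⟨u, hu, hmin⟩ := isCompact_Icc.exists_isMinOn hne hc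
  obtain ⟨v, hv, hmax⟩ := isCompact_Icc.exists_isMaxOn hne hc
  exact ⟨σ, σ * g u, σ * g v, hσ, hpos u hu, fun t ht => ⟨hmin ht, hmax ht⟩⟩

/-- The graph of a function with non-vanishing first and second derivatives on a compact interval
satisfies `IsCurve`, with comparable coordinates. -/
theorem exists_isCurve {f f' f'' : ℝ → ℝ} {a b : ℝ} (hab : a ≤ b)
    (hf : ∀ t ∈ Icc a b, HasDerivAt f (f' t) t) (hf' : ∀ t ∈ Icc a b, HasDerivAt f' (f'' t) t)
    (hc : ContinuousOn f'' (Icc a b)) (h0' : ∀ t ∈ Icc a b, f' t ≠ 0)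
    (h0'' : ∀ t ∈ Icc a b, f'' t ≠ 0) :
    ∃ K k σ κ s : ℝ, IsCurve (Icc a b) id f f' K k σ ∧ |s| = 1 ∧ 0 < κ ∧ κ ≤ 1 ∧
      (∀ x ∈ Icc a b, κ ≤ s * f' x) ∧ ∀ x ∈ Icc a b, ∀ y ∈ Icc a b,
        κ * |y - x| ≤ |f y - f x| ∧ |f y - f x| ≤ K * |y - x| := by
  obtain ⟨s, κ, L, hs, hκ, hL⟩ := exists_sign_and_bounds hab
    (fun t ht => (hf' t ht).continuousAt.continuousWithinAt) h0'
  obtain ⟨σ, k, K, hσ, hk, hK⟩ := exists_sign_and_bounds hab hc h0''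
  have hord : (Icc a b).OrdConnected := ordConnected_Icc
  have habs' : ∀ t ∈ Icc a b, κ ≤ |f' t| ∧ |f' t| ≤ L := fun t ht => by
    have h1 : |f' t| = s * f' t := by
      rw [← abs_of_nonneg (hκ.le.trans (hL t ht).1), abs_mul, hs, one_mul]
    rw [h1]; exact hL t ht
  have habs'' : ∀ t ∈ Icc a b, |f'' t| ≤ K := fun t ht => by
    have h1 : |f'' t| = σ * f'' t := by
      rw [← abs_of_nonneg (hk.le.trans (hK t ht).1), abs_mul, hσ, one_mul]
    rw [h1]; exact (hK t ht).2
  have htay : ∀ x ∈ Icc a b, ∀ y ∈ Icc a b, k / 2 * |y - x| ^ 2 ≤ σ * (f y - f x - f' x * (y - x)) ∧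
      σ * (f y - f x - f' x * (y - x)) ≤ K / 2 * |y - x| ^ 2 := by
    intro x hx y hy
    rw [sq_abs]
    -- `σ * f` is squeezed between parabolas: subtracting `k / 2 * t ^ 2` leaves a convex function,
    -- and so does subtracting it from `K / 2 * t ^ 2`.
    have hlow := tangent_le_of_monotoneOn (g := fun t => σ * f t - k / 2 * t ^ 2)
      (g' := fun t => σ * f' t - k / 2 * (2 * t)) hord
      (fun t ht => ((hf t ht).const_mul σ).sub
        (by simpa using ((hasDerivAt_pow 2 t).const_mul (k / 2))))
      (monotoneOn_of_hasDerivAt_nonneg (g' := fun t => σ * f'' t - k / 2 * (2 * 1)) hord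
        (fun t ht => ((hf' t ht).const_mul σ).sub
          (((hasDerivAt_id t).const_mul 2).const_mul (k / 2)))
        fun t ht => by linarith [(hK t ht).1]) hx hy
    have hup := tangent_le_of_monotoneOn (g := fun t => K / 2 * t ^ 2 - σ * f t)
      (g' := fun t => K / 2 * (2 * t) - σ * f' t) hord
      (fun t ht => HasDerivAt.sub (by simpa using ((hasDerivAt_pow 2 t).const_mul (K / 2)))
        ((hf t ht).const_mul σ))
      (monotoneOn_of_hasDerivAt_nonneg (g' := fun t => K / 2 * (2 * 1) - σ * f'' t) hord
        (fun t ht => HasDerivAt.sub (((hasDerivAt_id t).const_mul 2).const_mul (K / 2))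
          ((hf' t ht).const_mul σ))
        fun t ht => by linarith [(hK t ht).2]) hx hy
    constructor <;> nlinarith
  have hM₁ : 1 ≤ max 1 (max K L) := le_max_left _ _
  have hMK : K ≤ max 1 (max K L) := (le_max_left _ _).trans (le_max_right _ _)
  have hML : L ≤ max 1 (max K L) := (le_max_right _ _).trans (le_max_right _ _)
  refine ⟨max 1 (max K L), k / 2, σ, min κ 1, s, ⟨hM₁, by positivity, hσ, ?_, ?_, ?_, ?_⟩, hs,
    lt_min hκ one_pos, min_le_right _ _, fun x hx => (min_le_left _ _).trans (hL x hx).1, ?_⟩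
  · exact fun x hx => (habs' x hx).2.trans hML
  · intro x hx y hy
    obtain ⟨ξ, hξ, h⟩ := exists_sub_eq_mul_of_hasDerivAt hord hf' hx hy
    simp only [id]
    rw [h, abs_mul]
    gcongr
    exact (habs'' ξ (hord.uIcc_subset hx hy hξ)).trans hMK
  · intro x hx y hy
    obtain ⟨h1, h2⟩ := htay x hx y hy
    have h3 : |f y - f x - f' x * (y - x)| = σ * (f y - f x - f' x * (y - x)) := by
      rw [← abs_of_nonneg ((by positivity : 0 ≤ k / 2 * |y - x| ^ 2).trans h1), abs_mul, hσ,
        one_mul]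
    simp only [id]
    rw [h3]
    refine h2.trans (mul_le_mul_of_nonneg_right ?_ (by positivity))
    linarith
  · exact fun x hx y hy => (htay x hx y hy).1
  · intro x hx y hy
    obtain ⟨ξ, hξ, h⟩ := exists_sub_eq_mul_of_hasDerivAt hord hf hx hy
    have hξs := habs' ξ (hord.uIcc_subset hx hy hξ)
    rw [h, abs_mul]
    exact ⟨mul_le_mul_of_nonneg_right ((min_le_left _ _).trans hξs.1) (abs_nonneg _),
      mul_le_mul_of_nonneg_right (hξs.2.trans hML) (abs_nonneg _)⟩

theorem IsCurve.comp {ι ι' : Type*} {S : Set ι} {X Y m : ι → ℝ} {K k σ : ℝ}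
    (h : IsCurve S X Y m K k σ) (g : ι' → ι) :
    IsCurve (g ⁻¹' S) (X ∘ g) (Y ∘ g) (m ∘ g) K k σ :=
  ⟨h.one_le, h.pos, h.sign, fun _ hp => h.slope_le _ hp, fun _ hp _ hp' => h.slope_sub_le _ hp _ hp',
    fun _ hp _ hp' => h.taylor_le _ hp _ hp', fun _ hp _ hp' => h.le_taylor _ hp _ hp'⟩

/-- Exchanging the coordinates of a curve whose slope is bounded away from zero. -/
theorem IsCurve.swap {ι : Type*} {S : Set ι} {X Y m : ι → ℝ} {K k σ κ s : ℝ}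
    (h : IsCurve S X Y m K k σ) (hs : |s| = 1) (hκ : 0 < κ) (hκ1 : κ ≤ 1)
    (hm : ∀ p ∈ S, κ ≤ s * m p)
    (hXY : ∀ p ∈ S, ∀ p' ∈ S, κ * |X p' - X p| ≤ |Y p' - Y p|)
    (hYX : ∀ p ∈ S, ∀ p' ∈ S, |Y p' - Y p| ≤ K * |X p' - X p|) :
    IsCurve S Y X (fun p => (m p)⁻¹) (K / κ ^ 3) (k / K ^ 3) (-(σ * s)) := by
  have hK := h.one_le
  have hK0 : 0 < K := by linarith
  have hk := h.pos
  have habs : ∀ p ∈ S, κ ≤ |m p| := fun p hp => by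
    have h1 := hm p hp
    rwa [← abs_of_nonneg (hκ.le.trans h1), abs_mul, hs, one_mul] at h1
  have hm0 : ∀ p ∈ S, m p ≠ 0 := fun p hp => abs_pos.1 (hκ.trans_le (habs p hp))
  have hΔ : ∀ p ∈ S, ∀ p' ∈ S, |X p' - X p| ≤ |Y p' - Y p| / κ := fun p hp p' hp' => by
    rw [le_div_iff₀ hκ, mul_comm]; exact hXY p hp p' hp'
  -- The Taylor remainder of the inverse function is `-(m p)⁻¹` times the old one, whence the new
  -- sign `-(σ * s)`.
  have hid : ∀ p ∈ S, ∀ p' ∈ S, X p' - X p - (m p)⁻¹ * (Y p' - Y p) =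
      -((m p)⁻¹ * (Y p' - Y p - m p * (X p' - X p))) := fun p hp p' _ => by
    have := hm0 p hp
    field_simp
    ring
  refine ⟨?_, by positivity, by rw [abs_neg, abs_mul, h.sign, hs, one_mul], ?_, ?_, ?_, ?_⟩
  · rw [one_le_div (by positivity)]
    exact (pow_le_one₀ hκ.le hκ1).trans hK
  · intro p hp
    rw [abs_inv]
    calc |m p|⁻¹ ≤ κ⁻¹ := inv_anti₀ hκ (habs p hp)
      _ = 1 / κ ^ 1 := by rw [pow_one, one_div]
      _ ≤ K / κ ^ 3 := div_le_div₀ hK0.le hK (by positivity)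
          (pow_le_pow_of_le_one hκ.le hκ1 (by norm_num))
  · intro p hp p' hp'
    rw [inv_sub_inv (hm0 p' hp') (hm0 p hp), abs_div, abs_mul, abs_sub_comm (m p)]
    calc |m p' - m p| / (|m p'| * |m p|) ≤ K * (|Y p' - Y p| / κ) / (κ * κ) := by
          refine div_le_div₀ (by positivity) ((h.slope_sub_le p hp p' hp').trans ?_)
            (by positivity) (mul_le_mul (habs p' hp') (habs p hp) hκ.le (abs_nonneg _))
          exact mul_le_mul_of_nonneg_left (hΔ p hp p' hp') hK0.le
      _ = K / κ ^ 3 * |Y p' - Y p| := by field_simp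
  · intro p hp p' hp'
    rw [hid p hp p' hp', abs_neg, abs_mul, abs_inv]
    calc |m p|⁻¹ * |Y p' - Y p - m p * (X p' - X p)|
        ≤ κ⁻¹ * (K * (|Y p' - Y p| / κ) ^ 2) := by
          refine mul_le_mul (inv_anti₀ hκ (habs p hp)) ((h.taylor_le p hp p' hp').trans ?_)
            (abs_nonneg _) (by positivity)
          have := hΔ p hp p' hp'
          gcongr
      _ = K / κ ^ 3 * |Y p' - Y p| ^ 2 := by field_simp
  · intro p hp p' hp'
    have hsm : s * (m p)⁻¹ = |m p|⁻¹ := by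
      have h1 : |m p| = s * m p := by
        rw [← abs_of_nonneg (hκ.le.trans (hm p hp)), abs_mul, hs, one_mul]
      have h2 : s * s = 1 := by rw [← abs_mul_abs_self, hs, one_mul]
      have h3 : s ≠ 0 := fun h => by simp [h] at hs
      have := hm0 p hp
      rw [h1]
      field_simp
      linarith
    have hKm : K⁻¹ ≤ |m p|⁻¹ := inv_anti₀ (hκ.trans_le (habs p hp)) (h.slope_le p hp)
    rw [hid p hp p' hp']
    calc k / K ^ 3 * |Y p' - Y p| ^ 2 ≤ k / K ^ 3 * (K * |X p' - X p|) ^ 2 := by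
          have := hYX p hp p' hp'
          gcongr
      _ = K⁻¹ * (k * |X p' - X p| ^ 2) := by field_simp
      _ ≤ |m p|⁻¹ * (σ * (Y p' - Y p - m p * (X p' - X p))) :=
          mul_le_mul hKm (h.le_taylor p hp p' hp') (by positivity) (by positivity)
      _ = -(σ * s) * -((m p)⁻¹ * (Y p' - Y p - m p * (X p' - X p))) := by
          rw [← hsm]; ring

end Calculus

/-! ### Signed arc length as an isometry to an interval -/

section CurveMetric

variable {f : ℝ → ℝ} {I : Set ℝ}

theorem CurvePoint.fst_mem (p : CurvePoint f I) : p.1 0 ∈ I := by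
  obtain ⟨_, s, hs, rfl⟩ := p
  simpa [graphPt] using hs

theorem CurvePoint.snd_eq (p : CurvePoint f I) : p.1 1 = f (p.1 0) := by
  obtain ⟨_, s, hs, rfl⟩ := p
  simp [graphPt]

theorem CurvePoint.eq_graphPt (p : CurvePoint f I) : graphPt f (p.1 0) = p.1 := by
  obtain ⟨_, s, hs, rfl⟩ := p
  simp [graphPt]

theorem CurvePoint.exists_fst_eq {t : ℝ} (ht : t ∈ I) : ∃ p : CurvePoint f I, p.1 0 = t :=
  ⟨⟨graphPt f t, t, ht, rfl⟩, by simp [graphPt]⟩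

theorem CurvePoint.ofReal_abs_sub_le_edist (p q : CurvePoint f I) (a : Fin 2) :
    ENNReal.ofReal |q.1 a - p.1 a| ≤ edist p q := by
  refine le_trans ?_ (edist_graphPt_le_arcLength f (p.1 0) (q.1 0))
  rw [CurvePoint.eq_graphPt, CurvePoint.eq_graphPt, edist_comm, edist_dist, dist_eq_norm]
  exact ENNReal.ofReal_le_ofReal (by simpa using PiLp.norm_apply_le (q.1 - p.1) a)

theorem exists_lipschitzOnWith_graphPt (hf : ContDiffOn ℝ 1 f I) {a b : ℝ} (h : Icc a b ⊆ I) :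
    ∃ L, LipschitzOnWith L (graphPt f) (Icc a b) := by
  have hg : ContDiffOn ℝ 1 (graphPt f) (Icc a b) := by
    rw [contDiffOn_euclidean]
    intro i
    fin_cases i
    · simp only [graphPt, Fin.zero_eta, PiLp.toLp_apply, Matrix.cons_val_zero]
      exact contDiffOn_id
    · simpa [graphPt] using hf.mono h
  refine LocallyLipschitzOn.exists_lipschitzOnWith_of_compact isCompact_Icc fun x hx => ?_
  exact (hg x hx).exists_lipschitzOnWith (convex_Icc a b)

theorem arcLength_le_of_lipschitzOnWith {L : NNReal} {a b x y : ℝ}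
    (hL : LipschitzOnWith L (graphPt f) (Icc a b)) (hx : x ∈ Icc a b) (hy : y ∈ Icc a b) :
    arcLength f x y ≤ L * ENNReal.ofReal |y - x| := by
  wlog hxy : x ≤ y generalizing x y
  · rw [arcLength_comm, abs_sub_comm]
    exact this hy hx (le_of_not_ge hxy)
  have h1 : MapsTo id (Icc x y) (Icc a b) := Icc_subset_Icc hx.1 hy.2
  have h2 := hL.comp_eVariationOn_le h1
  rw [Function.comp_id] at h2
  rw [arcLength, uIcc_of_le hxy, abs_of_nonneg (sub_nonneg.2 hxy)]
  refine h2.trans (mul_le_mul_right ?_ _)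
  simp

theorem locallyBoundedVariationOn_graphPt (hI : I.OrdConnected) (hf : ContDiffOn ℝ 1 f I) :
    LocallyBoundedVariationOn (graphPt f) I := by
  intro a b ha hb
  obtain ⟨L, hL⟩ := exists_lipschitzOnWith_graphPt hf (hI.out ha hb)
  rcases le_total a b with hab | hab
  · rw [inter_eq_right.2 (hI.out ha hb), ← uIcc_of_le hab]
    exact ne_top_of_le_ne_top (ENNReal.mul_ne_top ENNReal.coe_ne_top ENNReal.ofReal_ne_top)
      (arcLength_le_of_lipschitzOnWith hL (left_mem_Icc.2 hab) (right_mem_Icc.2 hab))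
  · exact BoundedVariationOn.of_subsingleton
      ((subsingleton_Icc_of_ge hab).anti inter_subset_right)

theorem ofReal_abs_variationOnFromTo (hI : I.OrdConnected)
    (hf : LocallyBoundedVariationOn (graphPt f) I) {x y : ℝ} (hx : x ∈ I) (hy : y ∈ I) :
    ENNReal.ofReal |variationOnFromTo (graphPt f) I x y| = arcLength f x y := by
  wlog hxy : x ≤ y generalizing x y
  · rw [variationOnFromTo.eq_neg_swap, abs_neg, arcLength_comm]
    exact this hy hx (le_of_not_ge hxy)
  rw [abs_of_nonneg (variationOnFromTo.nonneg_of_le _ _ hxy), variationOnFromTo.eq_of_le _ _ hxy,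
    ENNReal.ofReal_toReal (hf x y hx hy), inter_eq_right.2 (hI.out hx hy), arcLength,
    uIcc_of_le hxy]

/-- The signed length of the arc from the point over `t₀`. -/
noncomputable def CurvePoint.signedLength (t₀ : ℝ) (p : CurvePoint f I) : ℝ :=
  variationOnFromTo (graphPt f) I t₀ (p.1 0)

variable {t₀ : ℝ}

theorem CurvePoint.signedLength_sub (hf : LocallyBoundedVariationOn (graphPt f) I) (ht₀ : t₀ ∈ I)
    (p q : CurvePoint f I) : q.signedLength t₀ - p.signedLength t₀ =
      variationOnFromTo (graphPt f) I (p.1 0) (q.1 0) := by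
  rw [sub_eq_iff_eq_add', signedLength, signedLength,
    variationOnFromTo.add hf ht₀ p.fst_mem q.fst_mem]

theorem CurvePoint.isometry_signedLength (hI : I.OrdConnected)
    (hf : LocallyBoundedVariationOn (graphPt f) I) (ht₀ : t₀ ∈ I) :
    Isometry (CurvePoint.signedLength (f := f) (I := I) t₀) := by
  intro p q
  rw [edist_comm, edist_dist, Real.dist_eq, signedLength_sub hf ht₀,
    ofReal_abs_variationOnFromTo hI hf p.fst_mem q.fst_mem]
  rfl

theorem CurvePoint.signedLength_lt_iff (hI : I.OrdConnected)
    (hf : LocallyBoundedVariationOn (graphPt f) I) (ht₀ : t₀ ∈ I) {p q : CurvePoint f I} :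
    p.signedLength t₀ < q.signedLength t₀ ↔ p.1 0 < q.1 0 := by
  have hmono : ∀ p q : CurvePoint f I, p.1 0 ≤ q.1 0 → p.signedLength t₀ ≤ q.signedLength t₀ :=
    fun p q h => by
      rw [← sub_nonneg, signedLength_sub hf ht₀]
      exact variationOnFromTo.nonneg_of_le _ _ h
  constructor
  · intro h
    by_contra h1
    exact absurd (hmono q p (not_lt.1 h1)) (not_le.2 h)
  · intro h
    refine (hmono p q h.le).lt_of_ne fun h1 => ?_
    rw [(isometry_signedLength hI hf ht₀).injective h1] at h
    exact lt_irrefl _ h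

theorem CurvePoint.signedLength_le_iff (hI : I.OrdConnected)
    (hf : LocallyBoundedVariationOn (graphPt f) I) (ht₀ : t₀ ∈ I) {p q : CurvePoint f I} :
    p.signedLength t₀ ≤ q.signedLength t₀ ↔ p.1 0 ≤ q.1 0 := by
  rw [← not_lt, ← not_lt, signedLength_lt_iff hI hf ht₀]

/-- Over compact parameter intervals the signed length is Lipschitz, so the intermediate value
theorem applies. -/
theorem CurvePoint.ordConnected_range_signedLength (hI : I.OrdConnected) (hf : ContDiffOn ℝ 1 f I)
    (ht₀ : t₀ ∈ I) : (range (CurvePoint.signedLength (f := f) (I := I) t₀)).OrdConnected := by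
  have hbv := locallyBoundedVariationOn_graphPt hI hf
  refine ⟨?_⟩
  rintro _ ⟨p, rfl⟩ _ ⟨q, rfl⟩ z hz
  have hpq := (signedLength_le_iff hI hbv ht₀).1 (hz.1.trans hz.2)
  have hsub := hI.out p.fst_mem q.fst_mem
  obtain ⟨L, hL⟩ := exists_lipschitzOnWith_graphPt hf hsub
  have hΦ : LipschitzOnWith L (variationOnFromTo (graphPt f) I t₀) (Icc (p.1 0) (q.1 0)) := by
    intro x hx y hy
    rw [edist_comm, edist_dist, Real.dist_eq, edist_comm x, edist_dist y, Real.dist_eq,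
      sub_eq_iff_eq_add'.2 (variationOnFromTo.add hbv ht₀ (hsub hx) (hsub hy)).symm,
      ofReal_abs_variationOnFromTo hI hbv (hsub hx) (hsub hy)]
    exact arcLength_le_of_lipschitzOnWith hL hx hy
  obtain ⟨t, ht, htz⟩ := intermediate_value_Icc hpq hΦ.continuousOn hz
  obtain ⟨p', rfl⟩ := CurvePoint.exists_fst_eq (f := f) (hsub ht)
  exact ⟨p', htz⟩

theorem CurvePoint.nontrivial_range_signedLength (hI : I.OrdConnected) (hI' : I.Nontrivial)
    (hf : LocallyBoundedVariationOn (graphPt f) I) (ht₀ : t₀ ∈ I) :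
    (range (CurvePoint.signedLength (f := f) (I := I) t₀)).Nontrivial := by
  obtain ⟨x, hx, y, hy, hxy⟩ := hI'
  obtain ⟨p, rfl⟩ := CurvePoint.exists_fst_eq (f := f) hx
  obtain ⟨q, rfl⟩ := CurvePoint.exists_fst_eq (f := f) hy
  exact ⟨_, ⟨p, rfl⟩, _, ⟨q, rfl⟩, fun h =>
    hxy (by rw [(isometry_signedLength hI hf ht₀).injective h])⟩

/-- A set of points of the curve which is an arc is the set of points over an interval. -/
theorem CurvePoint.exists_eq_preimage_Icc (hI : I.OrdConnected)
    (hf : LocallyBoundedVariationOn (graphPt f) I) (ht₀ : t₀ ∈ I) {A : Set (CurvePoint f I)}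
    {u v : ℝ} (huv : u ≤ v) (hA : CurvePoint.signedLength t₀ '' A = Icc u v) :
    ∃ p ∈ A, ∃ q ∈ A, p.signedLength t₀ = u ∧ q.signedLength t₀ = v ∧
      A = {r | r.1 0 ∈ Icc (p.1 0) (q.1 0)} := by
  obtain ⟨p, hp, hpu⟩ := hA.symm.subset (left_mem_Icc.2 huv)
  obtain ⟨q, hq, hqv⟩ := hA.symm.subset (right_mem_Icc.2 huv)
  refine ⟨p, hp, q, hq, hpu, hqv, Subset.antisymm (fun r hr => ?_) fun r hr => ?_⟩
  · have h : r.signedLength t₀ ∈ Icc u v := hA.subset ⟨r, hr, rfl⟩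
    rw [← hpu, ← hqv] at h
    exact ⟨(signedLength_le_iff hI hf ht₀).1 h.1, (signedLength_le_iff hI hf ht₀).1 h.2⟩
  · have h : r.signedLength t₀ ∈ Icc u v := by
      rw [← hpu, ← hqv]
      exact ⟨(signedLength_le_iff hI hf ht₀).2 hr.1, (signedLength_le_iff hI hf ht₀).2 hr.2⟩
    obtain ⟨r', hr', h'⟩ := hA.symm.subset h
    rwa [← (isometry_signedLength hI hf ht₀).injective h']

end CurveMetric

/-! ### From coordinates to arc length, and the first move -/

section Winning

theorem IsCurve.exists_clusters_ediam {M : Type*} [PseudoEMetricSpace M] {A : Set M}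
    {X Y m : M → ℝ} {K k σ i j : ℝ} (hc : IsCurve A X Y m K k σ) (hj : 0 < j) (hji : j ≤ i)
    (hij : i + j = 1) (γ δ : ℝ) {Λ D ϱ : ℝ} (hΛ : 0 < Λ) (hD : 0 < D) (hϱ : 0 < ϱ) (hϱ1 : ϱ < 1)
    (hX : ∀ p ∈ A, ∀ p' ∈ A, ENNReal.ofReal |X p' - X p| ≤ edist p p')
    (hX' : ∀ p ∈ A, ∀ p' ∈ A, edist p p' ≤ ENNReal.ofReal (Λ * |X p' - X p|)) :
    ∃ T : ℕ → ℕ → Set M,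
      (∀ n N, 1 ≤ n → n + 10 ≤ N → ∀ J ⊆ A, Metric.ediam J ≤ ENNReal.ofReal (D * ϱ ^ n) →
        (∀ n' N', 1 ≤ n' → n' + 10 ≤ N' → N' ≤ n → Disjoint J (T n' N')) →
        ∃ C : Fin 4 → Set M, J ∩ T n N ⊆ ⋃ a, C a ∧
          ∀ a, Metric.ediam (C a) ≤ ENNReal.ofReal (D * ϱ ^ N)) ∧
      ∀ p ∈ A, (∀ n N, 1 ≤ n → n + 10 ≤ N → p ∉ T n N) →
        ∃ c : ℝ, 0 < c ∧ ∀ q : ℕ, 1 ≤ q → c / (q : ℝ) <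
          max (distInt (q * X p - γ) ^ (1 / i)) (distInt (q * Y p - δ) ^ (1 / j)) := by
  -- Balls are measured by `D` because `X` does not increase distances; clusters by `D / Λ` because
  -- arc length may exceed the difference of `X` by the factor `Λ`.
  obtain ⟨T, hT, hbad⟩ := hc.exists_clusters hj hji hij γ δ hD (div_pos hD hΛ) hϱ hϱ1
  refine ⟨T, fun n N hn hN J hJ hJd hdis => ?_, hbad⟩
  obtain ⟨C, hcov, hC⟩ := hT n N hn hN J hJ (fun p hp p' hp' => by
    have h := ((hX p (hJ hp) p' (hJ hp')).trans (Metric.edist_le_ediam_of_mem hp hp')).trans hJd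
    exact (ENNReal.ofReal_le_ofReal_iff (by positivity)).1 h) hdis
  refine ⟨C, hcov, fun a => Metric.ediam_le fun p hp p' hp' => ?_⟩
  refine (hX' p (hJ ((hC a).1 hp)) p' (hJ ((hC a).1 hp'))).trans (ENNReal.ofReal_le_ofReal ?_)
  calc Λ * |X p' - X p| ≤ Λ * (D / Λ * ϱ ^ N) :=
        mul_le_mul_of_nonneg_left ((hC a).2 p hp p' hp') hΛ.le
    _ = D * ϱ ^ N := by field_simp

variable {f : ℝ → ℝ} {I : Set ℝ}

theorem hasDerivAt_of_contDiffOn_two (hf : ContDiffOn ℝ 2 f I) :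
    (∀ t ∈ interior I, HasDerivAt f (deriv f t) t) ∧
      (∀ t ∈ interior I, HasDerivAt (deriv f) (deriv (deriv f) t) t) ∧
      ContinuousOn (deriv (deriv f)) (interior I) := by
  have hU : IsOpen (interior I) := isOpen_interior
  have h2 : ContDiffOn ℝ (1 + 1) f (interior I) := by
    rw [one_add_one_eq_two]; exact hf.mono interior_subset
  have h1 : ContDiffOn ℝ (0 + 1) (deriv f) (interior I) := by
    rw [zero_add]; exact ((contDiffOn_succ_iff_deriv_of_isOpen hU).1 h2).2.2
  refine ⟨fun t ht => ?_, fun t ht => ?_, ?_⟩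
  · exact ((h2.differentiableOn (by norm_num)).differentiableAt (hU.mem_nhds ht)).hasDerivAt
  · exact ((h1.differentiableOn (by norm_num)).differentiableAt (hU.mem_nhds ht)).hasDerivAt
  · exact ((contDiffOn_succ_iff_deriv_of_isOpen hU).1 h1).2.2.continuousOn

theorem deriv_deriv_ne_zero (hI : I.OrdConnected) (hf : ContDiffOn ℝ 2 f I)
    (hf'' : ∀ x ∈ I, iteratedDerivWithin 2 f I x ≠ 0) {t : ℝ} (ht : t ∈ interior I) :
    deriv (deriv f) t ≠ 0 := by
  have hs : UniqueDiffOn ℝ I := uniqueDiffOn_convex hI.convex ⟨t, ht⟩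
  have h := hf'' t (interior_subset ht)
  rwa [iteratedDerivWithin_eq_iteratedDeriv hs
    ((hf t (interior_subset ht)).contDiffAt (mem_interior_iff_mem_nhds.1 ht)) (interior_subset ht),
    iteratedDeriv_succ, iteratedDeriv_one] at h

/-- The points over a compact interval on which the first and second derivatives of `f` do not
vanish and which are not badly approximable can be removed in few small clusters. -/
theorem exists_clusters_of_deriv_ne_zero (hI : I.OrdConnected) (hf : ContDiffOn ℝ 2 f I)
    (hf'' : ∀ x ∈ I, iteratedDerivWithin 2 f I x ≠ 0) {a b : ℝ} (hab : a ≤ b)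
    (hsub : Icc a b ⊆ interior I) (hd : ∀ t ∈ Icc a b, deriv f t ≠ 0) {i j : ℝ} (hi : 0 < i)
    (hj : 0 < j) (hij : i + j = 1) (γ δ : ℝ) {D ϱ : ℝ} (hD : 0 < D) (hϱ : 0 < ϱ) (hϱ1 : ϱ < 1) :
    ∃ T : ℕ → ℕ → Set (CurvePoint f I),
      (∀ n N, 1 ≤ n → n + 10 ≤ N → ∀ J ⊆ {p : CurvePoint f I | p.1 0 ∈ Icc a b},
        Metric.ediam J ≤ ENNReal.ofReal (D * ϱ ^ n) →
        (∀ n' N', 1 ≤ n' → n' + 10 ≤ N' → N' ≤ n → Disjoint J (T n' N')) →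
        ∃ C : Fin 4 → Set (CurvePoint f I), J ∩ T n N ⊆ ⋃ a, C a ∧
          ∀ a, Metric.ediam (C a) ≤ ENNReal.ofReal (D * ϱ ^ N)) ∧
      ∀ p ∈ {p : CurvePoint f I | p.1 0 ∈ Icc a b},
        (∀ n N, 1 ≤ n → n + 10 ≤ N → p ∉ T n N) → p.1 ∈ Bad i j γ δ := by
  obtain ⟨h1, h2, h3⟩ := hasDerivAt_of_contDiffOn_two hf
  obtain ⟨K, k, σ, κ, s, hc, hs, hκ, hκ1, hm, hXY⟩ := exists_isCurve hab
    (fun t ht => h1 t (hsub ht)) (fun t ht => h2 t (hsub ht)) (h3.mono hsub) hd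
    fun t ht => deriv_deriv_ne_zero hI hf hf'' (hsub ht)
  obtain ⟨L, hL⟩ := exists_lipschitzOnWith_graphPt (hf.of_le one_le_two)
    (hsub.trans interior_subset)
  have hΛ : (0 : ℝ) < L + 1 := by positivity
  set A : Set (CurvePoint f I) := {p | p.1 0 ∈ Icc a b}
  have hcA : IsCurve A (fun p => p.1 0) (fun p => p.1 1) (fun p => deriv f (p.1 0)) K k σ := by
    rw [show (fun p : CurvePoint f I => p.1 1) = fun p => f (p.1 0) from funext fun p => p.snd_eq]
    exact hc.comp fun p : CurvePoint f I => p.1 0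
  have hXYA : ∀ p ∈ A, ∀ p' ∈ A, κ * |p'.1 0 - p.1 0| ≤ |p'.1 1 - p.1 1| ∧
      |p'.1 1 - p.1 1| ≤ K * |p'.1 0 - p.1 0| := fun p hp p' hp' => by
    rw [p.snd_eq, p'.snd_eq]; exact hXY _ hp _ hp'
  have hlen : ∀ p ∈ A, ∀ p' ∈ A, edist p p' ≤ ENNReal.ofReal ((L + 1) * |p'.1 0 - p.1 0|) := by
    intro p hp p' hp'
    refine (arcLength_le_of_lipschitzOnWith hL hp hp').trans ?_
    rw [ENNReal.ofReal_mul hΛ.le]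
    gcongr
    rw [← ENNReal.ofReal_coe_nnreal]
    exact ENNReal.ofReal_le_ofReal (by linarith)
  -- For `i ≤ j` the coordinates are exchanged, together with `γ` and `δ`; this is where `f' ≠ 0` is
  -- needed.
  rcases le_total j i with hji | hji
  · exact hcA.exists_clusters_ediam hj hji hij γ δ hΛ hD hϱ hϱ1
      (fun p _ p' _ => p.ofReal_abs_sub_le_edist p' 0) hlen
  · obtain ⟨T, hT, hbad⟩ := (hcA.swap hs hκ hκ1 (fun p hp => hm _ hp)
      (fun p hp p' hp' => (hXYA p hp p' hp').1)
      fun p hp p' hp' => (hXYA p hp p' hp').2).exists_clusters_ediam hi hji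
        (by rwa [add_comm]) δ γ (Λ := (L + 1) / κ) (by positivity) hD hϱ hϱ1
        (fun p _ p' _ => p.ofReal_abs_sub_le_edist p' 1)
        (fun p hp p' hp' => (hlen p hp p' hp').trans (ENNReal.ofReal_le_ofReal (by
          rw [div_mul_eq_mul_div, le_div_iff₀ hκ, mul_assoc, mul_comm _ κ]
          exact mul_le_mul_of_nonneg_left (hXYA p hp p' hp').1 hΛ.le)))
    refine ⟨T, hT, fun p hp hpT => ?_⟩
    obtain ⟨c, hc0, h⟩ := hbad p hp hpT
    exact ⟨c, hc0, fun q hq => by rw [max_comm]; exact h q hq⟩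

/-- If `f'` vanished on both of two disjoint intervals, then `f''` would vanish in between. -/
theorem forall_deriv_ne_zero_or (hI : I.OrdConnected) (hf : ContDiffOn ℝ 2 f I)
    (hf'' : ∀ x ∈ I, iteratedDerivWithin 2 f I x ≠ 0) {a b a' b' : ℝ} (hba : b < a')
    (hsub : Icc a b' ⊆ interior I) :
    (∀ t ∈ Icc a b, deriv f t ≠ 0) ∨ ∀ t ∈ Icc a' b', deriv f t ≠ 0 := by
  by_contra! h
  obtain ⟨⟨t, ht, ht0⟩, t', ht', ht0'⟩ := h
  have hlt : t < t' := (ht.2.trans_lt hba).trans_le ht'.1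
  have hsub' : Icc t t' ⊆ interior I := (Icc_subset_Icc ht.1 ht'.2).trans hsub
  obtain ⟨c, hc, hc0⟩ := exists_deriv_eq_zero hlt
    (fun x hx => ((hasDerivAt_of_contDiffOn_two hf).2.1 x
      (hsub' hx)).continuousAt.continuousWithinAt) (ht0.trans ht0'.symm)
  exact deriv_deriv_ne_zero hI hf hf'' (hsub' (Ioo_subset_Icc_self hc)) hc0

end Winning

end

theorem theorem1 (i j : ℝ) (hi0 : 0 < i) (hi1 : i < 1) (hj0 : 0 < j) (hj1 : j < 1)
    (hij : i + j = 1) (I : Set ℝ) (hI : I.OrdConnected) (hI' : I.Nontrivial)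
    (f : ℝ → ℝ) (hf : ContDiffOn ℝ 2 f I) (hf'' : ∀ x ∈ I, iteratedDerivWithin 2 f I x ≠ 0)
    (γ δ : ℝ) :
    IsWinning {p : CurvePoint f I | p.1 ∈ Bad i j γ δ} := by
  have hf1 : ContDiffOn ℝ 1 f I := hf.of_le one_le_two
  have hbv := locallyBoundedVariationOn_graphPt hI hf1
  obtain ⟨t₀, ht₀⟩ := hI'.nonempty
  have hφ := CurvePoint.isometry_signedLength hI hbv ht₀
  have hord := CurvePoint.ordConnected_range_signedLength hI hf1 ht₀
  refine ⟨1 / 4, by norm_num, by norm_num, isAlphaWinning_of_clusters hφ hord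
    (CurvePoint.nontrivial_range_signedLength hI hI' hbv ht₀) _ fun β D hβ hβ1 hD B₀ hB hBD => ?_⟩
  obtain ⟨A, A', u, hA, hA', hu, hAφ, hAφ'⟩ := hB.exists_two_moves hφ hord hD hBD
  obtain ⟨p, hp, q, hq, hpu, hqu, hApq⟩ :=
    CurvePoint.exists_eq_preimage_Icc hI hbv ht₀ (by linarith) hAφ
  obtain ⟨p', hp', q', hq', hpu', hqu', hApq'⟩ :=
    CurvePoint.exists_eq_preimage_Icc hI hbv ht₀ (by linarith) hAφ'
  have hcA : IsCompact A := hφ.isEmbedding.isInducing.isCompact_iff.2 (hAφ ▸ isCompact_Icc)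
  have hcA' : IsCompact A' := hφ.isEmbedding.isInducing.isCompact_iff.2 (hAφ' ▸ isCompact_Icc)
  -- Points of the curve beyond both arcs show that the arcs lie over the interior of `I`, where
  -- ordinary derivatives are available.
  obtain ⟨v, -, hv⟩ := hu (show u + D / 16 ∈ Ioo u (u + D) from ⟨by linarith, by linarith⟩)
  obtain ⟨w, -, hw⟩ := hu (show u + 15 * D / 16 ∈ Ioo u (u + D) from ⟨by linarith, by linarith⟩)
  have hlt := @CurvePoint.signedLength_lt_iff f I t₀ hI hbv ht₀
  have hle := @CurvePoint.signedLength_le_iff f I t₀ hI hbv ht₀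
  have hsub : Icc (p.1 0) (q'.1 0) ⊆ interior I := by
    have h1 : v.1 0 < p.1 0 := hlt.1 (by rw [hv, hpu]; linarith)
    have h2 : q'.1 0 < w.1 0 := hlt.1 (by rw [hw, hqu']; linarith)
    refine (Icc_subset_Ioo h1 h2).trans (interior_maximal ?_ isOpen_Ioo)
    exact Ioo_subset_Icc_self.trans (hI.out v.fst_mem w.fst_mem)
  have hpq : p.1 0 ≤ q.1 0 := hle.1 (by rw [hpu, hqu]; linarith)
  have hqp : q.1 0 < p'.1 0 := hlt.1 (by rw [hqu, hpu']; linarith)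
  have hpq' : p'.1 0 ≤ q'.1 0 := hle.1 (by rw [hpu', hqu']; linarith)
  -- A's first move goes to an arc on which `f'` does not vanish.
  rcases forall_deriv_ne_zero_or hI hf hf'' hqp hsub with hd | hd
  · refine ⟨A, hA, hcA, ?_⟩
    rw [hApq]
    exact exists_clusters_of_deriv_ne_zero hI hf hf'' hpq
      ((Icc_subset_Icc_right (hqp.le.trans hpq')).trans hsub) hd hi0 hj0 hij γ δ hD
      (by positivity) (by linarith)
  · refine ⟨A', hA', hcA', ?_⟩
    rw [hApq']
    exact exists_clusters_of_deriv_ne_zero hI hf hf'' hpq'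
      ((Icc_subset_Icc_left (hpq.trans hqp.le)).trans hsub) hd hi0 hj0 hij γ δ hD
      (by positivity) (by linarith)
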